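/- Let $n\ge 1$ and write $|\cdot|$ for Lebesgue measure. For a set $K\subset\mathbb{R}^n$ that is compact and convex, or an open ball, let $h_{\Pi K}$ be the positively homogeneous function on $\mathbb{R}^n$ with $h_{\Pi K}(u)=|P_{u^\perp}K|$ for unit vectors $u$, where $P_{u^\perp}$ is the orthogonal projection onto $u^\perp$ and $|P_{u^\perp}K|$ is the $(n-1)$-dimensional volume in $u^\perp$ (for $n=1$ it is the counting measure of the one-point space $u^\perp$), and let $\Pi^\circ K=\{x\in\mathbb{R}^n : h_{\Pi K}(x)\le 1\}$ be the polar projection body. For a set $A\subset\mathbb{R}^n$ of finite volume let $A^*$ be the open Euclidean ball centred at the origin with $|A^*|=|A|$, and for an integrable $f:\mathbb{R}^n\to[0,\infty)$ let $f^*(x)=\int_0^\infty \mathbf 1_{\{f>t\}^*}(x)\,dt$ be its symmetric decreasing rearrangement. For an $n\times m$ matrix $X$ with columns $X_1,\dots,X_m$ and $C\subset\mathbb{R}^m$ let $XC=\{\sum_j c_jX_j : c\in C\}$. **Theorem.** (a) Let $C\subset\mathbb{R}^m$ be a compact convex set, let $f$ be a probability density on $\mathbb{R}^n$, and let $X$ and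 $X^{\#}$ be $n\times m$ random matrices with independent columns distributed according to the densities $f$ and $f^*$, respectively. Then for every radial measure $\nu$ on $\mathbb{R}^n$ with decreasing density, i.e. $d\nu(x)=\rho(|x|)\,dx$ with $\rho\ge 0$ non-increasing on $(0,\infty)$, $$\mathbb{E}\,\nu\bigl(\Pi^\circ(XC)\bigr)\le \mathbb{E}\,\nu\bigl(\Pi^\circ(X^{\#}C)\bigr),$$ as an inequality in $[0,\infty]$. (b) In particular, let $K\subset\mathbb{R}^n$ be a convex body (compact, convex, with non-empty interior), and let $[K]_m$ and $[K^*]_m$ be the convex hulls of $m$ independent random points distributed uniformly in $K$ and in $K^*$, respectively. Then $$\mathbb{E}\,|\Pi^\circ([K]_m)|\le \mathbb{E}\,|\Pi^\circ([K^*]_m)|.$$ (c) Consequently, Petty's projection inequality holds: $|\Pi^\circ(K)|\le|\Pi^\circ(K^*)|$ for every convex body $K\subset\mathbb{R}^n$. -/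

import Mathlib

open MeasureTheory ProbabilityTheory Set
open scoped ENNReal

noncomputable section

/-- Lebesgue measure of the linear subspace `S` of `ℝⁿ`, normalised by the inner product inherited
from `ℝⁿ`: the parallelepiped spanned by an orthonormal basis of `S` has measure `1`.
The instance is named so as not to confuse it with the restriction to `S` of the ambient Lebesgue
measure, which vanishes on proper subspaces. -/
def subspaceVolume {n : ℕ} (S : Submodule ℝ (EuclideanSpace ℝ (Fin n))) : Measure S :=
  (measureSpaceOfInnerProductSpace (E := S)).volume

/-- Support function of the projection body: `h_{ΠK}(u) = |P_{u^⊥} K|` (the `(n-1)`-dimensional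
volume) for unit vectors `u`, extended to all of `ℝⁿ` by positive homogeneity.
Here `(ℝ ∙ x)ᗮ = x^⊥` depends only on the direction of `x`. -/
def projectionBodySupport {n : ℕ} (K : Set (EuclideanSpace ℝ (Fin n)))
    (x : EuclideanSpace ℝ (Fin n)) : ℝ≥0∞ :=
  ENNReal.ofReal ‖x‖ *
    subspaceVolume (Submodule.span ℝ {x})ᗮ
      ((Submodule.span ℝ {x})ᗮ.orthogonalProjectionOnto '' K)

/-- The polar projection body `Π°K = (ΠK)° = {x : h_{ΠK}(x) ≤ 1}`. -/
def polarProjectionBody {n : ℕ} (K : Set (EuclideanSpace ℝ (Fin n))) :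
    Set (EuclideanSpace ℝ (Fin n)) :=
  {x | projectionBodySupport K x ≤ 1}

/-- The set `[x₁ … x_m] C = {∑ⱼ cⱼ xⱼ : c ∈ C}`, the image of `C ⊆ ℝᵐ` under the `n × m` matrix
whose columns are `x₁, …, x_m ∈ ℝⁿ`. -/
def matrixImage {n m : ℕ} (x : Fin m → EuclideanSpace ℝ (Fin n))
    (C : Set (EuclideanSpace ℝ (Fin m))) : Set (EuclideanSpace ℝ (Fin n)) :=
  (fun c : EuclideanSpace ℝ (Fin m) => ∑ j, c j • x j) '' C

/-- The symmetric rearrangement `A^*` of a set `A ⊆ ℝⁿ` of finite volume (`n ≥ 1`): the open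
Euclidean ball centred at the origin with the same volume as `A`. -/
def symmRearrangement {n : ℕ} (A : Set (EuclideanSpace ℝ (Fin n))) :
    Set (EuclideanSpace ℝ (Fin n)) :=
  Metric.ball 0
    ((volume.real A / volume.real (Metric.ball (0 : EuclideanSpace ℝ (Fin n)) 1)) ^
      (1 / (n : ℝ)))

/-- The rearranged set has the same volume. -/
theorem volume_symmRearrangement {n : ℕ} (hn : 1 ≤ n) (A : Set (EuclideanSpace ℝ (Fin n)))
    (hA : volume A ≠ ∞) : volume (symmRearrangement A) = volume A := by
  have hn0 : n ≠ 0 := by omega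
  have : Nonempty (Fin n) := ⟨⟨0, hn⟩⟩
  have hB0 : volume (Metric.ball (0 : EuclideanSpace ℝ (Fin n)) 1) ≠ 0 :=
    (Metric.measure_ball_pos _ _ one_pos).ne'
  have hB : volume (Metric.ball (0 : EuclideanSpace ℝ (Fin n)) 1) ≠ ∞ := measure_ball_lt_top.ne
  have hBr : 0 < volume.real (Metric.ball (0 : EuclideanSpace ℝ (Fin n)) 1) :=
    ENNReal.toReal_pos hB0 hB
  have hq : 0 ≤ volume.real A / volume.real (Metric.ball (0 : EuclideanSpace ℝ (Fin n)) 1) := by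
    positivity
  rw [symmRearrangement, Measure.addHaar_ball _ _ (by positivity)]
  rw [finrank_euclideanSpace_fin, one_div, Real.rpow_inv_natCast_pow hq hn0,
    ← ENNReal.ofReal_toReal hB, ← ENNReal.ofReal_mul hq]
  change ENNReal.ofReal (_ / volume.real _ * volume.real _) = _
  rw [div_mul_cancel₀ _ hBr.ne']
  exact ENNReal.ofReal_toReal hA

/-- The symmetric decreasing rearrangement `f^*(x) = ∫₀^∞ 1[x ∈ {f > t}^*] dt` of an integrable
`f : ℝⁿ → [0,∞)`. The value is in `[0,∞]`, since `f^*(0)` is infinite for unbounded `f`. -/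
def symmDecrRearrangement {n : ℕ} (f : EuclideanSpace ℝ (Fin n) → ℝ)
    (x : EuclideanSpace ℝ (Fin n)) : ℝ≥0∞ :=
  ∫⁻ t in Ioi (0 : ℝ), (symmRearrangement {y | t < f y}).indicator (fun _ => 1) x

/-- `f` is the density of a probability distribution on `ℝⁿ`. -/
structure IsProbDensity {n : ℕ} (f : EuclideanSpace ℝ (Fin n) → ℝ) : Prop where
  nonneg : ∀ x, 0 ≤ f x
  integrable : Integrable f volume
  integral_eq_one : ∫ x, f x = 1

/-- `X₁, …, X_m` are independent random vectors in `ℝⁿ`, each with density `g`; equivalently, the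
random `n × m` matrix with columns `X₁, …, X_m` has i.i.d. columns of density `g`. -/
structure HasIIDColumns {n m : ℕ} {Ω : Type*} [MeasurableSpace Ω] (P : Measure Ω)
    (X : Fin m → Ω → EuclideanSpace ℝ (Fin n)) (g : EuclideanSpace ℝ (Fin n) → ℝ≥0∞) : Prop where
  measurable : ∀ j, Measurable (X j)
  indep : iIndepFun X P
  law : ∀ j, P.map (X j) = volume.withDensity g

/-- `Y₁, …, Y_m` are independent random vectors, each uniformly distributed in `K`. -/
structure IsUniformSample {n m : ℕ} {Ω : Type*} [MeasurableSpace Ω] (P : Measure Ω)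
    (Y : Fin m → Ω → EuclideanSpace ℝ (Fin n)) (K : Set (EuclideanSpace ℝ (Fin n))) : Prop where
  measurable : ∀ j, Measurable (Y j)
  indep : iIndepFun Y P
  uniform : ∀ j, pdf.IsUniform (Y j) K P volume

/-- `ν` is a radial measure with a decreasing density: `dν(x) = ρ(|x|) dx` with `ρ ≥ 0`
decreasing (in the weak sense). The value `ρ(0)` does not matter. -/
def IsRadialDecreasing {n : ℕ} (ν : Measure (EuclideanSpace ℝ (Fin n))) : Prop :=
  ∃ ρ : ℝ → ℝ, AntitoneOn ρ (Ioi 0) ∧ (∀ r, 0 < r → 0 ≤ ρ r) ∧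
    ν = volume.withDensity (fun x => ENNReal.ofReal (ρ ‖x‖))

/-- A convex body in `ℝⁿ`: a compact convex set with non-empty interior. -/
structure IsConvexBody {n : ℕ} (K : Set (EuclideanSpace ℝ (Fin n))) : Prop where
  convex : Convex ℝ K
  compact : IsCompact K
  interior_nonempty : (interior K).Nonempty

end

/-! The left side of (a) is the mass that the product of `ν` and `m` copies of the law `f` gives to
one fixed set `L ⊆ (ℝⁿ)^(m+1)`: the tuples `(u, x₁, …, x_m)` with `u ∈ Π°(XC)`. A rearrangement
inequality of Rogers–Brascamp–Lieb–Luttinger type bounds this mass by the one for the rearranged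
densities, provided that for every unit `θ` and all `y_j ⊥ θ` the set of `t` with `(y_j + t_j θ)_j ∈
L` is convex and symmetric.

That property comes from volumes. By Cauchy's formula `|XC + [0,N]u| = |XC| + N h(u)`, with `h` the
support function of `Π(XC)`, and `XC + [0,N]u` is the image of the fixed convex set `[0,N] × C`
under the matrix with columns `u, x₁, …, x_m`. When the columns move along `θ` with speeds `t`, each
fibre parallel to `θ` is the image of a fixed convex set under the linear form with coefficients
`t`, so its length is convex and even in `t`; integration gives the same for the volume
(`volume_combinations_shadow`). Dividing by `N` and letting `N → ∞` removes the term `|XC|` and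
leaves `h`.

The rearrangement inequality starts on the line. Prékopa–Leindler gives Anderson's theorem: a
centrally symmetric convex set meets a box in more volume when the box moves towards the origin.
Finite unions of intervals are slid inwards until two of them touch, the two are merged, and
induction ends with one centred interval per coordinate; open sets and then arbitrary sets of finite
measure follow by approximation. Fubini turns this into monotonicity under simultaneous Steiner
symmetrization of all factors. A first moment argument finds a direction with a definite gain for
all factors together, so that finitely many symmetrizations bring every factor close to its ball.
Layer-cake integration passes from sets to densities. The radial density of `ν` does not grow under
rearrangement, so `ν` is kept.

Part (b) takes for `C` the standard simplex and for `f` a uniform density. For (c), `[K]_m ⊆ K`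
gives `Π°K ⊆ Π°[K]_m`, while the hulls of more and more points of `K^*` almost surely exhaust that
open ball. The limit needs a finite measure, so it is taken for volume restricted to balls, whose
radii then grow. -/

/-! ### Layer-cake formulas. -/

/-- Layer-cake representation of an extended nonnegative real. -/
theorem setLIntegral_indicator_ofReal_lt (c : ℝ≥0∞) :
    ∫⁻ t in Ioi (0 : ℝ), {s : ℝ | ENNReal.ofReal s < c}.indicator (fun _ => 1) t = c := by
  have hm : MeasurableSet {s : ℝ | ENNReal.ofReal s < c} :=
    measurableSet_lt ENNReal.measurable_ofReal measurable_const
  have h1 : ∫⁻ t in Ioi (0 : ℝ), {s : ℝ | ENNReal.ofReal s < c}.indicator (fun _ => (1 : ℝ≥0∞)) t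
      = volume ({s : ℝ | ENNReal.ofReal s < c} ∩ Ioi 0) := by
    rw [lintegral_indicator hm, lintegral_one, Measure.restrict_apply_univ,
      Measure.restrict_apply hm]
  rw [h1]
  induction c with
  | top => simp
  | coe c =>
    have : {s : ℝ | ENNReal.ofReal s < (c : ℝ≥0∞)} ∩ Ioi 0 = Ioo 0 (c : ℝ) := by
      ext s
      simp only [mem_inter_iff, mem_ofPred_eq, mem_Ioi, mem_Ioo]
      constructor
      · rintro ⟨h, h0⟩
        refine ⟨h0, ?_⟩
        rw [← ENNReal.ofReal_coe_nnreal] at h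
        exact (ENNReal.ofReal_lt_ofReal_iff_of_nonneg h0.le).1 h
      · rintro ⟨h0, h⟩
        refine ⟨?_, h0⟩
        rw [← ENNReal.ofReal_coe_nnreal]
        exact (ENNReal.ofReal_lt_ofReal_iff_of_nonneg h0.le).2 h
    rw [this, Real.volume_Ioo]
    simp

/-- Layer-cake formula for a measurable function with values in `[0,∞]`. -/
theorem lintegral_eq_setLIntegral_measure_ofReal_lt {α : Type*} [MeasurableSpace α]
    (μ : Measure α) [SFinite μ] {F : α → ℝ≥0∞} (hF : Measurable F) :
    ∫⁻ x, F x ∂μ = ∫⁻ t in Ioi (0 : ℝ), μ {x | ENNReal.ofReal t < F x} := by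
  calc ∫⁻ x, F x ∂μ
      = ∫⁻ x, (∫⁻ t in Ioi (0 : ℝ),
          {s : ℝ | ENNReal.ofReal s < F x}.indicator (fun _ => 1) t) ∂μ := by
        simp_rw [setLIntegral_indicator_ofReal_lt]
    _ = ∫⁻ t in Ioi (0 : ℝ), (∫⁻ x,
          {s : ℝ | ENNReal.ofReal s < F x}.indicator (fun _ => 1) t ∂μ) := by
        refine lintegral_lintegral_swap (Measurable.aemeasurable ?_)
        have : MeasurableSet {p : α × ℝ | ENNReal.ofReal p.2 < F p.1} :=
          measurableSet_lt (ENNReal.measurable_ofReal.comp measurable_snd) (hF.comp measurable_fst)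
        exact (measurable_const.indicator this : Measurable
          ({p : α × ℝ | ENNReal.ofReal p.2 < F p.1}.indicator (fun _ => (1 : ℝ≥0∞))))
    _ = _ := by
        refine lintegral_congr fun t => ?_
        have hm : MeasurableSet {x | ENNReal.ofReal t < F x} := measurableSet_lt measurable_const hF
        rw [← lintegral_indicator_one hm]
        rfl

/-! ### Brunn–Minkowski on the line, Prékopa–Leindler and Anderson's theorem. -/

open scoped Pointwise in
/-- Brunn–Minkowski inequality on the line for nonempty compact sets. -/
theorem volume_add_le_of_isCompact {A B C : Set ℝ} (hA : IsCompact A) (hB : IsCompact B)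
    (hA0 : A.Nonempty) (hB0 : B.Nonempty) {a b : ℝ} (ha : 0 < a) (hb : 0 < b)
    (hC : ∀ x ∈ A, ∀ y ∈ B, a * x + b * y ∈ C) :
    ENNReal.ofReal a * volume A + ENNReal.ofReal b * volume B ≤ volume C := by
  -- With `p = max A` and `q = min B`, the sets `aA + bq` and `ap + bB` both lie in `C` and share
  -- only the point `ap + bq`.
  obtain ⟨p, hpA, hp⟩ := hA.exists_isMaxOn hA0 continuousOn_id
  obtain ⟨q, hqB, hq⟩ := hB.exists_isMinOn hB0 continuousOn_id
  have hp' : ∀ x ∈ A, x ≤ p := fun x hx => hp hx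
  have hq' : ∀ y ∈ B, q ≤ y := fun y hy => hq hy
  set A' := (fun x => a * x + b * q) '' A
  set B' := (fun y => a * p + b * y) '' B
  have hA' : IsCompact A' := hA.image (by fun_prop)
  have hB' : IsCompact B' := hB.image (by fun_prop)
  have e1 : volume A' = ENNReal.ofReal a * volume A := by
    have : A' = (fun z => z + b * q) '' ((a : ℝ) • A) := by
      ext z; simp [A', Set.mem_smul_set, eq_add_neg_iff_add_eq]
    rw [this, Set.image_add_right, measure_preimage_add_right, Measure.addHaar_smul]
    simp [abs_of_pos ha]
  have e2 : volume B' = ENNReal.ofReal b * volume B := by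
    have : B' = (fun z => a * p + z) '' ((b : ℝ) • B) := by
      ext z; simp [B', Set.mem_smul_set, eq_neg_add_iff_add_eq]
    rw [this, Set.image_add_left, measure_preimage_add, Measure.addHaar_smul]
    simp [abs_of_pos hb]
  rw [← e1, ← e2, ← measure_union₀ hB'.measurableSet.nullMeasurableSet]
  · refine measure_mono ?_
    rintro _ (⟨x, hx, rfl⟩ | ⟨y, hy, rfl⟩)
    · exact hC x hx q hqB
    · exact hC p hpA y hy
  · refine measure_mono_null (t := {a * p + b * q}) ?_ (by simp)
    rintro z ⟨⟨x, hx, rfl⟩, ⟨y, hy, hxy⟩⟩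
    have h1 := mul_le_mul_of_nonneg_left (hp' x hx) ha.le
    have h2 := mul_le_mul_of_nonneg_left (hq' y hy) hb.le
    simp only at hxy
    simp only [mem_singleton_iff]
    linarith

/-- Brunn–Minkowski inequality on the line. -/
theorem volume_add_le_of_measurableSet {A B C : Set ℝ} (hA : MeasurableSet A)
    (hB : MeasurableSet B) (hA0 : A.Nonempty) (hB0 : B.Nonempty) {a b : ℝ} (ha : 0 < a)
    (hb : 0 < b) (hC : ∀ x ∈ A, ∀ y ∈ B, a * x + b * y ∈ C) :
    ENNReal.ofReal a * volume A + ENNReal.ofReal b * volume B ≤ volume C := by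
  obtain ⟨x₀, hx₀⟩ := hA0
  obtain ⟨y₀, hy₀⟩ := hB0
  rw [hA.measure_eq_iSup_isCompact, hB.measure_eq_iSup_isCompact]
  simp_rw [ENNReal.mul_iSup, iSup_and']
  refine ENNReal.biSup_add_biSup_le' ⟨∅, empty_subset _, isCompact_empty⟩
    ⟨∅, empty_subset _, isCompact_empty⟩ ?_
  rintro K ⟨hK, hKc⟩ K' ⟨hK', hKc'⟩
  -- The approximating compact sets may be empty; inserting a point of `A` and one of `B` makes the
  -- compact case applicable.
  refine le_trans ?_ (volume_add_le_of_isCompact (hKc.insert x₀) (hKc'.insert y₀)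
    (insert_nonempty _ _) (insert_nonempty _ _) ha hb (C := C) ?_)
  · gcongr <;> exact subset_insert _ _
  · exact fun x hx y hy => hC x (insert_subset hx₀ hK hx) y (insert_subset hy₀ hK' hy)

theorem ENNReal.rpow_mul_rpow_le_weighted_add {a b : ℝ} (ha : 0 < a) (hb : 0 < b)
    (hab : a + b = 1) (u v : ℝ≥0∞) :
    u ^ a * v ^ b ≤ ENNReal.ofReal a * u + ENNReal.ofReal b * v := by
  induction u with
  | top => simp [ENNReal.mul_top, ha]
  | coe u =>
    induction v with
    | top => simp [ENNReal.mul_top, hb]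
    | coe v =>
      have := NNReal.geom_mean_le_arith_mean2_weighted ⟨a, ha.le⟩ ⟨b, hb.le⟩ u v
        (NNReal.eq hab)
      rw [← ENNReal.coe_rpow_of_nonneg _ ha.le, ← ENNReal.coe_rpow_of_nonneg _ hb.le,
        ENNReal.ofReal, ENNReal.ofReal, Real.toNNReal_of_nonneg ha.le,
        Real.toNNReal_of_nonneg hb.le]
      exact_mod_cast this

/-- The one-dimensional Prékopa–Leindler inequality in additive form, for functions whose
suprema are at least `1`. -/
theorem weighted_add_lintegral_min_one_le {f g h : ℝ → ℝ≥0∞} (hf : Measurable f)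
    (hg : Measurable g) (hh : Measurable h) {a b : ℝ} (ha : 0 < a) (hb : 0 < b)
    (hab : a + b = 1) (hle : ∀ x y, f x ^ a * g y ^ b ≤ h (a * x + b * y))
    (hf1 : 1 ≤ ⨆ x, f x) (hg1 : 1 ≤ ⨆ x, g x) :
    ENNReal.ofReal a * (∫⁻ x, min (f x) 1) + ENNReal.ofReal b * (∫⁻ x, min (g x) 1) ≤
      ∫⁻ x, h x := by
  rw [lintegral_eq_setLIntegral_measure_ofReal_lt _ hh,
    lintegral_eq_setLIntegral_measure_ofReal_lt _ (hf.min measurable_const),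
    lintegral_eq_setLIntegral_measure_ofReal_lt _ (hg.min measurable_const)]
  rw [← lintegral_const_mul' _ _ ENNReal.ofReal_ne_top,
    ← lintegral_const_mul' _ _ ENNReal.ofReal_ne_top, ← lintegral_add_left']
  · refine setLIntegral_mono' measurableSet_Ioi fun t ht => ?_
    rw [mem_Ioi] at ht
    -- Below level 1 both superlevel sets are nonempty because the suprema are at least 1, so
    -- Brunn–Minkowski applies; from level 1 on the truncated functions contribute nothing.
    by_cases ht1 : t < 1
    · have ht1' : ENNReal.ofReal t < 1 := by rwa [ENNReal.ofReal_lt_one]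
      have e : ∀ k : ℝ → ℝ≥0∞, {x | ENNReal.ofReal t < min (k x) 1} =
          {x | ENNReal.ofReal t < k x} := fun k => by ext; simp [ht1']
      rw [e, e]
      refine volume_add_le_of_measurableSet (measurableSet_lt measurable_const hf)
        (measurableSet_lt measurable_const hg)
        (lt_iSup_iff.1 (ht1'.trans_le hf1)) (lt_iSup_iff.1 (ht1'.trans_le hg1)) ha hb ?_
      intro x hx y hy
      refine lt_of_lt_of_le ?_ (hle x y)
      have : ENNReal.ofReal t = ENNReal.ofReal t ^ a * ENNReal.ofReal t ^ b := by
        rw [← ENNReal.rpow_add _ _ (by simpa using ht) ENNReal.ofReal_ne_top, hab,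
          ENNReal.rpow_one]
      rw [this]
      exact ENNReal.mul_lt_mul (ENNReal.rpow_lt_rpow hx ha) (ENNReal.rpow_lt_rpow hy hb)
    · have e : ∀ k : ℝ → ℝ≥0∞, {x | ENNReal.ofReal t < min (k x) 1} = ∅ := fun k => by
        ext; simp; intro _; linarith
      rw [e, e]
      simp
  · refine (Measurable.const_mul ?_ _).aemeasurable
    have : MeasurableSet {p : ℝ × ℝ | ENNReal.ofReal p.1 < min (f p.2) 1} :=
      measurableSet_lt (ENNReal.measurable_ofReal.comp measurable_fst)
        ((hf.min measurable_const).comp measurable_snd)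
    exact measurable_measure_prodMk_left this

/-- The one-dimensional Prékopa–Leindler inequality. -/
theorem prekopa_leindler_real {f g h : ℝ → ℝ≥0∞} (hf : Measurable f)
    (hg : Measurable g) (hh : Measurable h) {a b : ℝ} (ha : 0 < a) (hb : 0 < b)
    (hab : a + b = 1) (hle : ∀ x y, f x ^ a * g y ^ b ≤ h (a * x + b * y)) :
    (∫⁻ x, f x) ^ a * (∫⁻ x, g x) ^ b ≤ ∫⁻ x, h x := by
  by_cases hf0 : ⨆ x, f x = 0
  · have : ∀ x, f x = 0 := by simpa using hf0
    simp [this, ha]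
  by_cases hg0 : ⨆ x, g x = 0
  · have : ∀ x, g x = 0 := by simpa using hg0
    simp [this, hb]
  -- Dividing `f` by `α` and `g` by `β` makes both suprema at least 1. The additive inequality then
  -- yields the multiplicative one by weighted AM–GM.
  have key : ∀ α β : ℝ≥0∞, α ≠ 0 → β ≠ 0 → α ≠ ∞ → β ≠ ∞ → α ≤ ⨆ x, f x → β ≤ ⨆ x, g x →
      (∫⁻ x, min (f x) α) ^ a * (∫⁻ x, min (g x) β) ^ b ≤ ∫⁻ x, h x := by
    intro α β hα hβ hα' hβ' hαf hβg
    have hM0 : α ^ a * β ^ b ≠ 0 := by simp [hα, hβ, hα', hβ']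
    have hMt : α ^ a * β ^ b ≠ ∞ :=
      ENNReal.mul_ne_top (ENNReal.rpow_ne_top_of_nonneg ha.le hα')
        (ENNReal.rpow_ne_top_of_nonneg hb.le hβ')
    have hmin : ∀ (k : ℝ → ℝ≥0∞) (γ : ℝ≥0∞), γ ≠ 0 → γ ≠ ∞ →
        ∫⁻ x, min (k x) γ = γ * ∫⁻ x, min (γ⁻¹ * k x) 1 := by
      intro k γ h0 ht
      rw [← lintegral_const_mul' _ _ ht]
      refine lintegral_congr fun x => ?_
      rw [mul_min, ← mul_assoc, ENNReal.mul_inv_cancel h0 ht, one_mul, mul_one]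
    have main := weighted_add_lintegral_min_one_le (f := fun x => α⁻¹ * f x)
      (g := fun x => β⁻¹ * g x) (h := fun x => (α ^ a * β ^ b)⁻¹ * h x)
      (hf.const_mul _) (hg.const_mul _) (hh.const_mul _) ha hb hab ?_ ?_ ?_
    · rw [hmin f α hα hα', hmin g β hβ hβ', ENNReal.mul_rpow_of_nonneg _ _ ha.le,
        ENNReal.mul_rpow_of_nonneg _ _ hb.le, mul_mul_mul_comm]
      have h2 := (ENNReal.rpow_mul_rpow_le_weighted_add ha hb hab _ _).trans main
      calc _ ≤ α ^ a * β ^ b * ∫⁻ x, (α ^ a * β ^ b)⁻¹ * h x := by gcongr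
        _ = ∫⁻ x, h x := by
          rw [lintegral_const_mul _ hh, ← mul_assoc, ENNReal.mul_inv_cancel hM0 hMt, one_mul]
    · intro x y
      rw [ENNReal.mul_rpow_of_nonneg _ _ ha.le, ENNReal.mul_rpow_of_nonneg _ _ hb.le,
        mul_mul_mul_comm, ENNReal.inv_rpow, ENNReal.inv_rpow, ← ENNReal.mul_inv]
      · gcongr
        exact hle x y
      · left; simp [hα, hα']
      · left; exact ENNReal.rpow_ne_top_of_nonneg ha.le hα'
    · rw [← ENNReal.mul_iSup, ← ENNReal.inv_mul_cancel hα hα']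
      gcongr
    · rw [← ENNReal.mul_iSup, ← ENNReal.inv_mul_cancel hβ hβ']
      gcongr
  -- Truncating `f` at `min (sup f) (n + 1)` is the same as truncating it at `n + 1`, and this level
  -- is nonzero and finite even when `sup f` is infinite.
  have key2 : ∀ n m : ℕ, (∫⁻ x, min (f x) (n + 1)) ^ a * (∫⁻ x, min (g x) (m + 1)) ^ b ≤
      ∫⁻ x, h x := by
    intro n m
    refine le_trans (le_of_eq ?_) (key (min (⨆ x, f x) (n + 1)) (min (⨆ x, g x) (m + 1))
      (lt_min (pos_iff_ne_zero.2 hf0) (by positivity)).ne'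
      (lt_min (pos_iff_ne_zero.2 hg0) (by positivity)).ne'
      (by simp) (by simp) (min_le_left _ _) (min_le_left _ _))
    congr 2
    · refine lintegral_congr fun x => ?_
      rw [← min_assoc, min_eq_left (le_iSup f x)]
    · refine lintegral_congr fun x => ?_
      rw [← min_assoc, min_eq_left (le_iSup g x)]
  have hlim : ∀ k : ℝ → ℝ≥0∞, Measurable k → ∀ c : ℝ, 0 < c →
      (∫⁻ x, k x) ^ c = ⨆ n : ℕ, (∫⁻ x, min (k x) (n + 1)) ^ c := by
    intro k hk c hc
    have e : ∫⁻ x, k x = ⨆ n : ℕ, ∫⁻ x, min (k x) (n + 1) := by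
      rw [← lintegral_iSup (fun n => hk.min measurable_const)]
      · refine lintegral_congr fun x => ?_
        refine le_antisymm ?_ (iSup_le fun n => min_le_left _ _)
        rcases eq_or_ne (k x) ∞ with hx | hx
        · rw [hx]
          rw [← ENNReal.iSup_natCast]
          exact iSup_mono fun n => le_min (le_iSup (fun n : ℕ => (n : ℝ≥0∞)) n) le_self_add
        · obtain ⟨n, hn⟩ := ENNReal.exists_nat_gt hx
          refine le_iSup_of_le n (le_min le_rfl (hn.le.trans ?_))
          exact le_self_add
      · intro n m hnm x
        dsimp only
        gcongr
    rw [e]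
    exact (ENNReal.orderIsoRpow c hc).map_iSup _
  rw [hlim f hf a ha, hlim g hg b hb]
  simp_rw [ENNReal.iSup_mul, ENNReal.mul_iSup]
  exact iSup_le fun n => iSup_le fun m => key2 n m

theorem measurable_finCons {α : Type*} [MeasurableSpace α] {k : ℕ} :
    Measurable fun p : α × (Fin k → α) => (Fin.cons p.1 p.2 : Fin (k + 1) → α) := by
  refine measurable_pi_iff.2 fun i => ?_
  refine Fin.cases ?_ (fun i => ?_) i
  · simpa using measurable_fst
  · simpa using by fun_prop

theorem measurePreserving_finCons {α : Type*} [MeasurableSpace α] {k : ℕ}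
    (μ : Fin (k + 1) → Measure α) [∀ i, SigmaFinite (μ i)] :
    MeasurePreserving (fun p : α × (Fin k → α) => (Fin.cons p.1 p.2 : Fin (k + 1) → α))
      ((μ 0).prod (Measure.pi fun i => μ i.succ)) (Measure.pi μ) := by
  convert! (measurePreserving_piFinSuccAbove μ 0).symm using 1
  ext p i
  refine Fin.cases ?_ (fun i => ?_) i
  · simp [MeasurableEquiv.piFinSuccAbove]
  · simp [MeasurableEquiv.piFinSuccAbove]

/-- The Prékopa–Leindler inequality in `ℝᵏ`. -/
theorem prekopa_leindler {k : ℕ} {f g h : (Fin k → ℝ) → ℝ≥0∞} (hf : Measurable f)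
    (hg : Measurable g) (hh : Measurable h) {a b : ℝ} (ha : 0 < a) (hb : 0 < b)
    (hab : a + b = 1) (hle : ∀ x y, f x ^ a * g y ^ b ≤ h (a • x + b • y)) :
    (∫⁻ x, f x) ^ a * (∫⁻ x, g x) ^ b ≤ ∫⁻ x, h x := by
  induction k with
  | zero =>
    rw [lintegral_unique, lintegral_unique, lintegral_unique]
    have e : (volume : Measure (Fin 0 → ℝ)) univ = 1 := by
      simp [volume_pi]
    rw [e, mul_one, mul_one, mul_one]
    exact (hle _ _).trans_eq (congrArg h (Subsingleton.elim _ _))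
  | succ k ih =>
    have hfub : ∀ F : (Fin (k + 1) → ℝ) → ℝ≥0∞, Measurable F →
        ∫⁻ x, F x = ∫⁻ t : ℝ, ∫⁻ y : Fin k → ℝ, F (Fin.cons t y) := by
      intro F hF
      rw [volume_pi, ← (measurePreserving_finCons fun _ : Fin (k + 1) =>
        (volume : Measure ℝ)).lintegral_comp hF, lintegral_prod]
      · rfl
      · exact (hF.comp measurable_finCons).aemeasurable
    have hmeas : ∀ F : (Fin (k + 1) → ℝ) → ℝ≥0∞, Measurable F →
        Measurable fun t : ℝ => ∫⁻ y : Fin k → ℝ, F (Fin.cons t y) := fun F hF =>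
      (hF.comp measurable_finCons).lintegral_prod_right'
    rw [hfub f hf, hfub g hg, hfub h hh]
    -- The marginals in the first coordinate satisfy the hypothesis on the line by the induction
    -- hypothesis for the slices.
    refine prekopa_leindler_real (hmeas f hf) (hmeas g hg) (hmeas h hh) ha hb hab fun s t => ?_
    refine ih (hf.comp (measurable_finCons.comp measurable_prodMk_left))
      (hg.comp (measurable_finCons.comp measurable_prodMk_left))
      (hh.comp (measurable_finCons.comp measurable_prodMk_left)) fun x y => ?_
    refine (hle _ _).trans (le_of_eq ?_)
    congr 1
    ext i
    refine Fin.cases ?_ (fun i => ?_) i <;> simp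

/-- Anderson's theorem: translating a symmetric convex set `Q` towards the origin increases the
volume of its intersection with a symmetric convex set `M`. -/
theorem volume_inter_translate_le {k : ℕ} {M Q : Set (Fin k → ℝ)} (hM : MeasurableSet M)
    (hQ : MeasurableSet Q) (hMc : Convex ℝ M) (hQc : Convex ℝ Q) (hMs : ∀ x ∈ M, -x ∈ M)
    (hQs : ∀ x ∈ Q, -x ∈ Q) (v : Fin k → ℝ) {τ : ℝ} (h0 : 0 ≤ τ) (h1 : τ ≤ 1) :
    volume (M ∩ {x | x - v ∈ Q}) ≤ volume (M ∩ {x | x - τ • v ∈ Q}) := by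
  rcases h1.eq_or_lt with rfl | h1
  · simp
  have hm : ∀ w : Fin k → ℝ, MeasurableSet (M ∩ {x | x - w ∈ Q}) := fun w =>
    hM.inter (hQ.preimage (measurable_id.sub_const w))
  have hneg : volume (M ∩ {x | x - -v ∈ Q}) = volume (M ∩ {x | x - v ∈ Q}) := by
    rw [← Measure.measure_neg (μ := volume) (M ∩ {x | x - v ∈ Q})]
    congr 1
    ext x
    simp only [mem_inter_iff, mem_ofPred_eq, Set.mem_neg]
    constructor
    · rintro ⟨h, h'⟩
      refine ⟨hMs _ h, ?_⟩
      have := hQs _ h'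
      rwa [show -x - v = -(x - -v) by ring]
    · rintro ⟨h, h'⟩
      refine ⟨by simpa using hMs _ h, ?_⟩
      have := hQs _ h'
      rwa [show x - -v = -(-x - v) by ring]
  -- These weights write `τv` as a convex combination of `v` and `-v`. The intersections for `v` and
  -- `-v` have equal volume by symmetry, so the geometric mean in Prékopa–Leindler collapses to that
  -- volume.
  have ha : 0 < (1 + τ) / 2 := by linarith
  have hb : 0 < (1 - τ) / 2 := by linarith
  have hab : (1 + τ) / 2 + (1 - τ) / 2 = 1 := by ring
  have := prekopa_leindler (f := (M ∩ {x | x - v ∈ Q}).indicator 1)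
    (g := (M ∩ {x | x - -v ∈ Q}).indicator 1) (h := (M ∩ {x | x - τ • v ∈ Q}).indicator 1)
    (measurable_one.indicator (hm _)) (measurable_one.indicator (hm _))
    (measurable_one.indicator (hm _)) ha hb hab ?_
  · rw [lintegral_indicator_one (hm _), lintegral_indicator_one (hm _),
      lintegral_indicator_one (hm _), hneg,
      ← ENNReal.rpow_add_of_nonneg _ _ ha.le hb.le, hab, ENNReal.rpow_one] at this
    exact this
  · intro x y
    by_cases hx : x ∈ M ∩ {x | x - v ∈ Q}
    · by_cases hy : y ∈ M ∩ {x | x - -v ∈ Q}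
      · have hz : ((1 + τ) / 2) • x + ((1 - τ) / 2) • y ∈ M ∩ {x | x - τ • v ∈ Q} := by
          refine ⟨hMc hx.1 hy.1 ha.le hb.le hab, ?_⟩
          have := hQc hx.2 hy.2 ha.le hb.le hab
          simp only [mem_ofPred_eq]
          convert! this using 1
          ext i
          simp
          ring
        rw [indicator_of_mem hx, indicator_of_mem hy, indicator_of_mem hz]
        simp
      · rw [indicator_of_notMem hy, ENNReal.zero_rpow_of_pos hb, mul_zero]
        exact zero_le
    · rw [indicator_of_notMem hx, ENNReal.zero_rpow_of_pos ha, zero_mul]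
      exact zero_le

/-! ### Rearrangement of product sets on the line. -/

/-- Moving the centres of pairwise disjoint intervals towards the origin, as long as they stay
disjoint, increases the volume of the intersection of their product with a symmetric convex set. -/
theorem volume_inter_intervals_le_of_scale {k : ℕ} {M : Set (Fin k → ℝ)} (hM : MeasurableSet M)
    (hMc : Convex ℝ M) (hMs : ∀ x ∈ M, -x ∈ M) (s : Fin k → Finset ℕ) (c r : Fin k → ℕ → ℝ)
    {τ : ℝ} (h0 : 0 ≤ τ) (h1 : τ ≤ 1)
    (hsep : ∀ j, ∀ p ∈ s j, ∀ q ∈ s j, p ≠ q → r j p + r j q ≤ |τ * c j p - τ * c j q|) :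
    volume (M ∩ {x | ∀ j, ∃ i ∈ s j, |x j - c j i| < r j i}) ≤
      volume (M ∩ {x | ∀ j, ∃ i ∈ s j, |x j - τ * c j i| < r j i}) := by
  -- Choosing one interval in each coordinate splits the set into boxes, to which Anderson's theorem
  -- applies one at a time.
  have hexp : ∀ c : Fin k → ℕ → ℝ, M ∩ {x | ∀ j, ∃ i ∈ s j, |x j - c j i| < r j i} =
      ⋃ σ ∈ Fintype.piFinset s, M ∩ {x | ∀ j, |x j - c j (σ j)| < r j (σ j)} := by
    intro c
    ext x
    simp only [mem_inter_iff, mem_ofPred_eq, mem_iUnion, Fintype.mem_piFinset, exists_prop]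
    constructor
    · rintro ⟨hx, h⟩
      choose σ hσ hσ' using h
      exact ⟨σ, hσ, hx, hσ'⟩
    · rintro ⟨σ, hσ, hx, h⟩
      exact ⟨hx, fun j => ⟨σ j, hσ j, h j⟩⟩
  have hmeas : ∀ (σ : Fin k → ℕ) (c : Fin k → ℕ → ℝ),
      MeasurableSet (M ∩ {x | ∀ j, |x j - c j (σ j)| < r j (σ j)}) := by
    intro σ c
    refine hM.inter ?_
    rw [ofPred_forall]
    exact MeasurableSet.iInter fun j => measurableSet_lt (by fun_prop) measurable_const
  -- Before the move subadditivity is enough; after the move `hsep` makes the boxes disjoint, so the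
  -- sum of their volumes is the volume of the union.
  calc _ ≤ ∑ σ ∈ Fintype.piFinset s,
        volume (M ∩ {x | ∀ j, |x j - c j (σ j)| < r j (σ j)}) := by
        rw [hexp c]
        exact measure_biUnion_finset_le _ _
    _ ≤ ∑ σ ∈ Fintype.piFinset s,
        volume (M ∩ {x | ∀ j, |x j - τ * c j (σ j)| < r j (σ j)}) := by
        refine Finset.sum_le_sum fun σ _ => ?_
        have hQ : {x : Fin k → ℝ | ∀ j, |x j| < r j (σ j)} =
            univ.pi fun j => Ioo (-r j (σ j)) (r j (σ j)) := by
          ext x; simp [abs_lt]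
        have := volume_inter_translate_le hM
          (Q := {x : Fin k → ℝ | ∀ j, |x j| < r j (σ j)})
          (by rw [hQ]; exact MeasurableSet.univ_pi fun _ => measurableSet_Ioo) hMc
          (by rw [hQ]; exact convex_pi fun _ _ => convex_Ioo _ _) hMs (by simp)
          (fun j => c j (σ j)) h0 h1
        simpa using this
    _ = _ := by
        rw [hexp fun j i => τ * c j i, measure_biUnion_finset]
        · intro σ hσ σ' hσ' hne
          obtain ⟨j, hj⟩ := Function.ne_iff.1 hne
          simp only [Finset.mem_coe, Fintype.mem_piFinset] at hσ hσ'
          refine Set.disjoint_left.2 fun x hx hx' => ?_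
          have h1 := hx.2 j
          have h2 := hx'.2 j
          have h3 := hsep j _ (hσ j) _ (hσ' j) hj
          have h4 := abs_sub_le (τ * c j (σ j)) (x j) (τ * c j (σ' j))
          rw [abs_sub_comm _ (x j)] at h4
          linarith
        · exact fun σ _ => hmeas σ fun j i => τ * c j i

/-- Merging two touching intervals of a finite separated family. -/
theorem exists_merge_intervals (s : Finset ℕ) (c r : ℕ → ℝ) (hr : ∀ i, 0 < r i)
    (hsep : ∀ p ∈ s, ∀ q ∈ s, p ≠ q → r p + r q ≤ |c p - c q|) {p q : ℕ} (hp : p ∈ s)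
    (hq : q ∈ s) (hpq : p ≠ q) (htouch : c q - c p = r p + r q) :
    ∃ c' r' : ℕ → ℝ, (∀ i, 0 < r' i) ∧
      (∀ a ∈ s.erase q, ∀ b ∈ s.erase q, a ≠ b → r' a + r' b ≤ |c' a - c' b|) ∧
      ∑ i ∈ s.erase q, r' i = ∑ i ∈ s, r i ∧
      ∀ t, (∃ i ∈ s, |t - c i| < r i) → ∃ i ∈ s.erase q, |t - c' i| < r' i := by
  have hp' : p ∈ s.erase q := Finset.mem_erase.2 ⟨hpq, hp⟩
  -- No third interval fits between two touching ones, so it lies on the same side of both. The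
  -- merged interval runs from `c p - r p` to `c q + r q`: its centre is the midpoint and its radius
  -- `r p + r q`.
  have hkey : ∀ i ∈ s, i ≠ p → i ≠ q →
      r i + (r p + r q) ≤ |c i - (c p - r p + c q + r q) / 2| := by
    intro i hi hip hiq
    have h1 := hsep i hi p hp hip
    have h2 := hsep i hi q hq hiq
    have h3 := hr i
    have h4 := hr p
    have h5 := hr q
    rw [le_abs] at h1 h2 ⊢
    rcases h1 with h1 | h1 <;> rcases h2 with h2 | h2
    · left; linarith
    · linarith
    · linarith
    · right; linarith
  refine ⟨Function.update c p ((c p - r p + c q + r q) / 2), Function.update r p (r p + r q),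
    fun i => ?_, ?_, ?_, ?_⟩
  · by_cases h : i = p
    · subst h; simpa using add_pos (hr _) (hr _)
    · simpa [h] using hr i
  · intro a ha b hb hab
    obtain ⟨haq, has⟩ := Finset.mem_erase.1 ha
    obtain ⟨hbq, hbs⟩ := Finset.mem_erase.1 hb
    by_cases h : a = p
    · subst h
      have := hkey b hbs hab.symm hbq
      simp only [Function.update_self, Function.update_of_ne hab.symm]
      rw [abs_sub_comm]
      linarith
    · by_cases h' : b = p
      · subst h'
        simpa [h] using hkey a has hab haq
      · simpa [h, h'] using hsep a has b hbs hab
  · rw [← Finset.add_sum_erase _ _ hp', ← Finset.add_sum_erase s _ hq,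
      ← Finset.add_sum_erase _ r hp', Function.update_self]
    rw [Finset.sum_congr rfl fun i hi =>
      Function.update_of_ne (Finset.ne_of_mem_erase hi) _ _]
    ring
  · rintro t ⟨i, hi, hti⟩
    have h4 := hr p
    have h5 := hr q
    by_cases hip : i = p
    · subst hip
      refine ⟨i, hp', ?_⟩
      rw [abs_lt] at hti
      simp only [Function.update_self, abs_lt]
      constructor <;> linarith
    · by_cases hiq : i = q
      · subst hiq
        refine ⟨p, hp', ?_⟩
        rw [abs_lt] at hti
        simp only [Function.update_self, abs_lt]
        constructor <;> linarith
      · exact ⟨i, Finset.mem_erase.2 ⟨hiq, hi⟩, by simpa [hip] using hti⟩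

/-- The rearrangement inequality for finite unions of intervals on the line. -/
theorem volume_inter_intervals_le {k : ℕ} {M : Set (Fin k → ℝ)} (hM : MeasurableSet M)
    (hMc : Convex ℝ M) (hMs : ∀ x ∈ M, -x ∈ M) (N : ℕ) (s : Fin k → Finset ℕ)
    (c r : Fin k → ℕ → ℝ) (hN : ∑ j, (s j).card ≤ N) (hr : ∀ j i, 0 < r j i)
    (hsep : ∀ j, ∀ p ∈ s j, ∀ q ∈ s j, p ≠ q → r j p + r j q ≤ |c j p - c j q|) :
    volume (M ∩ {x | ∀ j, ∃ i ∈ s j, |x j - c j i| < r j i}) ≤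
      volume (M ∩ {x | ∀ j, |x j| < ∑ i ∈ s j, r j i}) := by
  induction N generalizing s c r with
  | zero =>
    have h0 : ∀ j, s j = ∅ := by simpa using hN
    refine measure_mono (inter_subset_inter_right _ fun x hx j => ?_)
    obtain ⟨i, hi, -⟩ := hx j
    simp [h0] at hi
  | succ N ih =>
    by_cases hcard : ∀ j, (s j).card ≤ 1
    -- With at most one interval per coordinate nothing can collide, so all centres may be moved to
    -- the origin (`τ = 0`).
    · refine (volume_inter_intervals_le_of_scale hM hMc hMs s c r le_rfl zero_le_one
        fun j p hp q hq hpq => absurd (Finset.card_le_one.1 (hcard j) p hp q hq) hpq).trans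
        (measure_mono (inter_subset_inter_right _ fun x hx j => ?_))
      obtain ⟨i, hi, hxi⟩ := hx j
      rw [zero_mul, sub_zero] at hxi
      exact hxi.trans_le (Finset.single_le_sum (fun i _ => (hr j i).le) hi)
    · push Not at hcard
      obtain ⟨j₁, hj₁⟩ := hcard
      obtain ⟨a, ha, b, hb, hab⟩ := Finset.one_lt_card.1 hj₁
      -- All centres contract by a common factor. The largest ratio of radius sum to centre
      -- distance, over all coordinates and pairs, is the factor at which the first pair touches;
      -- every other pair is still separated then.
      set T : Finset ((_ : Fin k) × ℕ × ℕ) := Finset.univ.sigma fun j => (s j).offDiag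
      have hT : T.Nonempty := ⟨⟨j₁, a, b⟩, by simp [T, ha, hb, hab]⟩
      obtain ⟨⟨j, p', q'⟩, hmem, hmax⟩ := T.exists_max_image
        (fun z => (r z.1 z.2.1 + r z.1 z.2.2) / |c z.1 z.2.1 - c z.1 z.2.2|) hT
      simp only [T, Finset.mem_sigma, Finset.mem_univ, true_and, Finset.mem_offDiag] at hmem
      obtain ⟨hp', hq', hpq'⟩ := hmem
      have hpos : ∀ j, ∀ p ∈ s j, ∀ q ∈ s j, p ≠ q → 0 < |c j p - c j q| := fun j p hp q hq h =>
        (add_pos (hr j p) (hr j q)).trans_le (hsep j p hp q hq h)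
      set τ := (r j p' + r j q') / |c j p' - c j q'| with hτ
      have hτ0 : 0 ≤ τ := div_nonneg (add_pos (hr _ _) (hr _ _)).le (abs_nonneg _)
      have hτ1 : τ ≤ 1 := (div_le_one (hpos j p' hp' q' hq' hpq')).2 (hsep j p' hp' q' hq' hpq')
      have hscale : ∀ j p q, |τ * c j p - τ * c j q| = τ * |c j p - c j q| := fun j p q => by
        rw [← mul_sub, abs_mul, abs_of_nonneg hτ0]
      have hsep' : ∀ j, ∀ p ∈ s j, ∀ q ∈ s j, p ≠ q →
          r j p + r j q ≤ |τ * c j p - τ * c j q| := by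
        intro i p hp q hq hpq
        rw [hscale, ← div_le_iff₀ (hpos i p hp q hq hpq)]
        exact hmax ⟨i, p, q⟩ (by simp [T, hp, hq, hpq])
      refine (volume_inter_intervals_le_of_scale hM hMc hMs s c r hτ0 hτ1 hsep').trans ?_
      obtain ⟨p, q, hp, hq, hpq, htouch⟩ : ∃ p q, p ∈ s j ∧ q ∈ s j ∧ p ≠ q ∧
          τ * c j q - τ * c j p = r j p + r j q := by
        have h := hscale j p' q'
        rw [hτ, div_mul_cancel₀ _ (hpos j p' hp' q' hq' hpq').ne', ← hτ] at h
        rcases abs_choice (τ * c j p' - τ * c j q') with h' | h'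
        · exact ⟨q', p', hq', hp', hpq'.symm, by linarith⟩
        · exact ⟨p', q', hp', hq', hpq', by linarith⟩
      obtain ⟨c', r', hr', hs', hsum, hcov⟩ := exists_merge_intervals (s j) (fun i => τ * c j i)
        (r j) (hr j) (hsep' j) hp hq hpq htouch
      have := ih (Function.update s j ((s j).erase q))
        (Function.update (fun j i => τ * c j i) j c') (Function.update r j r') ?_ ?_ ?_
      · refine (measure_mono (inter_subset_inter_right _ ?_)).trans (this.trans_eq ?_)
        · intro x hx i
          by_cases hi : i = j
          · subst hi; simpa using hcov _ (hx i)
          · simpa [hi] using hx i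
        · congr 3
          ext x
          refine forall_congr' fun i => ?_
          by_cases hi : i = j
          · subst hi; simp [hsum]
          · simp [hi]
      · rw [← Finset.add_sum_erase _ _ (Finset.mem_univ j)] at hN ⊢
        rw [Function.update_self, Finset.sum_congr rfl fun i hi => by
          rw [Function.update_of_ne (Finset.ne_of_mem_erase hi)], Finset.card_erase_of_mem hq]
        have : 0 < (s j).card := Finset.card_pos.2 ⟨q, hq⟩
        omega
      · intro i l
        by_cases hi : i = j
        · subst hi; simpa using hr' l
        · simpa [hi] using hr i l
      · intro i
        by_cases hi : i = j
        · subst hi; simpa using hs'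
        · simpa [hi] using hsep' i

/-- The total length of a finite separated family of intervals contained in `O`. -/
theorem ofReal_two_mul_sum_radius_le (s : Finset ℕ) (c r : ℕ → ℝ) (hr : ∀ i, 0 < r i)
    (hsep : ∀ p ∈ s, ∀ q ∈ s, p ≠ q → r p + r q ≤ |c p - c q|) {O : Set ℝ}
    (hO : ∀ i ∈ s, Ioo (c i - r i) (c i + r i) ⊆ O) :
    ENNReal.ofReal (2 * ∑ i ∈ s, r i) ≤ volume O := by
  have h : volume (⋃ i ∈ s, Ioo (c i - r i) (c i + r i)) = ENNReal.ofReal (2 * ∑ i ∈ s, r i) := by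
    rw [measure_biUnion_finset _ fun _ _ => measurableSet_Ioo]
    · rw [Finset.mul_sum, ENNReal.ofReal_sum_of_nonneg fun i _ => by linarith [hr i]]
      refine Finset.sum_congr rfl fun i _ => ?_
      rw [Real.volume_Ioo]
      congr 1; ring
    · intro p hp q hq hpq
      refine Set.disjoint_left.2 fun x hx hx' => ?_
      have h3 := hsep p hp q hq hpq
      rw [le_abs] at h3
      have h1 := hx.1; have h2 := hx.2; have h1' := hx'.1; have h2' := hx'.2
      rcases h3 with h3 | h3 <;> linarith
  rw [← h]
  exact measure_mono (iUnion₂_subset hO)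

/-- Every open subset of the line is exhausted, up to rational points, by finite separated
families of intervals. -/
theorem exists_intervals_exhausting {O : Set ℝ} (hO : IsOpen O) :
    ∃ (s : ℕ → Finset ℕ) (c r : ℕ → ℕ → ℝ), (∀ n i, 0 < r n i) ∧
      (∀ n, ∀ p ∈ s n, ∀ q ∈ s n, p ≠ q → r n p + r n q ≤ |c n p - c n q|) ∧
      (∀ n, ∀ i ∈ s n, Ioo (c n i - r n i) (c n i + r n i) ⊆ O) ∧
      ∀ x ∈ O, Irrational x → ∃ n₀, ∀ n ≥ n₀, ∃ i ∈ s n, |x - c n i| < r n i := by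
  classical
  -- With `N = n + 1`, these are the centres and half-lengths of the cells of the grid of mesh
  -- `1/N`; the indices below `2N²` cover `[-N, N]`. The cells contained in `O` are kept.
  set c : ℕ → ℕ → ℝ := fun n i => ((i : ℝ) - (n + 1 : ℝ) ^ 2 + 1 / 2) / (n + 1)
  set r : ℕ → ℕ → ℝ := fun n i => 1 / 2 / (n + 1)
  refine ⟨fun n => (Finset.range (2 * (n + 1) ^ 2)).filter fun i =>
    Ioo (c n i - r n i) (c n i + r n i) ⊆ O, c, r, fun n i => by positivity, ?_, ?_, ?_⟩
  · intro n p _ q _ hpq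
    have hn : (0 : ℝ) < n + 1 := by positivity
    have e : c n p - c n q = ((p : ℝ) - q) / (n + 1) := by simp only [c]; ring
    rw [e, abs_div, abs_of_pos hn, le_div_iff₀ hn]
    simp only [r]
    rw [← add_div, div_mul_cancel₀ _ hn.ne']
    norm_num
    have : (1 : ℤ) ≤ |(p : ℤ) - q| := Int.one_le_abs (sub_ne_zero.2 (by exact_mod_cast hpq))
    exact_mod_cast this
  · intro n i hi
    exact (Finset.mem_filter.1 hi).2
  · intro x hx hirr
    obtain ⟨ε, hε, hball⟩ := Metric.isOpen_iff.1 hO x hx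
    obtain ⟨n₁, hn₁⟩ := exists_nat_gt (max |x| (1 / ε))
    refine ⟨n₁, fun n hn => ?_⟩
    have hn' : max |x| (1 / ε) < (n : ℝ) + 1 := by
      have : (n₁ : ℝ) ≤ n := by exact_mod_cast hn
      linarith
    obtain ⟨hxn, hεn⟩ := max_lt_iff.1 hn'
    set N : ℝ := (n : ℝ) + 1 with hN
    have hN0 : 0 < N := by positivity
    obtain ⟨hx1, hx2⟩ := abs_lt.1 hxn
    have hNi : N ^ 2 = (((n + 1) ^ 2 : ℕ) : ℝ) := by push_cast; rfl
    have hfl1 := Int.floor_le (N * x)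
    have hfl2 := Int.lt_floor_add_one (N * x)
    have hfl0 : -(((n + 1) ^ 2 : ℕ) : ℤ) ≤ ⌊N * x⌋ := by
      rw [Int.le_floor]
      push_cast
      nlinarith
    have hflt : ⌊N * x⌋ < (((n + 1) ^ 2 : ℕ) : ℤ) := by
      rw [Int.floor_lt]
      push_cast
      nlinarith
    obtain ⟨i, hi⟩ : ∃ i : ℕ, (i : ℤ) = ⌊N * x⌋ + ((n + 1) ^ 2 : ℕ) :=
      ⟨(⌊N * x⌋ + ((n + 1) ^ 2 : ℕ)).toNat, Int.toNat_of_nonneg (by linarith)⟩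
    have hiR : (i : ℝ) = ⌊N * x⌋ + N ^ 2 := by
      rw [hNi]; exact_mod_cast congrArg (Int.cast : ℤ → ℝ) hi
    -- Irrationality keeps `x` off the cell boundaries, hence inside an open cell.
    have hstrict : (⌊N * x⌋ : ℝ) < N * x := by
      refine lt_of_le_of_ne hfl1 fun h => ?_
      refine hirr ⟨⌊N * x⌋ / ((n + 1 : ℕ) : ℚ), ?_⟩
      push_cast
      rw [h, ← hN]
      field_simp
    have hcx : |x - c n i| < r n i := by
      have e : x - c n i = (N * x - ⌊N * x⌋ - 1 / 2) / N := by
        simp only [c, ← hN]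
        rw [hiR]
        field_simp
        ring
      rw [e, abs_div, abs_of_pos hN0]
      simp only [r, ← hN]
      rw [div_lt_div_iff_of_pos_right hN0, abs_lt]
      constructor <;> linarith
    refine ⟨i, Finset.mem_filter.2 ⟨?_, ?_⟩, hcx⟩
    · rw [Finset.mem_range]
      zify at hi hflt ⊢
      linarith
    · intro y hy
      refine hball ?_
      rw [Metric.mem_ball, Real.dist_eq]
      have hyc : |y - c n i| < r n i := by
        rw [abs_lt]; constructor <;> linarith [hy.1, hy.2]
      have h2r : r n i + r n i < ε := by
        simp only [r, ← hN]
        rw [← add_div, div_lt_iff₀ hN0]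
        rw [div_lt_iff₀ hε] at hεn
        linarith
      have := abs_sub_le y (c n i) x
      rw [abs_sub_comm (c n i)] at this
      linarith

/-- Almost every point of the product has irrational coordinates and is therefore reached by the
finite interval families in the factors. Radii `ρ` larger than needed are allowed so that the bound
can be used for open neighbourhoods of other sets. -/
theorem volume_inter_pi_isOpen_le {k : ℕ} {M : Set (Fin k → ℝ)} (hM : MeasurableSet M)
    (hMc : Convex ℝ M) (hMs : ∀ x ∈ M, -x ∈ M) (O : Fin k → Set ℝ) (hO : ∀ j, IsOpen (O j))
    (ρ : Fin k → ℝ) (hρ : ∀ j, volume (O j) ≤ ENNReal.ofReal (2 * ρ j)) (hρ0 : ∀ j, 0 ≤ ρ j) :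
    volume (M ∩ univ.pi O) ≤ volume (M ∩ univ.pi fun j => Ioo (-ρ j) (ρ j)) := by
  choose s c r hr hsep hsub hex using fun j => exists_intervals_exhausting (hO j)
  -- The families of different stages are not nested, so monotonicity is forced by intersecting over
  -- all later stages.
  set W : ℕ → Set (Fin k → ℝ) := fun n =>
    ⋂ m ≥ n, M ∩ {x | ∀ j, ∃ i ∈ s j m, |x j - c j m i| < r j m i}
  have hWmono : Monotone W := fun a b hab =>
    biInter_subset_biInter_left fun m (hm : m ≥ b) => hab.trans hm
  have hirr : ∀ᵐ x : Fin k → ℝ, ∀ j, ∀ q : ℚ, x j ≠ q :=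
    ae_all_iff.2 fun j => ae_all_iff.2 fun q => Measure.ae_eval_ne _ _ _
  calc volume (M ∩ univ.pi O) ≤ volume (⋃ n, W n) := by
        refine measure_mono_ae ?_
        filter_upwards [hirr] with x hx hxO
        have h1 : ∀ j, ∃ n₀, ∀ n ≥ n₀, ∃ i ∈ s j n, |x j - c j n i| < r j n i := fun j =>
          hex j (x j) (hxO.2 j (mem_univ j)) fun ⟨q, hq⟩ => hx j q hq.symm
        choose n₀ hn₀ using h1
        refine mem_iUnion.2 ⟨Finset.univ.sup n₀, mem_iInter₂.2 fun m hm => ⟨hxO.1, fun j => ?_⟩⟩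
        exact hn₀ j m ((Finset.le_sup (Finset.mem_univ j)).trans hm)
    _ = ⨆ n, volume (W n) := hWmono.measure_iUnion
    _ ≤ _ := by
        refine iSup_le fun n => ?_
        refine (measure_mono (biInter_subset_of_mem (le_refl n))).trans ?_
        refine (volume_inter_intervals_le hM hMc hMs _ (fun j => s j n) (fun j => c j n)
          (fun j => r j n) le_rfl (fun j => hr j n) fun j => hsep j n).trans ?_
        refine measure_mono (inter_subset_inter_right _ fun x hx j _ => ?_)
        have h2 := (ofReal_two_mul_sum_radius_le (s j n) (c j n) (r j n) (hr j n) (hsep j n)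
          (hsub j n)).trans (hρ j)
        rw [ENNReal.ofReal_le_ofReal_iff (by linarith [hρ0 j])] at h2
        have h3 : |x j| < ∑ i ∈ s j n, r j n i := hx j
        rw [abs_lt] at h3
        constructor <;> linarith

/-- Rearrangement inequality on the line: replacing each factor of a product set by the centred
interval of the same length increases the volume of the intersection of the product with a
symmetric convex set. -/
theorem volume_inter_pi_le_pi_Ioo {k : ℕ} {M : Set (Fin k → ℝ)} (hM : MeasurableSet M)
    (hMc : Convex ℝ M) (hMs : ∀ x ∈ M, -x ∈ M) (A : Fin k → Set ℝ)
    (hA : ∀ j, volume (A j) ≠ ∞) :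
    volume (M ∩ univ.pi A) ≤
      volume (M ∩ univ.pi fun j => Ioo (-(volume.real (A j) / 2)) (volume.real (A j) / 2)) := by
  set ρ : Fin k → ℝ := fun j => volume.real (A j) / 2
  have hρ0 : ∀ j, 0 ≤ ρ j := fun j => by positivity
  set I : ℝ → Set (Fin k → ℝ) := fun δ => univ.pi fun j => Ioo (-(ρ j + δ)) (ρ j + δ)
  have hIvol : ∀ δ, volume (I δ) = ∏ j, ENNReal.ofReal (2 * (ρ j + δ)) := by
    intro δ
    rw [Real.volume_pi_Ioo]
    refine Finset.prod_congr rfl fun j _ => ?_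
    congr 1; ring
  have hImeas : ∀ δ, MeasurableSet (I δ) := fun δ => MeasurableSet.univ_pi fun _ => measurableSet_Ioo
  have hIfin : ∀ δ, volume (I δ) ≠ ∞ := fun δ => by
    rw [hIvol]; exact ENNReal.prod_ne_top fun _ _ => ENNReal.ofReal_ne_top
  -- Outer regularity replaces each `A j`, measurable or not, by an open superset with at most `2δ`
  -- more measure. The price is the volume of the shell between two boxes, which vanishes as `δ →
  -- 0`.
  have hstep : ∀ δ : ℝ, 0 < δ → volume (M ∩ univ.pi A) ≤
      volume (M ∩ I 0) + (volume (I δ) - volume (I 0)) := by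
    intro δ hδ
    have hex : ∀ j, ∃ U ⊇ A j, IsOpen U ∧ volume U ≤ ENNReal.ofReal (2 * (ρ j + δ)) := by
      intro j
      obtain ⟨U, hU, hUo, hUv⟩ := (A j).exists_isOpen_lt_add (hA j)
        (ε := ENNReal.ofReal (2 * δ)) (by simp [hδ])
      refine ⟨U, hU, hUo, hUv.le.trans (le_of_eq ?_)⟩
      rw [mul_add, ENNReal.ofReal_add (by linarith [hρ0 j]) (by linarith)]
      congr 1
      rw [show 2 * ρ j = volume.real (A j) by simp only [ρ]; ring]
      exact (ENNReal.ofReal_toReal (hA j)).symm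
    choose U hAU hUo hUv using hex
    calc volume (M ∩ univ.pi A) ≤ volume (M ∩ univ.pi U) :=
          measure_mono (inter_subset_inter_right _ (pi_mono fun j _ => hAU j))
      _ ≤ volume (M ∩ I δ) := volume_inter_pi_isOpen_le hM hMc hMs U hUo (fun j => ρ j + δ) hUv
          fun j => by linarith [hρ0 j]
      _ ≤ volume ((M ∩ I 0) ∪ (I δ \ I 0)) := by
          refine measure_mono fun x hx => ?_
          by_cases h : x ∈ I 0
          · exact Or.inl ⟨hx.1, h⟩
          · exact Or.inr ⟨hx.2, h⟩
      _ ≤ volume (M ∩ I 0) + volume (I δ \ I 0) := measure_union_le _ _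
      _ = _ := by
          rw [measure_sdiff (pi_mono fun j _ => Ioo_subset_Ioo (by linarith) (by linarith))
            (hImeas 0).nullMeasurableSet (hIfin 0)]
  have hlim : Filter.Tendsto (fun δ => volume (M ∩ I 0) + (volume (I δ) - volume (I 0)))
      (nhdsWithin 0 (Ioi 0)) (nhds (volume (M ∩ I 0) + (volume (I 0) - volume (I 0)))) := by
    refine Filter.Tendsto.const_add _ (ENNReal.Tendsto.sub ?_ tendsto_const_nhds
      (Or.inl (hIfin 0)))
    have hprod : ∀ δ : ℝ, 0 ≤ δ → volume (I δ) = ENNReal.ofReal (∏ j, 2 * (ρ j + δ)) := by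
      intro δ hδ
      rw [hIvol, ENNReal.ofReal_prod_of_nonneg fun j _ => by linarith [hρ0 j]]
    rw [hprod 0 le_rfl]
    have hc : Continuous fun δ : ℝ => ENNReal.ofReal (∏ j, 2 * (ρ j + δ)) :=
      ENNReal.continuous_ofReal.comp (by fun_prop)
    refine Filter.Tendsto.congr' ?_ (hc.tendsto 0 |>.mono_left nhdsWithin_le_nhds)
    filter_upwards [self_mem_nhdsWithin] with δ hδ using (hprod δ (le_of_lt hδ)).symm
  rw [tsub_self, add_zero] at hlim
  have := ge_of_tendsto hlim (by filter_upwards [self_mem_nhdsWithin] with δ hδ using hstep δ hδ)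
  simpa [I] using this

/-! ### Steiner symmetrization: fibres, volume and gain relative to a ball. -/

instance subspaceVolume_isAddHaarMeasure {n : ℕ} (S : Submodule ℝ (EuclideanSpace ℝ (Fin n))) :
    (subspaceVolume S).IsAddHaarMeasure :=
  inferInstanceAs ((volume : Measure S).IsAddHaarMeasure)

/-- Orthogonal decomposition of Lebesgue measure along a unit vector. -/
theorem measurePreserving_orthogonal_add {n : ℕ} {S : Submodule ℝ (EuclideanSpace ℝ (Fin n))}
    {θ : EuclideanSpace ℝ (Fin n)} (hθ : ‖θ‖ = 1) (hS : S = (Submodule.span ℝ {θ})ᗮ) :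
    MeasurePreserving (fun p : S × ℝ => (p.1 : EuclideanSpace ℝ (Fin n)) + p.2 • θ)
      ((subspaceVolume S).prod volume) volume := by
  subst hS
  set L := Submodule.span ℝ {θ}
  have h1 : MeasurePreserving (LinearIsometryEquiv.toSpanUnitSingleton (𝕜 := ℝ) θ hθ)
      volume volume := LinearIsometryEquiv.measurePreserving _
  have h2 := (L.orthogonalDecomposition.symm.measurePreserving).comp
    (WithLp.volume_preserving_toLp L Lᗮ)
  have h3 := (h1.prod (MeasurePreserving.id (subspaceVolume Lᗮ))).comp
    (Measure.measurePreserving_swap (μ := subspaceVolume Lᗮ) (ν := (volume : Measure ℝ)))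
  convert! h2.comp h3 using 1
  ext p
  simp [add_comm]

noncomputable section

/-- The parameters `t` for which `y + tθ` lies in `A`. -/
def lineFiber {n : ℕ} (θ : EuclideanSpace ℝ (Fin n)) (A : Set (EuclideanSpace ℝ (Fin n)))
    (y : EuclideanSpace ℝ (Fin n)) : Set ℝ :=
  {t | y + t • θ ∈ A}

/-- Steiner symmetrization of `A` with respect to the hyperplane orthogonal to the unit
vector `θ`. -/
def steinerSymm {n : ℕ} (θ : EuclideanSpace ℝ (Fin n)) (A : Set (EuclideanSpace ℝ (Fin n))) :
    Set (EuclideanSpace ℝ (Fin n)) :=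
  {x | 2 * ENNReal.ofReal |inner ℝ θ x| < volume (lineFiber θ A x)}

end

section Steiner

theorem measurableSet_lineFiber {n : ℕ} {θ : EuclideanSpace ℝ (Fin n)}
    {A : Set (EuclideanSpace ℝ (Fin n))} (hA : MeasurableSet A) (y : EuclideanSpace ℝ (Fin n)) :
    MeasurableSet (lineFiber θ A y) :=
  hA.preimage (by fun_prop)

theorem measurable_volume_lineFiber {n : ℕ} {θ : EuclideanSpace ℝ (Fin n)}
    {A : Set (EuclideanSpace ℝ (Fin n))} (hA : MeasurableSet A) :
    Measurable fun y => volume (lineFiber θ A y) := by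
  have : MeasurableSet {p : EuclideanSpace ℝ (Fin n) × ℝ | p.1 + p.2 • θ ∈ A} :=
    hA.preimage (by fun_prop)
  exact measurable_measure_prodMk_left this

theorem volume_eq_lintegral_lineFiber {n : ℕ} {S : Submodule ℝ (EuclideanSpace ℝ (Fin n))}
    {θ : EuclideanSpace ℝ (Fin n)} (hθ : ‖θ‖ = 1) (hS : S = (Submodule.span ℝ {θ})ᗮ)
    {A : Set (EuclideanSpace ℝ (Fin n))} (hA : MeasurableSet A) :
    volume A = ∫⁻ y : S, volume (lineFiber θ A y) ∂(subspaceVolume S) := by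
  rw [← (measurePreserving_orthogonal_add hθ hS).measure_preimage hA.nullMeasurableSet,
    Measure.prod_apply (hA.preimage (by fun_prop))]
  rfl

theorem volume_two_mul_abs_lt (c : ℝ≥0∞) :
    volume {t : ℝ | 2 * ENNReal.ofReal |t| < c} = c := by
  induction c with
  | top =>
    have : {t : ℝ | 2 * ENNReal.ofReal |t| < ∞} = univ := by
      ext t; simp [ENNReal.mul_lt_top_iff]
    simp [this]
  | coe c =>
    have : {t : ℝ | 2 * ENNReal.ofReal |t| < (c : ℝ≥0∞)} = Ioo (-((c : ℝ) / 2)) ((c : ℝ) / 2) := by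
      ext t
      rw [mem_ofPred_eq, ← ENNReal.ofReal_ofNat, ← ENNReal.ofReal_mul (by norm_num),
        ← ENNReal.ofReal_coe_nnreal, ENNReal.ofReal_lt_ofReal_iff_of_nonneg (by positivity),
        mem_Ioo, ← abs_lt, lt_div_iff₀ (by norm_num), mul_comm]
    rw [this, Real.volume_Ioo]
    simp

theorem setOf_two_mul_abs_lt_eq_Ioo {c : ℝ≥0∞} (hc : c ≠ ∞) :
    {t : ℝ | 2 * ENNReal.ofReal |t| < c} = Ioo (-(c.toReal / 2)) (c.toReal / 2) := by
  ext t
  rw [mem_ofPred_eq, ← ENNReal.ofReal_ofNat, ← ENNReal.ofReal_mul (by norm_num),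
    ← ENNReal.ofReal_toReal hc, ENNReal.ofReal_lt_ofReal_iff_of_nonneg (by positivity),
    mem_Ioo, ← abs_lt, lt_div_iff₀ (by norm_num), mul_comm,
    ENNReal.toReal_ofReal ENNReal.toReal_nonneg]

theorem measurableSet_steinerSymm {n : ℕ} {θ : EuclideanSpace ℝ (Fin n)}
    {A : Set (EuclideanSpace ℝ (Fin n))} (hA : MeasurableSet A) :
    MeasurableSet (steinerSymm θ A) :=
  measurableSet_lt (by fun_prop) (measurable_volume_lineFiber hA)

/-- For `y ⊥ θ` the parameter `t` is the `θ`-coordinate of `y + tθ`, and the fibre of `A` based at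
`y + tθ` is a translate of the one at `y`. -/
theorem lineFiber_steinerSymm {n : ℕ} {θ : EuclideanSpace ℝ (Fin n)} (hθ : ‖θ‖ = 1)
    (A : Set (EuclideanSpace ℝ (Fin n))) {y : EuclideanSpace ℝ (Fin n)} (hy : inner ℝ θ y = 0) :
    lineFiber θ (steinerSymm θ A) y =
      {t | 2 * ENNReal.ofReal |t| < volume (lineFiber θ A y)} := by
  ext t
  have h1 : inner ℝ θ (y + t • θ) = t := by
    rw [inner_add_right, hy, inner_smul_right, real_inner_self_eq_norm_sq, hθ]; simp
  have h2 : volume (lineFiber θ A (y + t • θ)) = volume (lineFiber θ A y) := by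
    rw [← measure_preimage_add volume t (lineFiber θ A y)]
    congr 1
    ext s
    simp [lineFiber, add_smul, add_assoc]
  change 2 * ENNReal.ofReal |inner ℝ θ (y + t • θ)| < volume (lineFiber θ A (y + t • θ)) ↔ _
  rw [h1, h2]
  rfl

theorem inner_eq_zero_of_mem_orthogonal_span {n : ℕ} {S : Submodule ℝ (EuclideanSpace ℝ (Fin n))}
    {θ : EuclideanSpace ℝ (Fin n)} (hS : S = (Submodule.span ℝ {θ})ᗮ) (y : S) :
    inner ℝ θ (y : EuclideanSpace ℝ (Fin n)) = 0 := by
  subst hS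
  exact Submodule.mem_orthogonal_singleton_iff_inner_right.1 y.2

theorem volume_steinerSymm {n : ℕ} {θ : EuclideanSpace ℝ (Fin n)} (hθ : ‖θ‖ = 1)
    {A : Set (EuclideanSpace ℝ (Fin n))} (hA : MeasurableSet A) :
    volume (steinerSymm θ A) = volume A := by
  rw [volume_eq_lintegral_lineFiber hθ rfl hA,
    volume_eq_lintegral_lineFiber hθ rfl (measurableSet_steinerSymm hA)]
  refine lintegral_congr fun y => ?_
  rw [lineFiber_steinerSymm hθ A (inner_eq_zero_of_mem_orthogonal_span rfl y),
    volume_two_mul_abs_lt]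

theorem lineFiber_ball {n : ℕ} {θ : EuclideanSpace ℝ (Fin n)} (hθ : ‖θ‖ = 1)
    {y : EuclideanSpace ℝ (Fin n)} (hy : inner ℝ θ y = 0) {r : ℝ} (hr : 0 ≤ r) :
    ∃ s, 0 ≤ s ∧ lineFiber θ (Metric.ball 0 r) y = Ioo (-s) s := by
  refine ⟨√(r ^ 2 - ‖y‖ ^ 2), Real.sqrt_nonneg _, ?_⟩
  ext t
  have h : ‖y + t • θ‖ ^ 2 = ‖y‖ ^ 2 + t ^ 2 := by
    rw [norm_add_sq_real, inner_smul_right, real_inner_comm, hy, norm_smul, hθ]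
    simp
  rw [mem_Ioo, ← abs_lt]
  change y + t • θ ∈ Metric.ball 0 r ↔ _
  rw [mem_ball_zero_iff, ← sq_lt_sq₀ (norm_nonneg _) hr, h, Real.lt_sqrt (abs_nonneg _), sq_abs]
  constructor <;> intro h <;> linarith

theorem volume_lineFiber_ne_top {n : ℕ} {θ : EuclideanSpace ℝ (Fin n)} (hθ : ‖θ‖ = 1)
    {A : Set (EuclideanSpace ℝ (Fin n))} {R : ℝ} (hR : A ⊆ Metric.ball 0 R)
    {y : EuclideanSpace ℝ (Fin n)} (hy : inner ℝ θ y = 0) : volume (lineFiber θ A y) ≠ ∞ := by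
  obtain ⟨s, -, hfib⟩ := lineFiber_ball hθ hy (abs_nonneg R)
  refine ((measure_mono (t := Ioo (-s) s) ?_).trans_lt measure_Ioo_lt_top).ne
  rw [← hfib]
  exact fun t ht => Metric.ball_subset_ball (le_abs_self R) (hR ht)

/-- The fibres of a centred ball over `θ^⊥` are centred intervals, so a fibre of `A` that is centred
without changing its length stays inside. -/
theorem steinerSymm_subset_ball {n : ℕ} {θ : EuclideanSpace ℝ (Fin n)} (hθ : ‖θ‖ = 1) {r : ℝ}
    (hr : 0 ≤ r) {A : Set (EuclideanSpace ℝ (Fin n))} (hA : A ⊆ Metric.ball 0 r) :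
    steinerSymm θ A ⊆ Metric.ball 0 r := by
  intro x hx
  set t := inner ℝ θ x with ht
  set y := x - t • θ with hy
  have hy0 : inner ℝ θ y = 0 := by
    rw [hy, inner_sub_right, inner_smul_right, real_inner_self_eq_norm_sq, hθ]; simp [ht]
  have hxy : x = y + t • θ := by simp [hy]
  obtain ⟨s, -, hfib⟩ := lineFiber_ball hθ hy0 hr
  have h1 : t ∈ lineFiber θ (steinerSymm θ A) y := by
    change y + t • θ ∈ steinerSymm θ A
    rwa [← hxy]
  rw [lineFiber_steinerSymm hθ A hy0] at h1
  have h2 : volume (lineFiber θ A y) ≤ ENNReal.ofReal (2 * s) := by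
    refine (measure_mono (t := Ioo (-s) s) ?_).trans_eq ?_
    · rw [← hfib]; exact fun t ht => hA ht
    · rw [Real.volume_Ioo]; congr 1; ring
  have h3 : 2 * ENNReal.ofReal |t| < ENNReal.ofReal (2 * s) := lt_of_lt_of_le h1 h2
  rw [← ENNReal.ofReal_ofNat, ← ENNReal.ofReal_mul (by norm_num),
    ENNReal.ofReal_lt_ofReal_iff_of_nonneg (by positivity)] at h3
  have h4 : t ∈ lineFiber θ (Metric.ball 0 r) y := by
    rw [hfib, mem_Ioo, ← abs_lt]; linarith
  rw [hxy]
  exact h4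

/-- One-dimensional gain of centring a set, relative to a centred interval. -/
theorem volume_centred_diff_add_le {a : Set ℝ} (ha : MeasurableSet a) (hfin : volume a ≠ ∞)
    {s : ℝ} (τ : ℝ) :
    volume ({t : ℝ | 2 * ENNReal.ofReal |t| < volume a} \ Ioo (-s) s) +
      volume {t | t ∈ a \ Ioo (-s) s ∧ t + τ ∈ Ioo (-s) s \ a} ≤ volume (a \ Ioo (-s) s) := by
  set b := Ioo (-s) s with hb
  have hbm : MeasurableSet b := measurableSet_Ioo
  have hbfin : volume b ≠ ∞ := measure_Ioo_lt_top.ne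
  have hU : volume {t | t ∈ a \ b ∧ t + τ ∈ b \ a} ≤ volume (a \ b) :=
    measure_mono fun t ht => ht.1
  have hV : volume {t | t ∈ a \ b ∧ t + τ ∈ b \ a} ≤ volume (b \ a) := by
    rw [← measure_preimage_add_right volume τ (b \ a)]
    exact measure_mono fun t ht => ht.2
  have hbal : volume (a \ b) + volume b = volume (b \ a) + volume a := by
    rw [← measure_union disjoint_sdiff_left hbm, ← measure_union disjoint_sdiff_left ha,
      sdiff_union_self, sdiff_union_self, union_comm]
  rw [setOf_two_mul_abs_lt_eq_Ioo hfin]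
  -- If `a` is no longer than `b`, centring moves it inside `b`, and the second term is at most `|a
  -- \ b|`. Otherwise the centred set exceeds `b` by `|a| - |b| = |a \ b| - |b \ a|`, and the second
  -- term is at most `|b \ a|`.
  rcases le_total ((volume a).toReal / 2) s with h | h
  · have : Ioo (-((volume a).toReal / 2)) ((volume a).toReal / 2) \ b = ∅ := by
      rw [sdiff_eq_empty]
      exact Ioo_subset_Ioo (by linarith) h
    rw [this, measure_empty, zero_add]
    exact hU
  · rw [measure_sdiff (Ioo_subset_Ioo (by linarith) h) hbm.nullMeasurableSet hbfin,
      Real.volume_Ioo, sub_neg_eq_add, add_halves, ENNReal.ofReal_toReal hfin]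
    have h2 : volume b ≤ volume a := by
      rw [hb, Real.volume_Ioo, ← ENNReal.ofReal_toReal hfin]
      exact ENNReal.ofReal_le_ofReal (by linarith)
    have h3 : volume a - volume b + volume (b \ a) + volume b = volume (a \ b) + volume b := by
      rw [hbal, add_right_comm, tsub_add_cancel_of_le h2, add_comm]
    rw [← (ENNReal.add_left_inj hbfin).1 h3]
    gcongr

/-- Quantitative gain of Steiner symmetrization relative to a centred ball. -/
theorem volume_steinerSymm_diff_add_le {n : ℕ} {θ : EuclideanSpace ℝ (Fin n)} (hθ : ‖θ‖ = 1)
    {A : Set (EuclideanSpace ℝ (Fin n))} (hA : MeasurableSet A) {R : ℝ}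
    (hR : A ⊆ Metric.ball 0 R) {r : ℝ} (hr : 0 ≤ r) (τ : ℝ) :
    volume (steinerSymm θ A \ Metric.ball 0 r) +
      volume {x | x ∈ A \ Metric.ball 0 r ∧ x + τ • θ ∈ Metric.ball 0 r \ A} ≤
      volume (A \ Metric.ball 0 r) := by
  have hBm : MeasurableSet (Metric.ball (0 : EuclideanSpace ℝ (Fin n)) r) := measurableSet_ball
  have h1 := (measurableSet_steinerSymm (θ := θ) hA).diff hBm
  have h2 : MeasurableSet {x | x ∈ A \ Metric.ball 0 r ∧ x + τ • θ ∈ Metric.ball 0 r \ A} :=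
    (hA.diff hBm).inter ((hBm.diff hA).preimage (by fun_prop))
  rw [volume_eq_lintegral_lineFiber hθ rfl h1, volume_eq_lintegral_lineFiber hθ rfl h2,
    volume_eq_lintegral_lineFiber hθ rfl (hA.diff hBm),
    ← lintegral_add_left (by exact (measurable_volume_lineFiber h1).comp measurable_subtype_coe)]
  refine lintegral_mono fun y => ?_
  have hy := inner_eq_zero_of_mem_orthogonal_span rfl y
  obtain ⟨s, -, hfib⟩ := lineFiber_ball hθ hy hr
  have hfin := volume_lineFiber_ne_top hθ hR hy
  have key := volume_centred_diff_add_le (measurableSet_lineFiber (θ := θ) hA y) hfin (s := s) τ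
  rw [← hfib, ← lineFiber_steinerSymm hθ A hy] at key
  convert! key using 3
  ext t
  simp [lineFiber, add_smul, add_assoc]

end Steiner

/-! ### Rearrangement of product sets in `ℝⁿ`. -/

/-- The sections of `L` along every direction `θ` are convex and symmetric. -/
def IsSteinerConvex {n k : ℕ} (L : Set (Fin k → EuclideanSpace ℝ (Fin n))) : Prop :=
  ∀ θ : EuclideanSpace ℝ (Fin n), ‖θ‖ = 1 → ∀ y : Fin k → EuclideanSpace ℝ (Fin n),
    (∀ j, inner ℝ θ (y j) = 0) →
      Convex ℝ {t : Fin k → ℝ | (fun j => y j + t j • θ) ∈ L} ∧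
      ∀ t ∈ {t : Fin k → ℝ | (fun j => y j + t j • θ) ∈ L},
        -t ∈ {t : Fin k → ℝ | (fun j => y j + t j • θ) ∈ L}

theorem measurePreserving_pi_orthogonal_add {n k : ℕ}
    {S : Submodule ℝ (EuclideanSpace ℝ (Fin n))} {θ : EuclideanSpace ℝ (Fin n)} (hθ : ‖θ‖ = 1)
    (hS : S = (Submodule.span ℝ {θ})ᗮ) :
    MeasurePreserving (fun (p : (Fin k → S) × (Fin k → ℝ)) j =>
        (p.1 j : EuclideanSpace ℝ (Fin n)) + p.2 j • θ)
      ((Measure.pi fun _ => subspaceVolume S).prod volume) volume :=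
  (measurePreserving_pi (fun _ : Fin k => (subspaceVolume S).prod volume) (fun _ => volume)
    fun _ => measurePreserving_orthogonal_add hθ hS).comp
    (measurePreserving_arrowProdEquivProdArrow S ℝ (Fin k) (fun _ => subspaceVolume S)
      fun _ => volume).symm

/-- Steiner symmetrization of all factors increases the volume of the part of a product set
inside a set with convex symmetric sections. -/
theorem volume_inter_pi_le_steinerSymm {n k : ℕ} {L : Set (Fin k → EuclideanSpace ℝ (Fin n))}
    (hL : MeasurableSet L) (hLc : IsSteinerConvex L) {θ : EuclideanSpace ℝ (Fin n)}
    (hθ : ‖θ‖ = 1) {A : Fin k → Set (EuclideanSpace ℝ (Fin n))} (hA : ∀ j, MeasurableSet (A j))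
    {R : ℝ} (hR : ∀ j, A j ⊆ Metric.ball 0 R) :
    volume (L ∩ univ.pi A) ≤ volume (L ∩ univ.pi fun j => steinerSymm θ (A j)) := by
  set S := (Submodule.span ℝ {θ})ᗮ with hS
  have hmp := measurePreserving_pi_orthogonal_add (k := k) hθ hS
  have h1 : MeasurableSet (L ∩ univ.pi A) := hL.inter (MeasurableSet.univ_pi hA)
  have h2 : MeasurableSet (L ∩ univ.pi fun j => steinerSymm θ (A j)) :=
    hL.inter (MeasurableSet.univ_pi fun j => measurableSet_steinerSymm (hA j))
  -- With the components orthogonal to `θ` fixed, what remains is the inequality on the line for the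
  -- fibres of the `A j`.
  rw [← hmp.measure_preimage h1.nullMeasurableSet, ← hmp.measure_preimage h2.nullMeasurableSet,
    Measure.prod_apply (hmp.measurable h1), Measure.prod_apply (hmp.measurable h2)]
  refine lintegral_mono fun y => ?_
  have hy : ∀ j, inner ℝ θ (y j : EuclideanSpace ℝ (Fin n)) = 0 := fun j =>
    inner_eq_zero_of_mem_orthogonal_span hS (y j)
  obtain ⟨hc, hs⟩ := hLc θ hθ (fun j => y j) hy
  have hM : MeasurableSet {t : Fin k → ℝ |
      (fun j => (y j : EuclideanSpace ℝ (Fin n)) + t j • θ) ∈ L} :=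
    hL.preimage (by fun_prop)
  have hfin : ∀ j, volume (lineFiber θ (A j) (y j)) ≠ ∞ := fun j =>
    volume_lineFiber_ne_top hθ (hR j) (hy j)
  have key := volume_inter_pi_le_pi_Ioo hM hc hs (fun j => lineFiber θ (A j) (y j)) hfin
  refine le_trans (le_of_eq ?_) (key.trans_eq ?_)
  · congr 1
  · congr 1
    ext t
    simp only [mem_inter_iff, mem_preimage, mem_ofPred_eq, mem_pi, mem_univ, true_imp_iff]
    refine and_congr_right fun _ => forall_congr' fun j => ?_
    have e := lineFiber_steinerSymm hθ (A j) (hy j)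
    rw [setOf_two_mul_abs_lt_eq_Ioo (hfin j)] at e
    change t j ∈ Ioo _ _ ↔ t j ∈ lineFiber θ (steinerSymm θ (A j)) (y j)
    rw [e]
    rfl

/-- First moment argument: some direction gives a definite gain for all sets simultaneously. -/
theorem exists_steinerSymm_gain {n k : ℕ} (hn : 1 ≤ n)
    {A : Fin k → Set (EuclideanSpace ℝ (Fin n))} (hA : ∀ j, MeasurableSet (A j)) {R : ℝ}
    (hR0 : 0 < R) (hR : ∀ j, A j ⊆ Metric.ball 0 R) (r : Fin k → ℝ) (hr0 : ∀ j, 0 ≤ r j)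
    (hr : ∀ j, r j ≤ R) (hvol : ∀ j, volume (A j) =
      volume (Metric.ball (0 : EuclideanSpace ℝ (Fin n)) (r j))) :
    ∃ θ : EuclideanSpace ℝ (Fin n), ‖θ‖ = 1 ∧
      ∑ j, volume.real (steinerSymm θ (A j) \ Metric.ball 0 (r j)) +
        (volume.real (Metric.ball (0 : EuclideanSpace ℝ (Fin n)) (2 * R)))⁻¹ *
          ∑ j, volume.real (A j \ Metric.ball 0 (r j)) ^ 2 ≤
      ∑ j, volume.real (A j \ Metric.ball 0 (r j)) := by
  set B : Fin k → Set (EuclideanSpace ℝ (Fin n)) := fun j => Metric.ball 0 (r j)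
  have hBm : ∀ j, MeasurableSet (B j) := fun j => measurableSet_ball
  have hAfin : ∀ j, volume (A j) ≠ ∞ := fun j =>
    ((measure_mono (hR j)).trans_lt measure_ball_lt_top).ne
  have hUfin : ∀ j, volume (A j \ B j) ≠ ∞ := fun j =>
    measure_ne_top_of_subset sdiff_subset (hAfin j)
  -- `T j v` consists of the points of `A j \ B j` that the translation by `v` carries into the hole
  -- `B j \ A j`. By Tonelli its volume integrates over `v` to `|A j \ B j| |B j \ A j| = |A j \ B
  -- j|²`, and only `v` in the ball of radius `2R` contribute. Some such `v` does at least as well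
  -- as the average, and its direction is the `θ` sought.
  set T : Fin k → EuclideanSpace ℝ (Fin n) → Set (EuclideanSpace ℝ (Fin n)) :=
    fun j v => {x | x ∈ A j \ B j ∧ x + v ∈ B j \ A j}
  have hTU : ∀ j v, volume (T j v) ≤ volume (A j \ B j) := fun j v => measure_mono fun x hx => hx.1
  have hTm : ∀ j, MeasurableSet {p : EuclideanSpace ℝ (Fin n) × EuclideanSpace ℝ (Fin n) |
      p.2 ∈ T j p.1} := fun j =>
    (((hA j).diff (hBm j)).preimage measurable_snd).inter
      (((hBm j).diff (hA j)).preimage (measurable_snd.add measurable_fst))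
  set W := Metric.ball (0 : EuclideanSpace ℝ (Fin n)) (2 * R)
  have : Nonempty (Fin n) := ⟨⟨0, hn⟩⟩
  have hW0 : volume W ≠ 0 := (Metric.measure_ball_pos _ _ (by positivity)).ne'
  have hWt : volume W ≠ ∞ := measure_ball_lt_top.ne
  have hVU : ∀ j, volume (B j \ A j) = volume (A j \ B j) := fun j =>
    measure_sdiff_symm (hBm j).nullMeasurableSet (hA j).nullMeasurableSet (hvol j).symm
      (measure_ne_top_of_subset inter_subset_right (hAfin j))
  have hint : ∀ j, ∫⁻ v in W, volume (T j v) = volume (A j \ B j) ^ 2 := by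
    intro j
    have h1 : ∫⁻ v in W, volume (T j v) = ∫⁻ v, volume (T j v) := by
      rw [← lintegral_indicator measurableSet_ball]
      refine lintegral_congr fun v => ?_
      by_cases hv : v ∈ W
      · rw [indicator_of_mem hv]
      · rw [indicator_of_notMem hv]
        refine (measure_mono_null (t := ∅) ?_ measure_empty).symm
        rintro x ⟨hx, hxv⟩
        refine hv ?_
        have h1 := hR j hx.1
        have h2 := Metric.ball_subset_ball (hr j) hxv.1
        rw [mem_ball_zero_iff] at h1 h2 ⊢
        calc ‖v‖ = ‖(x + v) - x‖ := by simp
          _ ≤ ‖x + v‖ + ‖x‖ := norm_sub_le _ _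
          _ < 2 * R := by linarith
    have h2 : ∫⁻ v, volume (T j v) = (volume.prod volume)
        {p : EuclideanSpace ℝ (Fin n) × EuclideanSpace ℝ (Fin n) | p.2 ∈ T j p.1} := by
      rw [Measure.prod_apply (hTm j)]; rfl
    rw [h1, h2, Measure.prod_apply_symm (hTm j)]
    have h3 : ∀ x, volume ((fun v => (v, x)) ⁻¹' {p : EuclideanSpace ℝ (Fin n) ×
        EuclideanSpace ℝ (Fin n) | p.2 ∈ T j p.1}) =
        (A j \ B j).indicator (fun _ => volume (A j \ B j)) x := by
      intro x
      by_cases hx : x ∈ A j \ B j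
      · rw [indicator_of_mem hx, ← hVU j, ← measure_preimage_add volume x (B j \ A j)]
        congr 1
        ext v
        exact and_iff_right hx
      · rw [indicator_of_notMem hx]
        exact measure_mono_null (t := ∅) (fun v hv => hx hv.1) measure_empty
    rw [lintegral_congr h3, lintegral_indicator_const ((hA j).diff (hBm j)), sq]
  have hTmeas : ∀ j, Measurable fun v => volume (T j v) := fun j => measurable_measure_prodMk_left (hTm j)
  obtain ⟨v, -, hv⟩ : ∃ v ∈ W, laverage (volume.restrict W) (fun v => ∑ j, volume (T j v)) ≤ ∑ j, volume (T j v) := by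
    refine exists_setLAverage_le hW0 measurableSet_ball.nullMeasurableSet ?_
    rw [lintegral_finsetSum _ fun j _ => hTmeas j]
    simp only [hint]
    exact ENNReal.sum_ne_top.2 fun j _ => ENNReal.pow_ne_top (hUfin j)
  rw [setLAverage_eq, lintegral_finsetSum _ fun j _ => hTmeas j] at hv
  simp only [hint] at hv
  obtain ⟨θ, hθ, τ, rfl⟩ : ∃ θ : EuclideanSpace ℝ (Fin n), ‖θ‖ = 1 ∧ ∃ τ : ℝ, v = τ • θ := by
    by_cases hv0 : v = 0
    -- The zero vector has no direction; any unit vector with `τ = 0` serves.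
    · exact ⟨EuclideanSpace.single ⟨0, hn⟩ 1, by simp, 0, by simp [hv0]⟩
    · exact ⟨‖v‖⁻¹ • v, norm_smul_inv_norm hv0, ‖v‖, by
        rw [smul_smul, mul_inv_cancel₀ (norm_ne_zero_iff.2 hv0), one_smul]⟩
  refine ⟨θ, hθ, ?_⟩
  have hgain : ∀ j, volume (steinerSymm θ (A j) \ B j) + volume (T j (τ • θ)) ≤
      volume (A j \ B j) := fun j =>
    volume_steinerSymm_diff_add_le hθ (hA j) (hR j) (hr0 j) τ
  have hgain' : ∀ j, volume.real (steinerSymm θ (A j) \ B j) + volume.real (T j (τ • θ)) ≤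
      volume.real (A j \ B j) := by
    intro j
    have h1 : volume (steinerSymm θ (A j) \ B j) ≠ ∞ :=
      ne_top_of_le_ne_top (hUfin j) (le_self_add.trans (hgain j))
    have h2 : volume (T j (τ • θ)) ≠ ∞ := ne_top_of_le_ne_top (hUfin j) (hTU j _)
    rw [Measure.real, Measure.real, ← ENNReal.toReal_add h1 h2]
    exact ENNReal.toReal_mono (hUfin j) (hgain j)
  have hv' : (volume.real W)⁻¹ * ∑ j, volume.real (A j \ B j) ^ 2 ≤
      ∑ j, volume.real (T j (τ • θ)) := by
    have := ENNReal.toReal_mono (ENNReal.sum_ne_top.2 fun j _ =>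
      ne_top_of_le_ne_top (hUfin j) (hTU j (τ • θ))) hv
    rw [ENNReal.toReal_div, ENNReal.toReal_sum fun j _ => ENNReal.pow_ne_top (hUfin j),
      ENNReal.toReal_sum fun j _ => ne_top_of_le_ne_top (hUfin j) (hTU j (τ • θ))] at this
    simp only [ENNReal.toReal_pow] at this
    rw [div_eq_inv_mul] at this
    exact this
  calc _ ≤ ∑ j, volume.real (steinerSymm θ (A j) \ B j) + ∑ j, volume.real (T j (τ • θ)) := by
        gcongr
    _ = ∑ j, (volume.real (steinerSymm θ (A j) \ B j) + volume.real (T j (τ • θ))) :=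
        Finset.sum_add_distrib.symm
    _ ≤ _ := Finset.sum_le_sum fun j _ => hgain' j

/-- Finitely many successive Steiner symmetrizations bring all sets simultaneously close to
balls. -/
theorem exists_iterated_steinerSymm_close {n k : ℕ} (hn : 1 ≤ n)
    {L : Set (Fin k → EuclideanSpace ℝ (Fin n))} (hL : MeasurableSet L) (hLc : IsSteinerConvex L)
    {A : Fin k → Set (EuclideanSpace ℝ (Fin n))} (hA : ∀ j, MeasurableSet (A j)) {R : ℝ}
    (hR0 : 0 < R) (hR : ∀ j, A j ⊆ Metric.ball 0 R) (r : Fin k → ℝ) (hr0 : ∀ j, 0 ≤ r j)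
    (hr : ∀ j, r j ≤ R) (hvol : ∀ j, volume (A j) =
      volume (Metric.ball (0 : EuclideanSpace ℝ (Fin n)) (r j))) {ε : ℝ} (hε : 0 < ε) :
    ∃ A' : Fin k → Set (EuclideanSpace ℝ (Fin n)), (∀ j, A' j ⊆ Metric.ball 0 R) ∧
      volume (L ∩ univ.pi A) ≤ volume (L ∩ univ.pi A') ∧
      ∑ j, volume.real (A' j \ Metric.ball 0 (r j)) < ε := by
  by_contra! hcon
  have : Nonempty (Fin n) := ⟨⟨0, hn⟩⟩
  have hk : 0 < k := by
    rcases Nat.eq_zero_or_pos k with rfl | h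
    · have := hcon A hR le_rfl
      simp at this
      linarith
    · exact h
  set w := volume.real (Metric.ball (0 : EuclideanSpace ℝ (Fin n)) (2 * R))
  have hw : 0 < w := ENNReal.toReal_pos (Metric.measure_ball_pos _ _ (by positivity)).ne'
    measure_ball_lt_top.ne
  -- As long as the total excess is at least `ε`, Cauchy–Schwarz bounds the sum of squares below by
  -- `ε²/k`. Each symmetrization then lowers the excess by at least `η`, which cannot go on forever.
  set η : ℝ := w⁻¹ * (ε ^ 2 / k)
  have hη : 0 < η := by positivity
  have hiter : ∀ N : ℕ, ∃ A' : Fin k → Set (EuclideanSpace ℝ (Fin n)),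
      (∀ j, MeasurableSet (A' j)) ∧ (∀ j, A' j ⊆ Metric.ball 0 R) ∧
      (∀ j, volume (A' j) = volume (Metric.ball (0 : EuclideanSpace ℝ (Fin n)) (r j))) ∧
      volume (L ∩ univ.pi A) ≤ volume (L ∩ univ.pi A') ∧
      ∑ j, volume.real (A' j \ Metric.ball 0 (r j)) + N * η ≤
        ∑ j, volume.real (A j \ Metric.ball 0 (r j)) := by
    intro N
    induction N with
    | zero => exact ⟨A, hA, hR, hvol, le_rfl, by simp⟩
    | succ N ih =>
      obtain ⟨A', hA', hR', hvol', hJ, hD⟩ := ih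
      obtain ⟨θ, hθ, hgain⟩ := exists_steinerSymm_gain hn hA' hR0 hR' r hr0 hr hvol'
      refine ⟨fun j => steinerSymm θ (A' j), fun j => measurableSet_steinerSymm (hA' j),
        fun j => steinerSymm_subset_ball hθ hR0.le (hR' j),
        fun j => (volume_steinerSymm hθ (hA' j)).trans (hvol' j),
        hJ.trans (volume_inter_pi_le_steinerSymm hL hLc hθ hA' hR'), ?_⟩
      have hge := hcon A' hR' hJ
      have hsq : ε ^ 2 / k ≤ ∑ j, volume.real (A' j \ Metric.ball 0 (r j)) ^ 2 := by
        have h := sq_sum_le_card_mul_sum_sq (s := (Finset.univ : Finset (Fin k)))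
          (f := fun j => volume.real (A' j \ Metric.ball 0 (r j)))
        rw [Finset.card_univ, Fintype.card_fin] at h
        rw [div_le_iff₀' (by exact_mod_cast hk)]
        exact (pow_le_pow_left₀ hε.le hge 2).trans h
      have hη' : η ≤ w⁻¹ * ∑ j, volume.real (A' j \ Metric.ball 0 (r j)) ^ 2 := by
        simp only [η]; gcongr
      push_cast
      linarith
  obtain ⟨N, hN⟩ := exists_nat_gt ((∑ j, volume.real (A j \ Metric.ball 0 (r j))) / η)
  obtain ⟨A', -, -, -, -, hD⟩ := hiter N
  rw [div_lt_iff₀ hη] at hN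
  have : 0 ≤ ∑ j, volume.real (A' j \ Metric.ball 0 (r j)) :=
    Finset.sum_nonneg fun j _ => measureReal_nonneg
  linarith

/-- After symmetrizations with excess below `ε`, a point of the product outside the product of balls
has one coordinate in some excess set and the others in the ball of radius `R`. Such points have
volume at most `ε w^(k-1)`, which tends to zero with `ε`. -/
theorem volume_inter_pi_le_pi_ball {n k : ℕ} (hn : 1 ≤ n)
    {L : Set (Fin k → EuclideanSpace ℝ (Fin n))} (hL : MeasurableSet L) (hLc : IsSteinerConvex L)
    {A : Fin k → Set (EuclideanSpace ℝ (Fin n))} (hA : ∀ j, MeasurableSet (A j)) {R : ℝ}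
    (hR0 : 0 < R) (hR : ∀ j, A j ⊆ Metric.ball 0 R) (r : Fin k → ℝ) (hr0 : ∀ j, 0 ≤ r j)
    (hr : ∀ j, r j ≤ R) (hvol : ∀ j, volume (A j) =
      volume (Metric.ball (0 : EuclideanSpace ℝ (Fin n)) (r j))) :
    volume (L ∩ univ.pi A) ≤ volume (L ∩ univ.pi fun j => Metric.ball 0 (r j)) := by
  set w := volume (Metric.ball (0 : EuclideanSpace ℝ (Fin n)) R)
  have hw : w ≠ ∞ := measure_ball_lt_top.ne
  have hstep : ∀ ε : ℝ, 0 < ε → volume (L ∩ univ.pi A) ≤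
      volume (L ∩ univ.pi fun j => Metric.ball 0 (r j)) + ENNReal.ofReal ε * w ^ (k - 1) := by
    intro ε hε
    obtain ⟨A', hR', hJ, hD⟩ :=
      exists_iterated_steinerSymm_close hn hL hLc hA hR0 hR r hr0 hr hvol hε
    refine hJ.trans ?_
    have hcov : L ∩ univ.pi A' ⊆ (L ∩ univ.pi fun j => Metric.ball 0 (r j)) ∪
        ⋃ j, univ.pi (Function.update (fun _ => Metric.ball 0 R) j
          (A' j \ Metric.ball 0 (r j))) := by
      rintro x ⟨hx, hxA⟩
      by_cases h : ∀ j, x j ∈ Metric.ball (0 : EuclideanSpace ℝ (Fin n)) (r j)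
      · exact Or.inl ⟨hx, fun j _ => h j⟩
      · push Not at h
        obtain ⟨j, hj⟩ := h
        refine Or.inr (mem_iUnion.2 ⟨j, fun i _ => ?_⟩)
        by_cases hi : i = j
        · subst hi; simpa using ⟨hxA i (mem_univ _), by simpa using hj⟩
        · simpa [hi] using hR' i (hxA i (mem_univ _))
    have hbox : ∀ j, volume (univ.pi (Function.update
        (fun _ => Metric.ball (0 : EuclideanSpace ℝ (Fin n)) R) j
          (A' j \ Metric.ball 0 (r j)))) = volume (A' j \ Metric.ball 0 (r j)) * w ^ (k - 1) := by
      intro j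
      rw [volume_pi_pi, ← Finset.mul_prod_erase _ _ (Finset.mem_univ j), Function.update_self,
        Finset.prod_congr rfl fun i hi => by
          rw [Function.update_of_ne (Finset.ne_of_mem_erase hi)],
        Finset.prod_const, Finset.card_erase_of_mem (Finset.mem_univ j), Finset.card_univ,
        Fintype.card_fin]
    calc volume (L ∩ univ.pi A') ≤ _ := measure_mono hcov
      _ ≤ _ := measure_union_le _ _
      _ ≤ volume (L ∩ univ.pi fun j => Metric.ball 0 (r j)) +
          ∑ j, volume (A' j \ Metric.ball 0 (r j)) * w ^ (k - 1) := by
          gcongr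
          refine (measure_iUnion_fintype_le _ _).trans_eq (Finset.sum_congr rfl fun j _ => hbox j)
      _ ≤ _ := by
          rw [← Finset.sum_mul]
          gcongr
          have : ∑ j, volume (A' j \ Metric.ball 0 (r j)) =
              ENNReal.ofReal (∑ j, volume.real (A' j \ Metric.ball 0 (r j))) := by
            rw [ENNReal.ofReal_sum_of_nonneg fun j _ => measureReal_nonneg]
            refine Finset.sum_congr rfl fun j _ => (ENNReal.ofReal_toReal ?_).symm
            exact measure_ne_top_of_subset (sdiff_subset.trans (hR' j)) hw
          rw [this]
          exact ENNReal.ofReal_le_ofReal hD.le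
  have hc : Continuous fun ε : ℝ => ENNReal.ofReal ε * w ^ (k - 1) :=
    (ENNReal.continuous_mul_const (ENNReal.pow_ne_top hw)).comp ENNReal.continuous_ofReal
  have hlim : Filter.Tendsto (fun ε : ℝ => volume (L ∩ univ.pi fun j => Metric.ball 0 (r j)) +
      ENNReal.ofReal ε * w ^ (k - 1)) (nhdsWithin 0 (Ioi 0))
      (nhds (volume (L ∩ univ.pi fun j => Metric.ball 0 (r j)) +
        ENNReal.ofReal 0 * w ^ (k - 1))) :=
    ((hc.tendsto 0).const_add _).mono_left nhdsWithin_le_nhds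
  rw [ENNReal.ofReal_zero, zero_mul, add_zero] at hlim
  exact ge_of_tendsto hlim (by filter_upwards [self_mem_nhdsWithin] with ε hε using hstep ε hε)

theorem symmRearrangement_subset {n : ℕ} {A A' : Set (EuclideanSpace ℝ (Fin n))}
    (h : volume A ≤ volume A') (hA' : volume A' ≠ ∞) :
    symmRearrangement A ⊆ symmRearrangement A' := by
  refine Metric.ball_subset_ball ?_
  have : volume.real A ≤ volume.real A' := ENNReal.toReal_mono hA' h
  gcongr

/-- The rearrangement inequality: for a set `L` all of whose directional sections are convex and
symmetric, the volume of `L ∩ ∏ A_j` increases when every `A_j` is replaced by its symmetric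
rearrangement. -/
theorem volume_inter_pi_le_symmRearrangement {n k : ℕ} (hn : 1 ≤ n)
    {L : Set (Fin k → EuclideanSpace ℝ (Fin n))} (hL : MeasurableSet L) (hLc : IsSteinerConvex L)
    {A : Fin k → Set (EuclideanSpace ℝ (Fin n))} (hA : ∀ j, MeasurableSet (A j))
    (hfin : ∀ j, volume (A j) ≠ ∞) :
    volume (L ∩ univ.pi A) ≤ volume (L ∩ univ.pi fun j => symmRearrangement (A j)) := by
  have hmono : Monotone fun N : ℕ => L ∩ univ.pi fun j => A j ∩ Metric.ball 0 N := by
    intro N N' h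
    refine inter_subset_inter_right _ (pi_mono fun j _ => inter_subset_inter_right _ ?_)
    exact Metric.ball_subset_ball (by exact_mod_cast h)
  have hU : L ∩ univ.pi A = ⋃ N : ℕ, L ∩ univ.pi fun j => A j ∩ Metric.ball 0 N := by
    ext x
    simp only [mem_inter_iff, mem_iUnion, mem_pi, mem_univ, true_imp_iff]
    constructor
    · rintro ⟨hx, h⟩
      obtain ⟨N, hN⟩ := exists_nat_gt (∑ j, ‖x j‖)
      refine ⟨N, hx, fun j => ⟨h j, ?_⟩⟩
      rw [mem_ball_zero_iff]
      exact (Finset.single_le_sum (fun i _ => norm_nonneg (x i)) (Finset.mem_univ j)).trans_lt hN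
    · rintro ⟨N, hx, h⟩
      exact ⟨hx, fun j => (h j).1⟩
  rw [hU, hmono.measure_iUnion]
  refine iSup_le fun N => ?_
  set r : Fin k → ℝ := fun j => (volume.real (A j ∩ Metric.ball 0 N) /
    volume.real (Metric.ball (0 : EuclideanSpace ℝ (Fin n)) 1)) ^ (1 / (n : ℝ))
  have hr0 : ∀ j, 0 ≤ r j := fun j => by positivity
  have hfin' : ∀ j, volume (A j ∩ Metric.ball 0 N) ≠ ∞ := fun j =>
    measure_ne_top_of_subset inter_subset_left (hfin j)
  -- `R` must exceed the truncation radius `N` and every radius `r j`, and be positive.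
  refine (volume_inter_pi_le_pi_ball hn hL hLc (fun j => (hA j).inter measurableSet_ball)
    (R := N + 1 + ∑ j, r j) ?_ (fun j => ?_) r hr0 (fun j => ?_) fun j => ?_).trans ?_
  · have := Finset.sum_nonneg fun j (_ : j ∈ Finset.univ) => hr0 j
    positivity
  · refine inter_subset_right.trans (Metric.ball_subset_ball ?_)
    linarith [Finset.sum_nonneg fun j (_ : j ∈ Finset.univ) => hr0 j]
  · have := Finset.single_le_sum (fun j _ => hr0 j) (Finset.mem_univ j)
    have hN : (0 : ℝ) ≤ N := by positivity
    linarith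
  · exact (volume_symmRearrangement hn _ (hfin' j)).symm
  · refine measure_mono (inter_subset_inter_right _ (pi_mono fun j _ => ?_))
    exact symmRearrangement_subset (measure_mono inter_subset_left) (hfin j)

/-! ### Cauchy's formula, shadow systems and convexity of the polar projection graph. -/

theorem exists_Icc_eq_of_isCompact_of_convex {I : Set ℝ} (hc : IsCompact I) (hI : Convex ℝ I)
    (h0 : I.Nonempty) : ∃ a ∈ I, ∃ b ∈ I, a ≤ b ∧ I = Icc a b := by
  have h := eq_Icc_of_connected_compact ⟨h0, hI.isPreconnected⟩ hc
  refine ⟨sInf I, hc.sInf_mem h0, sSup I, hc.sSup_mem h0, ?_, h⟩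
  exact csInf_le hc.bddBelow (hc.sSup_mem h0)

/-- The volume of the sum of a compact convex set and the segment `[0, Nu]`. -/
theorem volume_add_segment {n : ℕ} {K : Set (EuclideanSpace ℝ (Fin n))} (hK : IsCompact K)
    (hKc : Convex ℝ K) (u : EuclideanSpace ℝ (Fin n)) {N : ℝ} (hN : 0 ≤ N) :
    volume {z | ∃ p ∈ K, ∃ s ∈ Icc 0 N, z = p + s • u} =
      volume K + ENNReal.ofReal N * projectionBodySupport K u := by
  have hcompact : IsCompact {z | ∃ p ∈ K, ∃ s ∈ Icc 0 N, z = p + s • u} := by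
    have : {z | ∃ p ∈ K, ∃ s ∈ Icc 0 N, z = p + s • u} =
        (fun q : EuclideanSpace ℝ (Fin n) × ℝ => q.1 + q.2 • u) '' (K ×ˢ Icc 0 N) := by
      ext z; simp [eq_comm, and_assoc]
    rw [this]
    exact (hK.prod isCompact_Icc).image (by fun_prop)
  by_cases hu : u = 0
  · subst hu
    have : {z | ∃ p ∈ K, ∃ s ∈ Icc 0 N, z = p + s • (0 : EuclideanSpace ℝ (Fin n))} = K := by
      ext z
      simp only [smul_zero, add_zero, mem_ofPred_eq]
      exact ⟨fun ⟨p, hp, _, _, h⟩ => h ▸ hp, fun h => ⟨z, h, 0, ⟨le_rfl, hN⟩, rfl⟩⟩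
    rw [this, projectionBodySupport]
    simp
  have hu0 : 0 < ‖u‖ := norm_pos_iff.2 hu
  set θ : EuclideanSpace ℝ (Fin n) := ‖u‖⁻¹ • u
  have hθ : ‖θ‖ = 1 := norm_smul_inv_norm hu
  have huθ : u = ‖u‖ • θ := by
    rw [smul_smul, mul_inv_cancel₀ hu0.ne', one_smul]
  set S := (Submodule.span ℝ {u})ᗮ with hSdef
  have hS : S = (Submodule.span ℝ {θ})ᗮ := by
    rw [hSdef, Submodule.span_singleton_smul_eq (inv_ne_zero hu0.ne').isUnit u]
  have hproj : ∀ y : S, (lineFiber θ K y).Nonempty ↔ y ∈ S.orthogonalProjectionOnto '' K := by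
    intro y
    have hPθ : S.orthogonalProjectionOnto θ = 0 := by
      rw [Submodule.orthogonalProjectionOnto_eq_zero_iff, hS]
      exact Submodule.le_orthogonal_orthogonal _ (Submodule.mem_span_singleton_self θ)
    constructor
    · rintro ⟨t, ht⟩
      refine ⟨_, ht, ?_⟩
      rw [map_add, map_smul, hPθ, smul_zero, add_zero,
        Submodule.orthogonalProjectionOnto_mem_subspace_eq_self]
    · rintro ⟨p, hp, rfl⟩
      have h1 : p - S.orthogonalProjectionOnto p ∈ Submodule.span ℝ {θ} := by
        rw [← (Submodule.span ℝ {θ}).orthogonal_orthogonal, ← hS]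
        exact S.sub_starProjection_mem_orthogonal p
      obtain ⟨t, ht⟩ := Submodule.mem_span_singleton.1 h1
      refine ⟨t, ?_⟩
      change _ + t • θ ∈ K
      rwa [ht, add_sub_cancel]
  -- A fibre parallel to `u` is nonempty exactly over the projection of `K`; there it is a compact
  -- interval, and adding the segment lengthens it by `N‖u‖`.
  have hfib : ∀ y : S, volume (lineFiber θ {z | ∃ p ∈ K, ∃ s ∈ Icc 0 N, z = p + s • u} y) =
      volume (lineFiber θ K y) +
        (S.orthogonalProjectionOnto '' K).indicator (fun _ => ENNReal.ofReal (N * ‖u‖)) y := by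
    intro y
    have hexp : lineFiber θ {z | ∃ p ∈ K, ∃ s ∈ Icc 0 N, z = p + s • u} y =
        {t | ∃ a ∈ lineFiber θ K y, ∃ s ∈ Icc 0 N, t = a + s * ‖u‖} := by
      ext t
      constructor
      · rintro ⟨p, hp, s, hs, h⟩
        refine ⟨t - s * ‖u‖, ?_, s, hs, by ring⟩
        change (y : EuclideanSpace ℝ (Fin n)) + (t - s * ‖u‖) • θ ∈ K
        rw [sub_smul, mul_smul, ← huθ, ← add_sub_assoc, h, add_sub_cancel_right]
        exact hp
      · rintro ⟨a, ha, s, hs, rfl⟩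
        refine ⟨_, ha, s, hs, ?_⟩
        rw [add_smul, mul_smul, ← huθ, add_assoc]
    rw [hexp]
    by_cases hne : (lineFiber θ K y).Nonempty
    · rw [indicator_of_mem ((hproj y).1 hne)]
      have hcl : IsCompact (lineFiber θ K y) := by
        refine (Metric.isCompact_iff_isClosed_bounded).2
          ⟨hK.isClosed.preimage (by fun_prop), ?_⟩
        obtain ⟨R, hR⟩ := hK.isBounded.subset_ball 0
        obtain ⟨s, -, hs⟩ := lineFiber_ball hθ (inner_eq_zero_of_mem_orthogonal_span hS y)
          (abs_nonneg R)
        refine Metric.isBounded_Ioo (-s) s |>.subset ?_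
        rw [← hs]
        exact fun t ht => Metric.ball_subset_ball (le_abs_self R) (hR ht)
      have hcv : Convex ℝ (lineFiber θ K y) := by
        have : lineFiber θ K y = AffineMap.lineMap (k := ℝ) (y : EuclideanSpace ℝ (Fin n))
            ((y : EuclideanSpace ℝ (Fin n)) + θ) ⁻¹' K := by
          ext t; simp [lineFiber, AffineMap.lineMap_apply, add_comm]
        rw [this]
        exact hKc.affine_preimage _
      obtain ⟨a, ha, b, hb, hab, hI⟩ := exists_Icc_eq_of_isCompact_of_convex hcl hcv hne
      have : {t | ∃ a ∈ lineFiber θ K y, ∃ s ∈ Icc 0 N, t = a + s * ‖u‖} =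
          Icc a (b + N * ‖u‖) := by
        rw [hI]
        ext t
        constructor
        · rintro ⟨c, hc, s, hs, rfl⟩
          have h1 := mul_le_mul_of_nonneg_right hs.2 hu0.le
          have h2 := mul_nonneg hs.1 hu0.le
          exact ⟨by linarith [hc.1], by linarith [hc.2]⟩
        · rintro ⟨h1, h2⟩
          by_cases htb : t ≤ b
          · exact ⟨t, ⟨h1, htb⟩, 0, ⟨le_rfl, hN⟩, by simp⟩
          · push Not at htb
            refine ⟨b, ⟨hab, le_rfl⟩, (t - b) / ‖u‖, ⟨div_nonneg (by linarith) hu0.le, ?_⟩, ?_⟩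
            · rw [div_le_iff₀ hu0]; linarith
            · rw [div_mul_cancel₀ _ hu0.ne']; ring
      rw [this, hI, Real.volume_Icc, Real.volume_Icc, ← ENNReal.ofReal_add (by linarith)
        (by positivity)]
      congr 1; ring
    · rw [indicator_of_notMem fun h => hne ((hproj y).2 h)]
      rw [not_nonempty_iff_eq_empty] at hne
      simp [hne]
  have hPm : MeasurableSet (S.orthogonalProjectionOnto '' K) :=
    (hK.image S.orthogonalProjectionOnto.continuous).measurableSet
  have hm : Measurable fun y : S => volume (lineFiber θ K y) :=
    (measurable_volume_lineFiber hK.measurableSet).comp measurable_subtype_coe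
  rw [volume_eq_lintegral_lineFiber hθ hS hcompact.measurableSet,
    volume_eq_lintegral_lineFiber hθ hS hK.measurableSet, lintegral_congr hfib,
    lintegral_add_left hm, lintegral_indicator_const hPm, projectionBodySupport,
    ENNReal.ofReal_mul hN, mul_assoc]

/-- The length of the image of a compact convex set under a linear form is an even convex function
of the form. -/
theorem volume_image_linearForm {k : ℕ} {G : Set (Fin k → ℝ)} (hG : IsCompact G)
    (hGc : Convex ℝ G) (t t' : Fin k → ℝ) {a b : ℝ} (ha : 0 ≤ a) (hb : 0 ≤ b) :
    volume ((fun d : Fin k → ℝ => ∑ j, d j * (a • t + b • t') j) '' G) ≤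
      ENNReal.ofReal a * volume ((fun d : Fin k → ℝ => ∑ j, d j * t j) '' G) +
      ENNReal.ofReal b * volume ((fun d : Fin k → ℝ => ∑ j, d j * t' j) '' G) := by
  rcases G.eq_empty_or_nonempty with rfl | hne
  · simp
  have hcpt : ∀ t : Fin k → ℝ, IsCompact ((fun d : Fin k → ℝ => ∑ j, d j * t j) '' G) :=
    fun t => hG.image (by fun_prop)
  have hcvx : ∀ t : Fin k → ℝ, Convex ℝ ((fun d : Fin k → ℝ => ∑ j, d j * t j) '' G) := by
    intro t
    refine hGc.is_linear_image ⟨fun x y => ?_, fun c x => ?_⟩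
    · simp [add_mul, Finset.sum_add_distrib]
    · simp [Finset.mul_sum, mul_assoc]
  have hwidth : ∀ (t : Fin k → ℝ), ∀ d ∈ G, ∀ d' ∈ G,
      ENNReal.ofReal (∑ j, d j * t j - ∑ j, d' j * t j) ≤
        volume ((fun d : Fin k → ℝ => ∑ j, d j * t j) '' G) := by
    intro t d hd d' hd'
    rw [← Real.volume_Icc]
    exact measure_mono ((hcvx t).ordConnected.out (mem_image_of_mem _ hd') (mem_image_of_mem _ hd))
  -- The extremes of the combined form are attained at `d` and `d'`. The difference of its values
  -- there is linear in the form, and for `t` and `t'` separately such a difference is at most the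
  -- length of the image.
  obtain ⟨_, ⟨d', hd', rfl⟩, _, ⟨d, hd, rfl⟩, -, hI⟩ := exists_Icc_eq_of_isCompact_of_convex
    (hcpt (a • t + b • t')) (hcvx _) (hne.image _)
  rw [hI, Real.volume_Icc]
  have e : ∑ j, d j * (a • t + b • t') j - ∑ j, d' j * (a • t + b • t') j =
      a * (∑ j, d j * t j - ∑ j, d' j * t j) + b * (∑ j, d j * t' j - ∑ j, d' j * t' j) := by
    simp only [Pi.add_apply, Pi.smul_apply, smul_eq_mul, mul_sub, Finset.mul_sum]
    simp only [← Finset.sum_sub_distrib, ← Finset.sum_add_distrib]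
    exact Finset.sum_congr rfl fun j _ => by ring
  simp only at e ⊢
  rw [e]
  refine ENNReal.ofReal_add_le.trans ?_
  rw [ENNReal.ofReal_mul ha, ENNReal.ofReal_mul hb]
  gcongr
  · exact hwidth t d hd d' hd'
  · exact hwidth t' d hd d' hd'

theorem volume_image_linearForm_neg {k : ℕ} (G : Set (Fin k → ℝ)) (t : Fin k → ℝ) :
    volume ((fun d : Fin k → ℝ => ∑ j, d j * (-t) j) '' G) =
      volume ((fun d : Fin k → ℝ => ∑ j, d j * t j) '' G) := by
  rw [← Measure.measure_neg volume ((fun d : Fin k → ℝ => ∑ j, d j * t j) '' G)]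
  congr 1
  ext s
  simp [neg_eq_iff_eq_neg]

/-- The set of combinations `∑ dⱼ zⱼ` with coefficient vector `d ∈ D`. -/
def combinations {n k : ℕ} (D : Set (Fin k → ℝ)) (z : Fin k → EuclideanSpace ℝ (Fin n)) :
    Set (EuclideanSpace ℝ (Fin n)) :=
  (fun d : Fin k → ℝ => ∑ j, d j • z j) '' D

theorem isCompact_combinations {n k : ℕ} {D : Set (Fin k → ℝ)} (hD : IsCompact D)
    (z : Fin k → EuclideanSpace ℝ (Fin n)) : IsCompact (combinations D z) :=
  hD.image (by fun_prop)

/-- The incidence set of pairs (columns, point of the combination set) is the projection of a closed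
set along the compact `D`, hence closed; volumes of sections of a measurable set are measurable. -/
theorem measurable_volume_combinations {n k : ℕ} {D : Set (Fin k → ℝ)} (hD : IsCompact D) :
    Measurable fun z : Fin k → EuclideanSpace ℝ (Fin n) => volume (combinations D z) := by
  have hcl : IsClosed {q : (Fin k → EuclideanSpace ℝ (Fin n)) × EuclideanSpace ℝ (Fin n) |
      q.2 ∈ combinations D q.1} := by
    have : CompactSpace D := isCompact_iff_compactSpace.1 hD
    have e : {q : (Fin k → EuclideanSpace ℝ (Fin n)) × EuclideanSpace ℝ (Fin n) |
        q.2 ∈ combinations D q.1} =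
        Prod.fst '' {p : ((Fin k → EuclideanSpace ℝ (Fin n)) × EuclideanSpace ℝ (Fin n)) × D |
          ∑ j, (p.2 : Fin k → ℝ) j • p.1.1 j = p.1.2} := by
      ext q
      simp [combinations]
    rw [e]
    refine isClosedMap_fst_of_compactSpace _ (isClosed_eq (continuous_finsetSum _ fun j _ => ?_)
      (by fun_prop))
    exact ((continuous_apply j).comp (continuous_subtype_val.comp continuous_snd)).smul
      ((continuous_apply j).comp (continuous_fst.comp continuous_fst))
  exact measurable_measure_prodMk_left hcl.measurableSet

/-- Comparing the components orthogonal and parallel to `θ` shows that the admissible coefficient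
vectors depend on `w` and `y` but not on `t`. The speeds enter only through the linear form, which
is the source of convexity in `t`. -/
theorem lineFiber_combinations {n k : ℕ} (D : Set (Fin k → ℝ)) {θ : EuclideanSpace ℝ (Fin n)}
    (hθ : ‖θ‖ = 1) {y : Fin k → EuclideanSpace ℝ (Fin n)} (hy : ∀ j, inner ℝ θ (y j) = 0)
    (t : Fin k → ℝ) {w : EuclideanSpace ℝ (Fin n)} (hw : inner ℝ θ w = 0) :
    lineFiber θ (combinations D fun j => y j + t j • θ) w =
      (fun d : Fin k → ℝ => ∑ j, d j * t j) '' (D ∩ {d | ∑ j, d j • y j = w}) := by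
  have hsum : ∀ d : Fin k → ℝ, ∑ j, d j • (y j + t j • θ) =
      ∑ j, d j • y j + (∑ j, d j * t j) • θ := by
    intro d
    simp only [smul_add, Finset.sum_add_distrib, Finset.sum_smul, mul_smul]
  ext s
  constructor
  · rintro ⟨d, hd, h⟩
    simp only [hsum] at h
    have h1 := congrArg (inner ℝ θ) h
    have hyd : inner ℝ θ (∑ j, d j • y j) = 0 := by
      simp [inner_sum, inner_smul_right, hy]
    simp only [inner_add_right, inner_smul_right, hw, hyd, real_inner_self_eq_norm_sq, hθ] at h1
    have h2 : ∑ j, d j * t j = s := by linarith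
    rw [h2] at h
    exact ⟨d, ⟨hd, add_right_cancel h⟩, h2⟩
  · rintro ⟨d, ⟨hd, hdw⟩, rfl⟩
    refine ⟨d, hd, ?_⟩
    simp only [hsum]
    rw [hdw]

/-- Along a shadow system the volume of a compact convex set of combinations is convex and even. -/
theorem volume_combinations_shadow {n k : ℕ} {D : Set (Fin k → ℝ)} (hD : IsCompact D)
    (hDc : Convex ℝ D) {θ : EuclideanSpace ℝ (Fin n)} (hθ : ‖θ‖ = 1)
    {y : Fin k → EuclideanSpace ℝ (Fin n)} (hy : ∀ j, inner ℝ θ (y j) = 0) :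
    (∀ t t' : Fin k → ℝ, ∀ a b : ℝ, 0 ≤ a → 0 ≤ b →
      volume (combinations D fun j => y j + (a • t + b • t') j • θ) ≤
        ENNReal.ofReal a * volume (combinations D fun j => y j + t j • θ) +
        ENNReal.ofReal b * volume (combinations D fun j => y j + t' j • θ)) ∧
    ∀ t : Fin k → ℝ, volume (combinations D fun j => y j + (-t) j • θ) =
      volume (combinations D fun j => y j + t j • θ) := by
  have hG : ∀ w, IsCompact (D ∩ {d : Fin k → ℝ | ∑ j, d j • y j = w}) := fun w =>
    hD.inter_right (isClosed_eq (by fun_prop) continuous_const)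
  have hGc : ∀ w, Convex ℝ (D ∩ {d : Fin k → ℝ | ∑ j, d j • y j = w}) := by
    intro w
    refine hDc.inter fun d hd d' hd' a b ha hb hab => ?_
    simp only [mem_ofPred_eq] at hd hd' ⊢
    simp only [Pi.add_apply, Pi.smul_apply, smul_eq_mul, add_smul, mul_smul,
      Finset.sum_add_distrib, ← Finset.smul_sum, hd, hd']
    rw [← add_smul, hab, one_smul]
  have hm : ∀ t : Fin k → ℝ, MeasurableSet (combinations D fun j => y j + t j • θ) := fun t =>
    (isCompact_combinations hD _).measurableSet
  have hfm : ∀ t : Fin k → ℝ, Measurable fun w : (Submodule.span ℝ {θ})ᗮ =>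
      volume (lineFiber θ (combinations D fun j => y j + t j • θ) w) := fun t =>
    (measurable_volume_lineFiber (hm t)).comp measurable_subtype_coe
  constructor
  · intro t t' a b ha hb
    rw [volume_eq_lintegral_lineFiber hθ rfl (hm _), volume_eq_lintegral_lineFiber hθ rfl (hm t),
      volume_eq_lintegral_lineFiber hθ rfl (hm t'), ← lintegral_const_mul _ (hfm t),
      ← lintegral_const_mul _ (hfm t'), ← lintegral_add_left ((hfm t).const_mul _)]
    refine lintegral_mono fun w => ?_
    have hw := inner_eq_zero_of_mem_orthogonal_span rfl w
    dsimp only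
    rw [lineFiber_combinations D hθ hy _ hw, lineFiber_combinations D hθ hy _ hw,
      lineFiber_combinations D hθ hy _ hw]
    exact volume_image_linearForm (hG w) (hGc w) t t' ha hb
  · intro t
    rw [volume_eq_lintegral_lineFiber hθ rfl (hm _), volume_eq_lintegral_lineFiber hθ rfl (hm t)]
    refine lintegral_congr fun w => ?_
    have hw := inner_eq_zero_of_mem_orthogonal_span rfl w
    rw [lineFiber_combinations D hθ hy _ hw, lineFiber_combinations D hθ hy _ hw]
    exact volume_image_linearForm_neg _ t

/-- The coefficient set `[0, N] × C`. -/
def segmentProd {m : ℕ} (C : Set (EuclideanSpace ℝ (Fin m))) (N : ℝ) : Set (Fin (m + 1) → ℝ) :=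
  {d | d 0 ∈ Icc 0 N ∧ WithLp.toLp 2 (Fin.tail d) ∈ C}

theorem segmentProd_eq_image {m : ℕ} (C : Set (EuclideanSpace ℝ (Fin m))) (N : ℝ) :
    segmentProd C N = (fun p : ℝ × EuclideanSpace ℝ (Fin m) =>
      (Fin.cons p.1 (WithLp.ofLp p.2) : Fin (m + 1) → ℝ)) '' (Icc 0 N ×ˢ C) := by
  ext d
  constructor
  · rintro ⟨h0, h1⟩
    exact ⟨(d 0, WithLp.toLp 2 (Fin.tail d)), ⟨h0, h1⟩, Fin.cons_self_tail d⟩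
  · rintro ⟨⟨s, c⟩, ⟨hs, hc⟩, rfl⟩
    exact ⟨by simpa using hs, by simpa using hc⟩

theorem isCompact_segmentProd {m : ℕ} {C : Set (EuclideanSpace ℝ (Fin m))} (hC : IsCompact C)
    (N : ℝ) : IsCompact (segmentProd C N) := by
  rw [segmentProd_eq_image]
  refine (isCompact_Icc.prod hC).image (continuous_pi fun i => ?_)
  refine Fin.cases ?_ (fun i => ?_) i
  · simpa using continuous_fst
  · simp only [Fin.cons_succ]
    fun_prop

theorem convex_segmentProd {m : ℕ} {C : Set (EuclideanSpace ℝ (Fin m))} (hC : Convex ℝ C)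
    (N : ℝ) : Convex ℝ (segmentProd C N) := by
  intro d hd d' hd' a b ha hb hab
  exact ⟨convex_Icc (0 : ℝ) N hd.1 hd'.1 ha hb hab, hC hd.2 hd'.2 ha hb hab⟩

theorem isCompact_matrixImage {n m : ℕ} {C : Set (EuclideanSpace ℝ (Fin m))} (hC : IsCompact C)
    (x : Fin m → EuclideanSpace ℝ (Fin n)) : IsCompact (matrixImage x C) :=
  hC.image (by fun_prop)

theorem convex_matrixImage {n m : ℕ} {C : Set (EuclideanSpace ℝ (Fin m))} (hC : Convex ℝ C)
    (x : Fin m → EuclideanSpace ℝ (Fin n)) : Convex ℝ (matrixImage x C) := by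
  refine hC.is_linear_image ⟨fun c d => ?_, fun a c => ?_⟩
  · simp [add_smul, Finset.sum_add_distrib]
  · simp [Finset.smul_sum, mul_smul]

/-- Coefficients in `[0,N] × C` applied to the columns `(u, x)` give `XC + [0,N]u`. Thus the support
function of the projection body is read off from volumes to which shadow systems apply. -/
theorem volume_combinations_segmentProd {n m : ℕ} {C : Set (EuclideanSpace ℝ (Fin m))}
    (hC : IsCompact C) (hCc : Convex ℝ C) {N : ℝ} (hN : 0 ≤ N)
    (z : Fin (m + 1) → EuclideanSpace ℝ (Fin n)) :
    volume (combinations (segmentProd C N) z) = volume (matrixImage (Fin.tail z) C) +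
      ENNReal.ofReal N * projectionBodySupport (matrixImage (Fin.tail z) C) (z 0) := by
  rw [← volume_add_segment (isCompact_matrixImage hC _) (convex_matrixImage hCc _) (z 0) hN,
    combinations, segmentProd_eq_image, image_image]
  congr 1
  ext p
  simp only [mem_image, Prod.exists, mem_prod, Fin.sum_univ_succ, Fin.cons_zero, Fin.cons_succ,
    mem_ofPred_eq, matrixImage, Fin.tail]
  constructor
  · rintro ⟨s, c, ⟨hs, hc⟩, rfl⟩
    exact ⟨_, ⟨c, hc, rfl⟩, s, hs, add_comm _ _⟩
  · rintro ⟨_, ⟨c, hc, rfl⟩, s, hs, rfl⟩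
    exact ⟨s, c, ⟨hs, hc⟩, add_comm _ _⟩

/-- The pairs `(u, x₁, …, x_m)` with `u ∈ Π°([x₁ … x_m] C)`. -/
def polarProjectionGraph {m : ℕ} (n : ℕ) (C : Set (EuclideanSpace ℝ (Fin m))) :
    Set (Fin (m + 1) → EuclideanSpace ℝ (Fin n)) :=
  {z | z 0 ∈ polarProjectionBody (matrixImage (Fin.tail z) C)}

theorem volume_matrixImage_ne_top {n m : ℕ} {C : Set (EuclideanSpace ℝ (Fin m))}
    (hC : IsCompact C) (x : Fin m → EuclideanSpace ℝ (Fin n)) : volume (matrixImage x C) ≠ ∞ :=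
  (isCompact_matrixImage hC x).measure_lt_top.ne

/-- The cases `N = 1` and `N = 0` of the volume formula give `|XC| + h` and `|XC|`; as `|XC|` is
finite, `h ≤ 1` becomes an inequality between measurable functions of the tuple. -/
theorem measurableSet_polarProjectionGraph {n m : ℕ} {C : Set (EuclideanSpace ℝ (Fin m))}
    (hC : IsCompact C) (hCc : Convex ℝ C) : MeasurableSet (polarProjectionGraph n C) := by
  have e : polarProjectionGraph n C = {z | volume (combinations (segmentProd C 1) z) ≤
      volume (combinations (segmentProd C 0) z) + 1} := by
    ext z
    rw [mem_ofPred_eq, volume_combinations_segmentProd hC hCc zero_le_one,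
      volume_combinations_segmentProd hC hCc le_rfl, ENNReal.ofReal_one, one_mul,
      ENNReal.ofReal_zero, zero_mul, add_zero,
      ENNReal.add_le_add_iff_left (volume_matrixImage_ne_top hC _)]
    rfl
  rw [e]
  exact measurableSet_le (measurable_volume_combinations (isCompact_segmentProd hC 1))
    ((measurable_volume_combinations (isCompact_segmentProd hC 0)).add_const 1)

theorem ENNReal.le_one_of_forall_nat_mul_le {c h : ℝ≥0∞} (hc : c ≠ ∞)
    (H : ∀ N : ℕ, (N : ℝ≥0∞) * h ≤ c + N) : h ≤ 1 := by
  have hlim : Filter.Tendsto (fun N : ℕ => c * (N : ℝ≥0∞)⁻¹ + 1) Filter.atTop (nhds (c * 0 + 1)) :=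
    (ENNReal.Tendsto.const_mul ENNReal.tendsto_inv_nat_nhds_zero (Or.inr hc)).add_const 1
  rw [mul_zero, zero_add] at hlim
  refine ge_of_tendsto hlim (Filter.eventually_atTop.2 ⟨1, fun N hN => ?_⟩)
  have hN0 : (N : ℝ≥0∞) ≠ 0 := by exact_mod_cast (by omega : N ≠ 0)
  have hNt : (N : ℝ≥0∞) ≠ ∞ := ENNReal.natCast_ne_top N
  calc h = (N : ℝ≥0∞)⁻¹ * (N * h) := by
        rw [← mul_assoc, ENNReal.inv_mul_cancel hN0 hNt, one_mul]
    _ ≤ (N : ℝ≥0∞)⁻¹ * (c + N) := by gcongr; exact H N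
    _ = _ := by rw [mul_add, ENNReal.inv_mul_cancel hN0 hNt, mul_comm]

/-- `V + N h` is convex and even in `t` for every `N`. Here `V` varies with `t`, but it becomes
negligible against `N`, so the condition `h ≤ 1` passes to convex combinations. Evenness of `V` (`N
= 0`) and of `V + h` (`N = 1`) gives evenness of `h`. -/
theorem isSteinerConvex_polarProjectionGraph {n m : ℕ} {C : Set (EuclideanSpace ℝ (Fin m))}
    (hC : IsCompact C) (hCc : Convex ℝ C) : IsSteinerConvex (polarProjectionGraph n C) := by
  intro θ hθ y hy
  set z : (Fin (m + 1) → ℝ) → Fin (m + 1) → EuclideanSpace ℝ (Fin n) := fun t j => y j + t j • θ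
  set V : (Fin (m + 1) → ℝ) → ℝ≥0∞ := fun t => volume (matrixImage (Fin.tail (z t)) C)
  set h : (Fin (m + 1) → ℝ) → ℝ≥0∞ := fun t =>
    projectionBodySupport (matrixImage (Fin.tail (z t)) C) (z t 0)
  have hV : ∀ t, V t ≠ ∞ := fun t => volume_matrixImage_ne_top hC _
  have hcomb : ∀ (N : ℕ) t, volume (combinations (segmentProd C N) (z t)) = V t + N * h t := by
    intro N t
    rw [volume_combinations_segmentProd hC hCc (Nat.cast_nonneg N), ENNReal.ofReal_natCast]
  have hsh := fun N : ℕ => volume_combinations_shadow (isCompact_segmentProd hC (N : ℝ))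
    (convex_segmentProd hCc (N : ℝ)) hθ hy
  constructor
  · intro t ht t' ht' a b ha hb hab
    change h t ≤ 1 at ht
    change h t' ≤ 1 at ht'
    change h (a • t + b • t') ≤ 1
    refine ENNReal.le_one_of_forall_nat_mul_le
      (c := ENNReal.ofReal a * V t + ENNReal.ofReal b * V t')
      (ENNReal.add_ne_top.2 ⟨ENNReal.mul_ne_top ENNReal.ofReal_ne_top (hV t),
        ENNReal.mul_ne_top ENNReal.ofReal_ne_top (hV t')⟩) fun N => ?_
    have key := (hsh N).1 t t' a b ha hb
    change volume (combinations _ (z (a • t + b • t'))) ≤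
      _ * volume (combinations _ (z t)) + _ * volume (combinations _ (z t')) at key
    rw [hcomb, hcomb, hcomb] at key
    calc (N : ℝ≥0∞) * h (a • t + b • t') ≤ _ := le_add_self
      _ ≤ _ := key
      _ ≤ ENNReal.ofReal a * (V t + N * 1) + ENNReal.ofReal b * (V t' + N * 1) := by gcongr
      _ = ENNReal.ofReal a * V t + ENNReal.ofReal b * V t' +
          (ENNReal.ofReal a + ENNReal.ofReal b) * N := by ring
      _ = _ := by rw [← ENNReal.ofReal_add ha hb, hab, ENNReal.ofReal_one, one_mul]
  · intro t ht
    change h t ≤ 1 at ht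
    change h (-t) ≤ 1
    have h0 := (hsh 0).2 t
    have h1 := (hsh 1).2 t
    change volume (combinations _ (z (-t))) = volume (combinations _ (z t)) at h0 h1
    rw [hcomb, hcomb, Nat.cast_zero, zero_mul, zero_mul, add_zero, add_zero] at h0
    rw [hcomb, hcomb, Nat.cast_one, one_mul, one_mul, h0] at h1
    rwa [(ENNReal.add_right_inj (hV t)).1 h1]

/-! ### From product sets to product densities. -/

theorem lintegral_pi_prod {α : Type*} [MeasurableSpace α] {k : ℕ} (μ : Fin k → Measure α)
    [∀ j, SigmaFinite (μ j)] {f : Fin k → α → ℝ≥0∞} (hf : ∀ j, Measurable (f j)) :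
    ∫⁻ x, ∏ j, f j (x j) ∂(Measure.pi μ) = ∏ j, ∫⁻ x, f j x ∂(μ j) := by
  induction k with
  | zero => simp
  | succ k ih =>
    have hm : Measurable fun x : Fin (k + 1) → α => ∏ j, f j (x j) :=
      Finset.measurable_prod _ fun j _ => (hf j).comp (measurable_pi_apply j)
    have hm' : Measurable fun x : Fin k → α => ∏ j, f j.succ (x j) :=
      Finset.measurable_prod _ fun j _ => (hf j.succ).comp (measurable_pi_apply j)
    rw [← (measurePreserving_finCons μ).lintegral_comp hm, Fin.prod_univ_succ,
      ← ih (fun j => μ j.succ) fun j => hf j.succ]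
    simp only [Fin.prod_univ_succ, Fin.cons_zero, Fin.cons_succ]
    exact lintegral_prod_mul (hf 0).aemeasurable hm'.aemeasurable

theorem pi_withDensity {α : Type*} [MeasurableSpace α] {k : ℕ} (μ : Fin k → Measure α)
    [∀ j, SigmaFinite (μ j)] {f : Fin k → α → ℝ≥0∞} (hf : ∀ j, Measurable (f j))
    [∀ j, SigmaFinite ((μ j).withDensity (f j))] :
    Measure.pi (fun j => (μ j).withDensity (f j)) =
      (Measure.pi μ).withDensity fun x => ∏ j, f j (x j) := by
  refine Measure.pi_eq fun s hs => ?_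
  rw [withDensity_apply _ (MeasurableSet.univ_pi hs), Measure.restrict_pi_pi,
    lintegral_pi_prod _ hf]
  exact Finset.prod_congr rfl fun j _ => (withDensity_apply _ (hs j)).symm

/-- Layer-cake formula for a product measure whose factors have densities of the form
`g_j(x) = ∫₀^∞ 1[x ∈ S_j(t)] dt`. -/
theorem pi_withDensity_apply_eq_lintegral_layers {α : Type*} [MeasureSpace α]
    [SigmaFinite (volume : Measure α)] {k : ℕ} {g : Fin k → α → ℝ≥0∞} {S : Fin k → ℝ → Set α}
    [∀ j, SigmaFinite ((volume : Measure α).withDensity (g j))]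
    (hg : ∀ j x, g j x = ∫⁻ t in Ioi (0 : ℝ), (S j t).indicator (fun _ => 1) x)
    (hS : ∀ j, MeasurableSet {p : α × ℝ | p.1 ∈ S j p.2}) {L : Set (Fin k → α)}
    (hL : MeasurableSet L) :
    Measure.pi (fun j => (volume : Measure α).withDensity (g j)) L =
      ∫⁻ t, volume (L ∩ univ.pi fun j => S j (t j))
        ∂(Measure.pi fun _ : Fin k => volume.restrict (Ioi (0 : ℝ))) := by
  have hind : ∀ j, Measurable fun p : α × ℝ => (S j p.2).indicator (fun _ => (1 : ℝ≥0∞)) p.1 :=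
    fun j => (measurable_const.indicator (hS j) :
      Measurable ({p : α × ℝ | p.1 ∈ S j p.2}.indicator fun _ => (1 : ℝ≥0∞)))
  have hgm : ∀ j, Measurable (g j) := by
    intro j
    rw [funext (hg j)]
    exact (hind j).lintegral_prod_right'
  rw [pi_withDensity _ hgm, withDensity_apply _ hL]
  have h1 : ∀ x : Fin k → α, ∏ j, g j (x j) = ∫⁻ t, ∏ j, (S j (t j)).indicator (fun _ => 1) (x j)
      ∂(Measure.pi fun _ : Fin k => volume.restrict (Ioi (0 : ℝ))) := by
    intro x
    rw [lintegral_pi_prod (fun _ : Fin k => volume.restrict (Ioi (0 : ℝ)))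
      (f := fun j t => (S j t).indicator (fun _ => 1) (x j))
      fun j => (hind j).comp measurable_prodMk_left]
    exact Finset.prod_congr rfl fun j _ => hg j (x j)
  simp_rw [h1]
  rw [lintegral_lintegral_swap]
  · refine lintegral_congr fun t => ?_
    have hSt : ∀ j, MeasurableSet (S j (t j)) := fun j =>
      (hS j).preimage (measurable_id.prodMk measurable_const)
    have e : ∀ x : Fin k → α, ∏ j, (S j (t j)).indicator (fun _ => (1 : ℝ≥0∞)) (x j) =
        (univ.pi fun j => S j (t j)).indicator 1 x := by
      intro x
      by_cases hx : x ∈ univ.pi fun j => S j (t j)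
      · rw [indicator_of_mem hx]
        exact Finset.prod_eq_one fun j _ => indicator_of_mem (hx j (mem_univ j)) _
      · rw [indicator_of_notMem hx]
        simp only [mem_pi, mem_univ, true_imp_iff, not_forall] at hx
        obtain ⟨j, hj⟩ := hx
        exact Finset.prod_eq_zero (Finset.mem_univ j) (indicator_of_notMem hj _)
    simp_rw [e]
    rw [lintegral_indicator_one (MeasurableSet.univ_pi hSt),
      Measure.restrict_apply (MeasurableSet.univ_pi hSt), inter_comm]
    rfl
  · refine (Finset.measurable_prod _ fun j _ => ?_).aemeasurable
    have h : Measurable fun p : (Fin k → α) × (Fin k → ℝ) => (p.1 j, p.2 j) := by fun_prop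
    exact (hind j).comp h

noncomputable section

/-- The symmetric decreasing rearrangement of a function with values in `[0,∞]`. -/
def layerRearrangement {n : ℕ} (g : EuclideanSpace ℝ (Fin n) → ℝ≥0∞)
    (x : EuclideanSpace ℝ (Fin n)) : ℝ≥0∞ :=
  ∫⁻ t in Ioi (0 : ℝ), (symmRearrangement {y | ENNReal.ofReal t < g y}).indicator (fun _ => 1) x

end

theorem measurableSet_layer {n : ℕ} {g : EuclideanSpace ℝ (Fin n) → ℝ≥0∞} (hg : Measurable g) :
    MeasurableSet {p : EuclideanSpace ℝ (Fin n) × ℝ | p.1 ∈ {y | ENNReal.ofReal p.2 < g y}} :=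
  measurableSet_lt (ENNReal.measurable_ofReal.comp measurable_snd) (hg.comp measurable_fst)

theorem measurableSet_symmRearrangement_layer {n : ℕ} {g : EuclideanSpace ℝ (Fin n) → ℝ≥0∞}
    (hg : Measurable g) : MeasurableSet {p : EuclideanSpace ℝ (Fin n) × ℝ |
      p.1 ∈ symmRearrangement {y | ENNReal.ofReal p.2 < g y}} := by
  have h1 : Measurable fun t : ℝ => volume.real {y | ENNReal.ofReal t < g y} :=
    (measurable_measure_prodMk_right (measurableSet_layer hg)).ennreal_toReal
  have : {p : EuclideanSpace ℝ (Fin n) × ℝ |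
      p.1 ∈ symmRearrangement {y | ENNReal.ofReal p.2 < g y}} =
      {p | ‖p.1‖ < (volume.real {y | ENNReal.ofReal p.2 < g y} /
        volume.real (Metric.ball (0 : EuclideanSpace ℝ (Fin n)) 1)) ^ (1 / (n : ℝ))} := by
    ext p
    simp [symmRearrangement]
  rw [this]
  exact measurableSet_lt (by fun_prop)
    (((h1.comp measurable_snd).div_const _).pow_const _)

theorem volume_layer_ne_top {n : ℕ} {g : EuclideanSpace ℝ (Fin n) → ℝ≥0∞} (hg : Measurable g)
    (hfin : ∫⁻ x, g x ≠ ∞) {t : ℝ} (ht : 0 < t) : volume {y | ENNReal.ofReal t < g y} ≠ ∞ := by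
  have h := mul_meas_ge_le_lintegral (μ := volume) hg (ENNReal.ofReal t)
  have h2 : volume {y | ENNReal.ofReal t ≤ g y} ≠ ∞ := by
    intro htop
    rw [htop, ENNReal.mul_top (by simpa using ht)] at h
    exact hfin (top_le_iff.1 h)
  exact measure_ne_top_of_subset (fun y (hy : ENNReal.ofReal t < g y) => hy.le) h2

/-- Every layer at positive height keeps its volume, so the total mass is kept; in particular the
rearranged densities define finite measures. -/
theorem lintegral_layerRearrangement {n : ℕ} (hn : 1 ≤ n) {g : EuclideanSpace ℝ (Fin n) → ℝ≥0∞}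
    (hg : Measurable g) (hfin : ∫⁻ x, g x ≠ ∞) : ∫⁻ x, layerRearrangement g x = ∫⁻ x, g x := by
  unfold layerRearrangement
  rw [lintegral_lintegral_swap, lintegral_eq_setLIntegral_measure_ofReal_lt _ hg]
  · refine setLIntegral_congr_fun measurableSet_Ioi fun t ht => ?_
    rw [lintegral_indicator_const (s := symmRearrangement _) measurableSet_ball, one_mul]
    exact volume_symmRearrangement hn _ (volume_layer_ne_top hg hfin ht)
  · exact (measurable_const.indicator (measurableSet_symmRearrangement_layer hg) : Measurable
      ({p : EuclideanSpace ℝ (Fin n) × ℝ | p.1 ∈ symmRearrangement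
        {y | ENNReal.ofReal p.2 < g y}}.indicator fun _ => (1 : ℝ≥0∞))).aemeasurable

/-- Rearrangement inequality for product measures with integrable densities. -/
theorem pi_withDensity_le_layerRearrangement {n k : ℕ} (hn : 1 ≤ n)
    {L : Set (Fin k → EuclideanSpace ℝ (Fin n))} (hL : MeasurableSet L) (hLc : IsSteinerConvex L)
    {g : Fin k → EuclideanSpace ℝ (Fin n) → ℝ≥0∞} (hg : ∀ j, Measurable (g j))
    (hfin : ∀ j, ∫⁻ x, g j x ≠ ∞) :
    Measure.pi (fun j => volume.withDensity (g j)) L ≤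
      Measure.pi (fun j => volume.withDensity (layerRearrangement (g j))) L := by
  have i1 : ∀ j, IsFiniteMeasure (volume.withDensity (g j)) := fun j =>
    isFiniteMeasure_withDensity (hfin j)
  have i2 : ∀ j, IsFiniteMeasure (volume.withDensity (layerRearrangement (g j))) := fun j =>
    isFiniteMeasure_withDensity (by rw [lintegral_layerRearrangement hn (hg j) (hfin j)]
                                    exact hfin j)
  rw [pi_withDensity_apply_eq_lintegral_layers (S := fun j t => {y | ENNReal.ofReal t < g j y})
      (fun j x => ?_) (fun j => measurableSet_layer (hg j)) hL,
    pi_withDensity_apply_eq_lintegral_layers (g := fun j => layerRearrangement (g j))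
      (S := fun j t => symmRearrangement {y | ENNReal.ofReal t < g j y})
      (fun j x => rfl) (fun j => measurableSet_symmRearrangement_layer (hg j)) hL]
  · refine lintegral_mono_ae ?_
    -- Only layers at positive height are known to have finite volume; the other heights form a null
    -- set.
    have hpos : ∀ᵐ t ∂(Measure.pi fun _ : Fin k => volume.restrict (Ioi (0 : ℝ))),
        ∀ j, 0 < t j := by
      refine ae_all_iff.2 fun j => ?_
      exact (Measure.quasiMeasurePreserving_eval (fun _ : Fin k => volume.restrict (Ioi (0 : ℝ)))
        j).ae (ae_restrict_mem measurableSet_Ioi)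
    filter_upwards [hpos] with t ht
    exact volume_inter_pi_le_symmRearrangement hn hL hLc
      (fun j => measurableSet_lt measurable_const (hg j))
      fun j => volume_layer_ne_top (hg j) (hfin j) (ht j)
  · exact (setLIntegral_indicator_ofReal_lt (g j x)).symm

/-- A radially decreasing set differs from its rearrangement at most at the origin and on its
boundary sphere. -/
theorem symmRearrangement_sdiff_subset_zero {n : ℕ} (hn : 1 ≤ n)
    {S : Set (EuclideanSpace ℝ (Fin n))} (hS : volume S ≠ ∞)
    (hrad : ∀ u, u ≠ 0 → ∀ v ∈ S, ‖u‖ ≤ ‖v‖ → u ∈ S) : symmRearrangement S \ S ⊆ {0} := by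
  rintro x ⟨hx, hxS⟩
  by_contra hx0
  -- A nonzero point outside `S` confines `S` to the open ball through that point, whereas `x ∈ S^*`
  -- makes the volume of `S` strictly larger than that of this ball.
  have hsub : S ⊆ Metric.ball 0 ‖x‖ := by
    intro v hv
    rw [mem_ball_zero_iff]
    by_contra h
    exact hxS (hrad x hx0 v hv (not_lt.1 h))
  have hvol := (volume_symmRearrangement hn S hS).trans_le (measure_mono hsub)
  rw [symmRearrangement, mem_ball_zero_iff] at hx
  rw [symmRearrangement] at hvol
  have : Nonempty (Fin n) := ⟨⟨0, hn⟩⟩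
  have hr0 := (norm_nonneg x).trans hx.le
  rw [Measure.addHaar_ball _ _ hr0, Measure.addHaar_ball _ _ (norm_nonneg x),
    ENNReal.mul_le_mul_iff_left (Metric.measure_ball_pos _ _ one_pos).ne' measure_ball_lt_top.ne,
    ENNReal.ofReal_le_ofReal_iff (by positivity), finrank_euclideanSpace_fin] at hvol
  exact absurd hvol (not_le.2 (pow_lt_pow_left₀ hx (norm_nonneg x) (by omega)))

/-- The layers of a radially decreasing function are balls up to the origin and a boundary sphere.
One inequality suffices, since it only has to restore `ν` after all `m + 1` densities have been
rearranged. -/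
theorem layerRearrangement_le_of_radial {n : ℕ} (hn : 1 ≤ n)
    {F : EuclideanSpace ℝ (Fin n) → ℝ≥0∞} (hF : Measurable F) (hfin : ∫⁻ x, F x ≠ ∞)
    (hrad : ∀ u v, u ≠ 0 → ‖u‖ ≤ ‖v‖ → F v ≤ F u) {x : EuclideanSpace ℝ (Fin n)} (hx : x ≠ 0) :
    layerRearrangement F x ≤ F x := by
  rw [← setLIntegral_indicator_ofReal_lt (F x)]
  refine setLIntegral_mono' measurableSet_Ioi fun t ht => ?_
  by_cases h : x ∈ symmRearrangement {y | ENNReal.ofReal t < F y}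
  · have : ENNReal.ofReal t < F x := by
      by_contra hxS
      exact hx (symmRearrangement_sdiff_subset_zero hn (volume_layer_ne_top hF hfin ht)
        (fun u hu v hv huv => lt_of_lt_of_le hv (hrad u v hu huv)) ⟨h, hxS⟩)
    rw [indicator_of_mem h]
    rw [indicator_of_mem (by exact this)]
  · rw [indicator_of_notMem h]
    exact zero_le

/-! ### Expectations for columns with a density: part (a). -/

theorem lintegral_section_eq_pi {n m : ℕ} {L : Set (Fin (m + 1) → EuclideanSpace ℝ (Fin n))}
    (hL : MeasurableSet L) (μ : Fin (m + 1) → Measure (EuclideanSpace ℝ (Fin n)))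
    [∀ j, SigmaFinite (μ j)] :
    ∫⁻ x, μ 0 {u | (Fin.cons u x : Fin (m + 1) → EuclideanSpace ℝ (Fin n)) ∈ L}
      ∂(Measure.pi fun j : Fin m => μ j.succ) = Measure.pi μ L := by
  rw [← (measurePreserving_finCons μ).measure_preimage hL.nullMeasurableSet,
    Measure.prod_apply_symm (measurable_finCons hL)]
  rfl

theorem polarProjectionBody_matrixImage_eq_section {n m : ℕ} (C : Set (EuclideanSpace ℝ (Fin m)))
    (x : Fin m → EuclideanSpace ℝ (Fin n)) : polarProjectionBody (matrixImage x C) =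
      {u | (Fin.cons u x : Fin (m + 1) → EuclideanSpace ℝ (Fin n)) ∈ polarProjectionGraph n C} := by
  ext u
  simp [polarProjectionGraph]

theorem measurableSet_polarProjectionBody_matrixImage {n m : ℕ}
    {C : Set (EuclideanSpace ℝ (Fin m))} (hC : IsCompact C) (hCc : Convex ℝ C)
    (x : Fin m → EuclideanSpace ℝ (Fin n)) :
    MeasurableSet (polarProjectionBody (matrixImage x C)) := by
  rw [polarProjectionBody_matrixImage_eq_section]
  exact (measurableSet_polarProjectionGraph hC hCc).preimage
    (measurable_finCons.comp measurable_prodMk_right)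

theorem measurable_measure_polarProjectionBody {n m : ℕ} {C : Set (EuclideanSpace ℝ (Fin m))}
    (hC : IsCompact C) (hCc : Convex ℝ C) (ν : Measure (EuclideanSpace ℝ (Fin n))) [SFinite ν] :
    Measurable fun x : Fin m → EuclideanSpace ℝ (Fin n) =>
      ν (polarProjectionBody (matrixImage x C)) := by
  simp_rw [polarProjectionBody_matrixImage_eq_section]
  exact measurable_measure_prodMk_right
    (measurable_finCons (measurableSet_polarProjectionGraph hC hCc))

/-- By Tonelli the expectation is the product measure of the polar projection graph, with `F` in
slot zero. All slots are rearranged, and `F^* ≤ F` almost everywhere undoes the change in slot zero.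
-/
theorem lintegral_polarProjectionBody_le_of_integrable {n m : ℕ} (hn : 1 ≤ n)
    {C : Set (EuclideanSpace ℝ (Fin m))} (hC : IsCompact C) (hCc : Convex ℝ C)
    {g F : EuclideanSpace ℝ (Fin n) → ℝ≥0∞} (hg : Measurable g) (hgfin : ∫⁻ x, g x ≠ ∞)
    (hF : Measurable F) (hFfin : ∫⁻ x, F x ≠ ∞)
    (hrad : ∀ u v, u ≠ 0 → ‖u‖ ≤ ‖v‖ → F v ≤ F u) :
    ∫⁻ x, volume.withDensity F (polarProjectionBody (matrixImage x C))
        ∂(Measure.pi fun _ : Fin m => volume.withDensity g) ≤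
      ∫⁻ x, volume.withDensity F (polarProjectionBody (matrixImage x C))
        ∂(Measure.pi fun _ : Fin m => volume.withDensity (layerRearrangement g)) := by
  have hL := measurableSet_polarProjectionGraph (n := n) hC hCc
  set G : Fin (m + 1) → EuclideanSpace ℝ (Fin n) → ℝ≥0∞ := Fin.cons F fun _ => g with hG
  have hGm : ∀ j, Measurable (G j) := Fin.cases hF fun _ => hg
  have hGfin : ∀ j, ∫⁻ x, G j x ≠ ∞ := Fin.cases hFfin fun _ => hgfin
  have i1 : ∀ j, IsFiniteMeasure (volume.withDensity (G j)) := fun j =>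
    isFiniteMeasure_withDensity (hGfin j)
  have i2 : ∀ j, IsFiniteMeasure (volume.withDensity (layerRearrangement (G j))) := fun j =>
    isFiniteMeasure_withDensity (by rw [lintegral_layerRearrangement hn (hGm j) (hGfin j)]
                                    exact hGfin j)
  have key := pi_withDensity_le_layerRearrangement hn hL
    (isSteinerConvex_polarProjectionGraph hC hCc) hGm hGfin
  rw [← lintegral_section_eq_pi hL, ← lintegral_section_eq_pi hL] at key
  simp_rw [← polarProjectionBody_matrixImage_eq_section] at key
  refine key.trans (lintegral_mono fun x => ?_)
  refine withDensity_mono ?_ _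
  have : Nonempty (Fin n) := ⟨⟨0, hn⟩⟩
  filter_upwards [Measure.ae_ne volume (0 : EuclideanSpace ℝ (Fin n))] with x hx
  exact layerRearrangement_le_of_radial hn hF hFfin hrad hx

/-- The inequality for column laws with densities `g` and its rearrangement. -/
theorem lintegral_polarProjectionBody_le {n m : ℕ} (hn : 1 ≤ n)
    {C : Set (EuclideanSpace ℝ (Fin m))} (hC : IsCompact C) (hCc : Convex ℝ C)
    {g : EuclideanSpace ℝ (Fin n) → ℝ≥0∞} (hg : Measurable g) (hgfin : ∫⁻ x, g x ≠ ∞)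
    {ν : Measure (EuclideanSpace ℝ (Fin n))} (hν : IsRadialDecreasing ν) :
    ∫⁻ x, ν (polarProjectionBody (matrixImage x C))
        ∂(Measure.pi fun _ : Fin m => volume.withDensity g) ≤
      ∫⁻ x, ν (polarProjectionBody (matrixImage x C))
        ∂(Measure.pi fun _ : Fin m => volume.withDensity (layerRearrangement g)) := by
  obtain ⟨ρ, hρ, hρ0, rfl⟩ := hν
  have : Nonempty (Fin n) := ⟨⟨0, hn⟩⟩
  set H : EuclideanSpace ℝ (Fin n) → ℝ≥0∞ := fun x => ENNReal.ofReal (ρ ‖x‖)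
  -- Cutting off at height `N` and radius `N` makes the density integrable. The origin is removed
  -- because nothing is assumed about `ρ 0`; off the origin the `F N` are radially decreasing and
  -- increase to `H`.
  set F : ℕ → EuclideanSpace ℝ (Fin n) → ℝ≥0∞ := fun N =>
    (Metric.ball 0 N \ {0}).indicator fun x => min (H x) N
  -- `ρ` is monotone only on the positive half-line, so only its restriction there is known to be
  -- measurable.
  have hρm : Measurable ((Ioi (0 : ℝ)).indicator ρ) := by
    refine measurable_of_restrict_of_restrict_compl (s := Ioi 0) measurableSet_Ioi ?_ ?_
    · have e : (Ioi (0 : ℝ)).domRestrict ((Ioi (0 : ℝ)).indicator ρ) = fun a : Ioi (0 : ℝ) => ρ a :=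
        funext fun a => indicator_of_mem a.2 _
      rw [e]
      exact Antitone.measurable fun a b hab => hρ a.2 b.2 hab
    · have e : (Ioi (0 : ℝ))ᶜ.domRestrict ((Ioi (0 : ℝ)).indicator ρ) = fun _ => 0 :=
        funext fun a => indicator_of_notMem a.2 _
      rw [e]
      exact measurable_const
  have hFm : ∀ N, Measurable (F N) := by
    intro N
    have : F N = (Metric.ball 0 N \ {0}).indicator
        fun x => min (ENNReal.ofReal ((Ioi (0 : ℝ)).indicator ρ ‖x‖)) N := by
      refine indicator_congr fun x hx => ?_
      rw [indicator_of_mem (by simpa using hx.2 : ‖x‖ ∈ Ioi (0 : ℝ))]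
    rw [this]
    refine Measurable.indicator ?_ (measurableSet_ball.diff (measurableSet_singleton 0))
    exact (ENNReal.measurable_ofReal.comp (hρm.comp measurable_norm)).min measurable_const
  have hFfin : ∀ N, ∫⁻ x, F N x ≠ ∞ := by
    intro N
    have hle : ∫⁻ x, F N x ≤ ∫⁻ x : EuclideanSpace ℝ (Fin n),
        (Metric.ball 0 (N : ℝ)).indicator (fun _ => (N : ℝ≥0∞)) x :=
      lintegral_mono fun x => (indicator_le_indicator (min_le_right _ _)).trans
        (indicator_le_indicator_of_subset sdiff_subset (fun _ => zero_le) x)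
    rw [lintegral_indicator_const measurableSet_ball] at hle
    exact ne_top_of_le_ne_top
      (ENNReal.mul_ne_top (ENNReal.natCast_ne_top N) measure_ball_lt_top.ne) hle
  have hFrad : ∀ N u v, u ≠ 0 → ‖u‖ ≤ ‖v‖ → F N v ≤ F N u := by
    intro N u v hu huv
    by_cases hv : v ∈ Metric.ball (0 : EuclideanSpace ℝ (Fin n)) N \ {0}
    · have hu' : u ∈ Metric.ball (0 : EuclideanSpace ℝ (Fin n)) N \ {0} := by
        refine ⟨?_, hu⟩
        rw [mem_ball_zero_iff]
        exact huv.trans_lt (mem_ball_zero_iff.1 hv.1)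
      simp only [F]
      rw [indicator_of_mem hv, indicator_of_mem hu']
      refine min_le_min_right _ (ENNReal.ofReal_le_ofReal ?_)
      exact hρ (norm_pos_iff.2 hu) (norm_pos_iff.2 hv.2) huv
    · simp only [F]
      rw [indicator_of_notMem hv]
      exact zero_le
  have hFmono : Monotone F := by
    intro N N' h x
    have h' : (N : ℝ≥0∞) ≤ N' := by exact_mod_cast h
    have hsub : Metric.ball (0 : EuclideanSpace ℝ (Fin n)) N \ {0} ⊆ Metric.ball 0 N' \ {0} :=
      sdiff_subset_sdiff_left (Metric.ball_subset_ball (by exact_mod_cast h))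
    exact (indicator_le_indicator_of_subset hsub (fun _ => zero_le) x).trans
      (indicator_le_indicator (min_le_min_left (H x) h'))
  have hFsup : ∀ x, x ≠ 0 → ⨆ N, F N x = H x := by
    intro x hx
    refine le_antisymm (iSup_le fun N => ?_) ?_
    · by_cases h : x ∈ Metric.ball (0 : EuclideanSpace ℝ (Fin n)) N \ {0}
      · simp only [F]; rw [indicator_of_mem h]; exact min_le_left _ _
      · simp only [F]; rw [indicator_of_notMem h]; exact zero_le
    · obtain ⟨N, hN⟩ := exists_nat_gt (max ‖x‖ (ρ ‖x‖))
      obtain ⟨h1, h2⟩ := max_lt_iff.1 hN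
      refine le_iSup_of_le N ?_
      simp only [F]
      rw [indicator_of_mem (show x ∈ Metric.ball 0 (N : ℝ) \ {0} from ⟨by simpa using h1, hx⟩),
        le_min_iff]
      exact ⟨le_rfl, ENNReal.ofReal_le_of_le_toReal (by simpa using h2.le)⟩
  have hνsup : ∀ s, MeasurableSet s → volume.withDensity H s = ⨆ N, volume.withDensity (F N) s := by
    intro s hs
    rw [withDensity_apply _ hs]
    simp_rw [withDensity_apply _ hs]
    rw [← lintegral_iSup hFm hFmono]
    refine lintegral_congr_ae (ae_restrict_of_ae ?_)
    filter_upwards [Measure.ae_ne volume (0 : EuclideanSpace ℝ (Fin n))] with x hx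
    exact (hFsup x hx).symm
  have i1 : ∀ N, IsFiniteMeasure (volume.withDensity (F N)) := fun N =>
    isFiniteMeasure_withDensity (hFfin N)
  simp_rw [fun x => hνsup _ (measurableSet_polarProjectionBody_matrixImage hC hCc x)]
  rw [lintegral_iSup (fun N => measurable_measure_polarProjectionBody hC hCc _)]
  · refine iSup_le fun N => ?_
    refine (lintegral_polarProjectionBody_le_of_integrable hn hC hCc hg hgfin (hFm N) (hFfin N)
      (hFrad N)).trans (lintegral_mono fun x => ?_)
    exact le_iSup (fun N => volume.withDensity (F N) (polarProjectionBody (matrixImage x C))) N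
  · intro N N' h x
    exact withDensity_mono (Filter.Eventually.of_forall (hFmono h)) _

theorem symmRearrangement_congr {n : ℕ} {A A' : Set (EuclideanSpace ℝ (Fin n))}
    (h : volume A = volume A') : symmRearrangement A = symmRearrangement A' := by
  have h' : volume.real A = volume.real A' := congrArg ENNReal.toReal h
  rw [symmRearrangement, symmRearrangement, h']

theorem symmRearrangement_empty {n : ℕ} (hn : 1 ≤ n) :
    symmRearrangement (∅ : Set (EuclideanSpace ℝ (Fin n))) = ∅ := by
  rw [symmRearrangement, measureReal_empty, zero_div, Real.zero_rpow, Metric.ball_zero]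
  -- In dimension zero the exponent would be `1 / 0 = 0` and the radius `0 ^ 0 = 1`, giving a
  -- nonempty ball.
  have : (n : ℝ) ≠ 0 := by exact_mod_cast (by omega : n ≠ 0)
  exact one_div_ne_zero this

/-- Only the volumes of the superlevel sets enter, so a density may be replaced by a measurable
representative of its almost everywhere class. -/
theorem symmDecrRearrangement_eq_layerRearrangement {n : ℕ} {f : EuclideanSpace ℝ (Fin n) → ℝ}
    {g : EuclideanSpace ℝ (Fin n) → ℝ≥0∞} (h : (fun x => ENNReal.ofReal (f x)) =ᵐ[volume] g) :
    symmDecrRearrangement f = layerRearrangement g := by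
  ext x
  refine setLIntegral_congr_fun measurableSet_Ioi fun t ht => ?_
  have hvol : volume {y | t < f y} = volume {y | ENNReal.ofReal t < g y} := by
    refine measure_congr ?_
    filter_upwards [h] with y hy
    refine propext ?_
    change t < f y ↔ ENNReal.ofReal t < g y
    rw [← hy, ENNReal.ofReal_lt_ofReal_iff_of_nonneg (le_of_lt ht)]
  rw [symmRearrangement_congr hvol]

theorem lintegral_comp_hasIIDColumns {n m : ℕ} {Ω : Type*} [MeasurableSpace Ω] {P : Measure Ω}
    [IsProbabilityMeasure P] {X : Fin m → Ω → EuclideanSpace ℝ (Fin n)}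
    {g : EuclideanSpace ℝ (Fin n) → ℝ≥0∞} (hX : HasIIDColumns P X g)
    {Φ : (Fin m → EuclideanSpace ℝ (Fin n)) → ℝ≥0∞} (hΦ : Measurable Φ) :
    ∫⁻ ω, Φ (fun j => X j ω) ∂P = ∫⁻ x, Φ x ∂(Measure.pi fun _ : Fin m => volume.withDensity g) := by
  have h := hX.indep.map_fun_eq_pi_map fun j => (hX.measurable j).aemeasurable
  simp_rw [hX.law] at h
  rw [← h, lintegral_map hΦ (measurable_pi_lambda _ hX.measurable)]

theorem sFinite_of_isRadialDecreasing {n : ℕ} {ν : Measure (EuclideanSpace ℝ (Fin n))}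
    (hν : IsRadialDecreasing ν) : SFinite ν := by
  obtain ⟨ρ, -, -, rfl⟩ := hν
  infer_instance

/-- The rearrangement inequality for polar projection bodies of random linear images. -/
theorem lintegral_polarProjectionBody_matrixImage_le {n m : ℕ} (hn : 1 ≤ n)
    {C : Set (EuclideanSpace ℝ (Fin m))} (hC : IsCompact C) (hCc : Convex ℝ C)
    {f : EuclideanSpace ℝ (Fin n) → ℝ} (hf : IsProbDensity f)
    {Ω Ω' : Type*} [MeasurableSpace Ω] [MeasurableSpace Ω'] {P : Measure Ω} {P' : Measure Ω'}
    [IsProbabilityMeasure P] [IsProbabilityMeasure P']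
    {X : Fin m → Ω → EuclideanSpace ℝ (Fin n)} {X' : Fin m → Ω' → EuclideanSpace ℝ (Fin n)}
    (hX : HasIIDColumns P X fun x => ENNReal.ofReal (f x))
    (hX' : HasIIDColumns P' X' (symmDecrRearrangement f))
    {ν : Measure (EuclideanSpace ℝ (Fin n))} (hν : IsRadialDecreasing ν) :
    ∫⁻ ω, ν (polarProjectionBody (matrixImage (fun j => X j ω) C)) ∂P ≤
      ∫⁻ ω, ν (polarProjectionBody (matrixImage (fun j => X' j ω) C)) ∂P' := by
  have := sFinite_of_isRadialDecreasing hν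
  have hm := measurable_measure_polarProjectionBody (n := n) hC hCc ν
  have hfm : AEMeasurable (fun x => ENNReal.ofReal (f x)) volume :=
    hf.integrable.1.aemeasurable.ennreal_ofReal
  have hfin : ∫⁻ x, hfm.mk _ x ≠ ∞ := by
    rw [← lintegral_congr_ae hfm.ae_eq_mk]
    exact hf.integrable.lintegral_lt_top.ne
  rw [lintegral_comp_hasIIDColumns hX hm, lintegral_comp_hasIIDColumns hX' hm,
    symmDecrRearrangement_eq_layerRearrangement hfm.ae_eq_mk,
    withDensity_congr_ae hfm.ae_eq_mk]
  exact lintegral_polarProjectionBody_le hn hC hCc hfm.measurable_mk hfin hν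

/-! ### Uniform samples and random polytopes: part (b). -/

theorem cond_eq_withDensity {n : ℕ} {K : Set (EuclideanSpace ℝ (Fin n))} (hK : MeasurableSet K) :
    ProbabilityTheory.cond volume K =
      volume.withDensity (K.indicator fun _ => (volume K)⁻¹) := by
  rw [withDensity_indicator hK, withDensity_const, ProbabilityTheory.cond]

/-- The superlevel sets are `K` below height `a` and empty from `a` on. Hence the uniform density on
`K` rearranges to the uniform density on `K^*`. -/
theorem layerRearrangement_indicator {n : ℕ} (hn : 1 ≤ n) (K : Set (EuclideanSpace ℝ (Fin n)))
    (a : ℝ≥0∞) : layerRearrangement (K.indicator fun _ => a) =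
      (symmRearrangement K).indicator fun _ => a := by
  ext x
  have hlev : ∀ t : ℝ, {y | ENNReal.ofReal t < K.indicator (fun _ => a) y} =
      if ENNReal.ofReal t < a then K else ∅ := by
    intro t
    ext y
    by_cases hy : y ∈ K <;> by_cases ht : ENNReal.ofReal t < a <;> simp [hy, ht]
  by_cases hx : x ∈ symmRearrangement K
  · rw [indicator_of_mem hx]
    refine Eq.trans ?_ (setLIntegral_indicator_ofReal_lt a)
    refine setLIntegral_congr_fun measurableSet_Ioi fun t _ => ?_
    simp only [hlev]
    by_cases ht : ENNReal.ofReal t < a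
    · simp [ht, hx]
    · simp [ht, symmRearrangement_empty hn]
  · rw [indicator_of_notMem hx]
    refine Eq.trans (setLIntegral_congr_fun measurableSet_Ioi fun t _ => ?_) lintegral_zero
    simp only [hlev]
    by_cases ht : ENNReal.ofReal t < a
    · simp [ht, hx]
    · simp [ht, symmRearrangement_empty hn]

/-- The inequality for independent uniformly distributed columns. -/
theorem lintegral_polarProjectionBody_cond_le {n m : ℕ} (hn : 1 ≤ n)
    {C : Set (EuclideanSpace ℝ (Fin m))} (hC : IsCompact C) (hCc : Convex ℝ C)
    {K : Set (EuclideanSpace ℝ (Fin n))} (hK : MeasurableSet K) (hK0 : volume K ≠ 0)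
    (hKt : volume K ≠ ∞) {ν : Measure (EuclideanSpace ℝ (Fin n))} (hν : IsRadialDecreasing ν) :
    ∫⁻ x, ν (polarProjectionBody (matrixImage x C))
        ∂(Measure.pi fun _ : Fin m => ProbabilityTheory.cond volume K) ≤
      ∫⁻ x, ν (polarProjectionBody (matrixImage x C))
        ∂(Measure.pi fun _ : Fin m => ProbabilityTheory.cond volume (symmRearrangement K)) := by
  have h := lintegral_polarProjectionBody_le hn hC hCc
    (g := K.indicator fun _ => (volume K)⁻¹) (measurable_const.indicator hK) ?_ hν
  · rw [cond_eq_withDensity hK, cond_eq_withDensity (K := symmRearrangement K) measurableSet_ball,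
      volume_symmRearrangement hn K hKt, ← layerRearrangement_indicator hn]
    exact h
  · rw [lintegral_indicator_const hK]
    exact ENNReal.mul_ne_top (ENNReal.inv_ne_top.2 hK0) hKt

/-- The standard simplex in Euclidean space. -/
def euclideanSimplex (m : ℕ) : Set (EuclideanSpace ℝ (Fin m)) :=
  WithLp.toLp 2 '' stdSimplex ℝ (Fin m)

theorem isCompact_euclideanSimplex (m : ℕ) : IsCompact (euclideanSimplex m) :=
  (isCompact_stdSimplex ℝ (Fin m)).image (PiLp.continuous_toLp 2 _)

theorem convex_euclideanSimplex (m : ℕ) : Convex ℝ (euclideanSimplex m) :=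
  (convex_stdSimplex ℝ (Fin m)).is_linear_image (WithLp.linearEquiv 2 ℝ _).symm.isLinear

/-- This makes random polytopes the case `C =` simplex of random linear images. -/
theorem convexHull_range_eq_matrixImage {n m : ℕ} (x : Fin m → EuclideanSpace ℝ (Fin n)) :
    convexHull ℝ (range x) = matrixImage x (euclideanSimplex m) := by
  have hlin : IsLinearMap ℝ fun c : Fin m → ℝ => ∑ j, c j • x j :=
    ⟨fun c d => by simp [add_smul, Finset.sum_add_distrib],
      fun a c => by simp [Finset.smul_sum, mul_smul]⟩
  rw [matrixImage, euclideanSimplex, image_image, ← convexHull_basis_eq_stdSimplex]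
  refine Eq.trans ?_ (hlin.image_convexHull _).symm
  rw [← range_comp]
  congr 2
  ext i
  simp

theorem measurable_measure_polarProjectionBody_convexHull {n : ℕ} (m : ℕ)
    (ν : Measure (EuclideanSpace ℝ (Fin n))) [SFinite ν] :
    Measurable fun x : Fin m → EuclideanSpace ℝ (Fin n) =>
      ν (polarProjectionBody (convexHull ℝ (range x))) := by
  simp_rw [convexHull_range_eq_matrixImage]
  exact measurable_measure_polarProjectionBody (isCompact_euclideanSimplex m)
    (convex_euclideanSimplex m) ν

theorem lintegral_comp_isUniformSample {n m : ℕ} {Ω : Type*} [MeasurableSpace Ω] {P : Measure Ω}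
    [IsProbabilityMeasure P] {Y : Fin m → Ω → EuclideanSpace ℝ (Fin n)}
    {K : Set (EuclideanSpace ℝ (Fin n))} (hY : IsUniformSample P Y K)
    {Φ : (Fin m → EuclideanSpace ℝ (Fin n)) → ℝ≥0∞} (hΦ : Measurable Φ) :
    ∫⁻ ω, Φ (fun j => Y j ω) ∂P =
      ∫⁻ x, Φ x ∂(Measure.pi fun _ : Fin m => ProbabilityTheory.cond volume K) := by
  have h := hY.indep.map_fun_eq_pi_map fun j => (hY.measurable j).aemeasurable
  have hu : ∀ j, P.map (Y j) = ProbabilityTheory.cond volume K := hY.uniform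
  simp_rw [hu] at h
  rw [← h, lintegral_map hΦ (measurable_pi_lambda _ hY.measurable)]

theorem isRadialDecreasing_volume {n : ℕ} :
    IsRadialDecreasing (volume : Measure (EuclideanSpace ℝ (Fin n))) :=
  ⟨fun _ => 1, fun _ _ _ _ _ => le_rfl, fun _ _ => zero_le_one, by simp⟩

theorem IsConvexBody.volume_ne_zero {n : ℕ} {K : Set (EuclideanSpace ℝ (Fin n))}
    (hK : IsConvexBody K) : volume K ≠ 0 :=
  (Measure.measure_pos_of_nonempty_interior _ hK.interior_nonempty).ne'

/-- The inequality for random polytopes in a convex body. -/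
theorem lintegral_volume_polarProjectionBody_convexHull_le {n m : ℕ} (hn : 1 ≤ n)
    {K : Set (EuclideanSpace ℝ (Fin n))} (hK : IsConvexBody K)
    {Ω Ω' : Type*} [MeasurableSpace Ω] [MeasurableSpace Ω'] {P : Measure Ω} {P' : Measure Ω'}
    [IsProbabilityMeasure P] [IsProbabilityMeasure P']
    {Y : Fin m → Ω → EuclideanSpace ℝ (Fin n)} {Y' : Fin m → Ω' → EuclideanSpace ℝ (Fin n)}
    (hY : IsUniformSample P Y K) (hY' : IsUniformSample P' Y' (symmRearrangement K)) :
    ∫⁻ ω, volume (polarProjectionBody (convexHull ℝ (range fun j => Y j ω))) ∂P ≤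
      ∫⁻ ω, volume (polarProjectionBody (convexHull ℝ (range fun j => Y' j ω))) ∂P' := by
  have hm := measurable_measure_polarProjectionBody_convexHull (n := n) m volume
  rw [lintegral_comp_isUniformSample hY hm, lintegral_comp_isUniformSample hY' hm]
  simp_rw [convexHull_range_eq_matrixImage]
  exact lintegral_polarProjectionBody_cond_le hn (isCompact_euclideanSimplex m)
    (convex_euclideanSimplex m) hK.compact.measurableSet hK.volume_ne_zero
    hK.compact.measure_lt_top.ne isRadialDecreasing_volume

/-! ### Petty's projection inequality from random polytopes with many vertices. -/

theorem projectionBodySupport_mono {n : ℕ} {K K' : Set (EuclideanSpace ℝ (Fin n))} (h : K ⊆ K')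
    (x : EuclideanSpace ℝ (Fin n)) : projectionBodySupport K x ≤ projectionBodySupport K' x :=
  mul_le_mul_right (measure_mono (image_mono h)) _

theorem polarProjectionBody_anti {n : ℕ} {K K' : Set (EuclideanSpace ℝ (Fin n))} (h : K ⊆ K') :
    polarProjectionBody K' ⊆ polarProjectionBody K :=
  fun x hx => (projectionBodySupport_mono h x).trans hx

/-- Projection commutes with unions and measure is continuous along increasing unions, so the
support function of the union is the supremum of the support functions. -/
theorem iInter_polarProjectionBody_subset {n : ℕ} {S : ℕ → Set (EuclideanSpace ℝ (Fin n))}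
    (hS : Monotone S) : ⋂ k, polarProjectionBody (S k) ⊆ polarProjectionBody (⋃ k, S k) := by
  intro x hx
  change projectionBodySupport _ x ≤ 1
  have hmono : Monotone fun k => (Submodule.span ℝ {x})ᗮ.orthogonalProjectionOnto '' S k :=
    fun a b hab => image_mono (hS hab)
  rw [projectionBodySupport, image_iUnion, hmono.measure_iUnion, ENNReal.mul_iSup]
  exact iSup_le fun k => mem_iInter.1 hx k

/-- The affine span of `S` is closed and contains the open set `B`, so the hull has interior points.
A convex set with interior points has the same interior as its closure, hence no closure is needed
in the conclusion. -/
theorem subset_convexHull_of_isOpen_of_subset_closure {E : Type*} [NormedAddCommGroup E]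
    [NormedSpace ℝ E] [FiniteDimensional ℝ E] {B S : Set E} (hB : IsOpen B)
    (h : B ⊆ closure S) : B ⊆ convexHull ℝ S := by
  rcases B.eq_empty_or_nonempty with rfl | hne
  · exact empty_subset _
  have hT : Convex ℝ (convexHull ℝ S) := convex_convexHull ℝ S
  have hspan : affineSpan ℝ (convexHull ℝ S) = ⊤ := by
    rw [affineSpan_convexHull]
    refine top_unique ?_
    rw [← hB.affineSpan_eq_top hne, affineSpan_le]
    exact h.trans (closure_minimal (subset_affineSpan ℝ S)
      (AffineSubspace.closed_of_finiteDimensional _))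
  have hint := hT.interior_nonempty_iff_affineSpan_eq_top.2 hspan
  have h1 : B ⊆ interior (closure (convexHull ℝ S)) :=
    interior_maximal (h.trans (closure_mono (subset_convexHull ℝ S))) hB
  rw [hT.interior_closure_eq_interior_of_nonempty_interior hint] at h1
  exact h1.trans interior_subset

theorem monotone_convexHull_range_fin {E : Type*} [AddCommGroup E] [Module ℝ E] (ω : ℕ → E) :
    Monotone fun k : ℕ => convexHull ℝ (range fun j : Fin k => ω j) := by
  intro a b hab
  refine convexHull_mono ?_
  rintro _ ⟨j, rfl⟩
  exact ⟨Fin.castLE hab j, rfl⟩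

theorem convexHull_range_subset_iUnion {E : Type*} [AddCommGroup E] [Module ℝ E] (ω : ℕ → E) :
    convexHull ℝ (range ω) ⊆ ⋃ k : ℕ, convexHull ℝ (range fun j : Fin k => ω j) := by
  refine convexHull_min ?_ (Directed.convex_iUnion
    (monotone_convexHull_range_fin ω).directed_le fun k => convex_convexHull ℝ _)
  rintro _ ⟨j, rfl⟩
  exact mem_iUnion.2 ⟨j + 1, subset_convexHull ℝ _ ⟨Fin.last j, rfl⟩⟩

theorem infinitePi_map_fin {E : Type*} [MeasurableSpace E] (μ : Measure E)
    [IsProbabilityMeasure μ] (k : ℕ) :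
    (Measure.infinitePi fun _ : ℕ => μ).map (fun ω (j : Fin k) => ω j) =
      Measure.pi fun _ : Fin k => μ := by
  rw [← Measure.infinitePi_eq_pi]
  exact Measure.map_infinitePi_infinitePi_of_inj (f := (Fin.val : Fin k → ℕ)) Fin.val_injective

theorem ae_infinitePi_exists_mem {E : Type*} [MeasurableSpace E] (μ : Measure E)
    [IsProbabilityMeasure μ] {U : Set E} (hU : MeasurableSet U) (h : μ U ≠ 0) :
    ∀ᵐ ω ∂(Measure.infinitePi fun _ : ℕ => μ), ∃ j, ω j ∈ U := by
  have hlt : μ Uᶜ < 1 := by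
    rw [prob_compl_eq_one_sub hU]
    exact ENNReal.sub_lt_self ENNReal.one_ne_top one_ne_zero h
  -- Missing `U` in the first `k` draws has probability `μ(Uᶜ)^k`, which tends to zero.
  refine le_antisymm (ge_of_tendsto' (ENNReal.tendsto_pow_atTop_nhds_zero_of_lt_one hlt)
    fun k => ?_) zero_le
  calc _ ≤ Measure.infinitePi (fun _ : ℕ => μ) (Set.pi (Finset.range k) fun _ => Uᶜ) :=
        measure_mono fun ω (hω : ¬∃ j, ω j ∈ U) j _ hj => hω ⟨j, hj⟩
    _ = μ Uᶜ ^ k := by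
        rw [Measure.infinitePi_pi _ fun _ _ => hU.compl, Finset.prod_const, Finset.card_range]

theorem ae_infinitePi_subset_closure_range {E : Type*} [TopologicalSpace E]
    [SecondCountableTopology E] [MeasurableSpace E] [OpensMeasurableSpace E] (μ : Measure E)
    [IsProbabilityMeasure μ] {B : Set E}
    (hB : ∀ U, IsOpen U → (U ∩ B).Nonempty → μ U ≠ 0) :
    ∀ᵐ ω ∂(Measure.infinitePi fun _ : ℕ => μ), B ⊆ closure (range ω) := by
  have hc := TopologicalSpace.countable_countableBasis E
  have hb := TopologicalSpace.isBasis_countableBasis E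
  have : ∀ᵐ ω ∂(Measure.infinitePi fun _ : ℕ => μ),
      ∀ U ∈ TopologicalSpace.countableBasis E, (U ∩ B).Nonempty → ∃ j, ω j ∈ U := by
    rw [ae_ball_iff hc]
    intro U hU
    by_cases hne : (U ∩ B).Nonempty
    · filter_upwards [ae_infinitePi_exists_mem μ (hb.isOpen hU).measurableSet
        (hB U (hb.isOpen hU) hne)] with ω hω _ using hω
    · exact Filter.Eventually.of_forall fun ω h => absurd h hne
  filter_upwards [this] with ω hω x hx
  rw [hb.mem_closure_iff]
  intro U hU hxU
  obtain ⟨j, hj⟩ := hω U hU ⟨x, hxU, hx⟩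
  exact ⟨ω j, hj, mem_range_self j⟩

theorem measurableSet_polarProjectionBody_convexHull {n m : ℕ}
    (x : Fin m → EuclideanSpace ℝ (Fin n)) :
    MeasurableSet (polarProjectionBody (convexHull ℝ (range x))) := by
  rw [convexHull_range_eq_matrixImage]
  exact measurableSet_polarProjectionBody_matrixImage (isCompact_euclideanSimplex m)
    (convex_euclideanSimplex m) x

/-- The hull of points of `K` lies in `K`, and `Π°` reverses inclusions. -/
theorem measure_polarProjectionBody_le_lintegral {n : ℕ} (m : ℕ)
    {K : Set (EuclideanSpace ℝ (Fin n))} (hK : IsConvexBody K)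
    (ν : Measure (EuclideanSpace ℝ (Fin n))) :
    ν (polarProjectionBody K) ≤ ∫⁻ x, ν (polarProjectionBody (convexHull ℝ (range x)))
      ∂(Measure.pi fun _ : Fin m => ProbabilityTheory.cond volume K) := by
  have : IsProbabilityMeasure (ProbabilityTheory.cond volume K) :=
    cond_isProbabilityMeasure_of_finite hK.volume_ne_zero
      (hK.compact.measure_lt_top (μ := volume)).ne
  have hae : ∀ᵐ x ∂(Measure.pi fun _ : Fin m => ProbabilityTheory.cond volume K),
      ∀ j, x j ∈ K := by
    rw [ae_all_iff]
    intro j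
    exact Measure.tendsto_eval_ae_ae.eventually (ae_cond_mem hK.compact.measurableSet)
  calc ν (polarProjectionBody K)
      = ∫⁻ _, ν (polarProjectionBody K)
          ∂(Measure.pi fun _ : Fin m => ProbabilityTheory.cond volume K) := by simp
    _ ≤ _ := by
      refine lintegral_mono_ae ?_
      filter_upwards [hae] with x hx
      exact measure_mono (polarProjectionBody_anti
        (convexHull_min (range_subset_iff.2 hx) hK.convex))

/-- Finiteness of `ν` gives both continuity from above along the decreasing sets `Π°` and the
dominating constant; volume would fail, since `Π°` of the empty hull is the whole space. -/
theorem measure_polarProjectionBody_le_of_isFiniteMeasure {n : ℕ} (hn : 1 ≤ n)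
    {K : Set (EuclideanSpace ℝ (Fin n))} (hK : IsConvexBody K)
    {ν : Measure (EuclideanSpace ℝ (Fin n))} [IsFiniteMeasure ν] (hν : IsRadialDecreasing ν) :
    ν (polarProjectionBody K) ≤ ν (polarProjectionBody (symmRearrangement K)) := by
  have hK0 := hK.volume_ne_zero
  have hKt := (hK.compact.measure_lt_top (μ := volume)).ne
  have hvol := volume_symmRearrangement hn K hKt
  set B := symmRearrangement K with hBdef
  have hBo : IsOpen B := Metric.isOpen_ball
  have : IsProbabilityMeasure (ProbabilityTheory.cond volume B) :=
    cond_isProbabilityMeasure_of_finite (hvol.trans_ne hK0) (hvol.trans_ne hKt)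
  -- One infinite i.i.d. sequence in `K^*` realises the samples of every size at once, with
  -- increasing hulls.
  set Q := Measure.infinitePi fun _ : ℕ => ProbabilityTheory.cond volume B with hQ
  have hproj : ∀ k : ℕ, Measurable fun (ω : ℕ → EuclideanSpace ℝ (Fin n)) (j : Fin k) => ω j :=
    fun k => measurable_pi_lambda _ fun j => measurable_pi_apply _
  have hmeas : ∀ k : ℕ, Measurable fun ω : ℕ → EuclideanSpace ℝ (Fin n) =>
      ν (polarProjectionBody (convexHull ℝ (range fun j : Fin k => ω j))) := fun k =>
    (measurable_measure_polarProjectionBody_convexHull (n := n) k ν).comp (hproj k)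
  have hle : ∀ k : ℕ, ν (polarProjectionBody K) ≤
      ∫⁻ ω, ν (polarProjectionBody (convexHull ℝ (range fun j : Fin k => ω j))) ∂Q := by
    intro k
    refine (measure_polarProjectionBody_le_lintegral k hK ν).trans ?_
    have h := lintegral_polarProjectionBody_cond_le hn (isCompact_euclideanSimplex k)
      (convex_euclideanSimplex k) hK.compact.measurableSet hK0 hKt hν
    simp_rw [← convexHull_range_eq_matrixImage] at h
    refine h.trans_eq ?_
    rw [← infinitePi_map_fin, lintegral_map
      (measurable_measure_polarProjectionBody_convexHull (n := n) k ν) (hproj k)]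
  have hlim := tendsto_lintegral_of_dominated_convergence (μ := Q) (fun _ => ν univ) hmeas
    (fun k => Filter.Eventually.of_forall fun ω => measure_mono (subset_univ _))
    (by simp) (Filter.Eventually.of_forall fun ω => tendsto_measure_iInter_atTop
      (fun k => (measurableSet_polarProjectionBody_convexHull _).nullMeasurableSet)
      (fun a b hab => polarProjectionBody_anti (monotone_convexHull_range_fin ω hab))
      ⟨0, measure_ne_top _ _⟩)
  refine (ge_of_tendsto' hlim hle).trans ?_
  calc _ ≤ ∫⁻ _, ν (polarProjectionBody B) ∂Q := by
        refine lintegral_mono_ae ?_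
        -- Every open set meeting the ball has positive probability, so the sequence is almost
        -- surely dense in the ball and the increasing hulls cover it.
        have hd : ∀ᵐ ω ∂Q, B ⊆ closure (range ω) := by
          refine ae_infinitePi_subset_closure_range _ fun U hU hne => ?_
          rw [cond_apply hBo.measurableSet]
          refine mul_ne_zero (ENNReal.inv_ne_zero.2 (hvol.trans_ne hKt)) ?_
          rw [inter_comm]
          exact ((hU.inter hBo).measure_pos _ hne).ne'
        filter_upwards [hd] with ω hω
        refine measure_mono ((iInter_polarProjectionBody_subset
          (monotone_convexHull_range_fin ω)).trans (polarProjectionBody_anti ?_))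
        exact (subset_convexHull_of_isOpen_of_subset_closure hBo hω).trans
          (convexHull_range_subset_iUnion ω)
    _ = _ := by simp

theorem isRadialDecreasing_restrict_ball {n : ℕ} (R : ℝ) :
    IsRadialDecreasing
      ((volume : Measure (EuclideanSpace ℝ (Fin n))).restrict (Metric.ball 0 R)) := by
  refine ⟨fun r => if r < R then 1 else 0, ?_, ?_, ?_⟩
  · intro a _ b _ hab
    dsimp only
    by_cases hb : b < R
    · rw [if_pos hb, if_pos (hab.trans_lt hb)]
    · rw [if_neg hb]
      positivity
  · intro r _
    dsimp only
    split_ifs <;> norm_num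
  · rw [← withDensity_indicator_one Metric.isOpen_ball.measurableSet]
    congr 1
    ext x
    by_cases hx : ‖x‖ < R <;> simp [indicator, hx]

theorem measure_eq_iSup_restrict_ball {E : Type*} [NormedAddCommGroup E] [MeasurableSpace E]
    [OpensMeasurableSpace E] (μ : Measure E) (s : Set E) :
    μ s = ⨆ k : ℕ, μ.restrict (Metric.ball 0 (k : ℝ)) s := by
  have hmono : Monotone fun k : ℕ => s ∩ Metric.ball (0 : E) k := fun a b hab =>
    inter_subset_inter_right _ (Metric.ball_subset_ball (by exact_mod_cast hab))
  simp_rw [fun k : ℕ => Measure.restrict_apply' (μ := μ) (t := s)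
    (measurableSet_ball (x := (0 : E)) (ε := (k : ℝ)))]
  rw [← hmono.measure_iUnion, ← inter_iUnion, Metric.iUnion_ball_nat, inter_univ]

/-- **Petty's projection inequality**. -/
theorem volume_polarProjectionBody_le {n : ℕ} (hn : 1 ≤ n)
    {K : Set (EuclideanSpace ℝ (Fin n))} (hK : IsConvexBody K) :
    volume (polarProjectionBody K) ≤ volume (polarProjectionBody (symmRearrangement K)) := by
  rw [measure_eq_iSup_restrict_ball volume (polarProjectionBody K),
    measure_eq_iSup_restrict_ball volume (polarProjectionBody (symmRearrangement K))]
  -- Volume restricted to a centred ball is finite and again radial with decreasing density.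
  refine iSup_mono fun k => ?_
  have : IsFiniteMeasure
      ((volume : Measure (EuclideanSpace ℝ (Fin n))).restrict (Metric.ball 0 (k : ℝ))) :=
    isFiniteMeasure_restrict.2 measure_ball_lt_top.ne
  exact measure_polarProjectionBody_le_of_isFiniteMeasure hn hK
    (isRadialDecreasing_restrict_ball _)

theorem theorem1p2 (n : ℕ) (hn : 1 ≤ n) :
    -- the inequality for random linear images of a compact convex set
    (∀ (m : ℕ) (C : Set (EuclideanSpace ℝ (Fin m))), IsCompact C → Convex ℝ C →
      ∀ f : EuclideanSpace ℝ (Fin n) → ℝ, IsProbDensity f →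
      ∀ (Ω Ω' : Type*) [MeasurableSpace Ω] [MeasurableSpace Ω']
        (P : Measure Ω) (P' : Measure Ω') [IsProbabilityMeasure P] [IsProbabilityMeasure P']
        (X : Fin m → Ω → EuclideanSpace ℝ (Fin n)) (X' : Fin m → Ω' → EuclideanSpace ℝ (Fin n)),
        HasIIDColumns P X (fun x => ENNReal.ofReal (f x)) →
        HasIIDColumns P' X' (symmDecrRearrangement f) →
      ∀ ν : Measure (EuclideanSpace ℝ (Fin n)), IsRadialDecreasing ν →
        ∫⁻ ω, ν (polarProjectionBody (matrixImage (fun j => X j ω) C)) ∂P ≤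
          ∫⁻ ω, ν (polarProjectionBody (matrixImage (fun j => X' j ω) C)) ∂P') ∧
    -- the special case of random polytopes
    (∀ (m : ℕ) (K : Set (EuclideanSpace ℝ (Fin n))), IsConvexBody K →
      ∀ (Ω Ω' : Type*) [MeasurableSpace Ω] [MeasurableSpace Ω']
        (P : Measure Ω) (P' : Measure Ω') [IsProbabilityMeasure P] [IsProbabilityMeasure P']
        (Y : Fin m → Ω → EuclideanSpace ℝ (Fin n)) (Y' : Fin m → Ω' → EuclideanSpace ℝ (Fin n)),
        IsUniformSample P Y K →
        IsUniformSample P' Y' (symmRearrangement K) →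
        ∫⁻ ω, volume (polarProjectionBody (convexHull ℝ (range fun j => Y j ω))) ∂P ≤
          ∫⁻ ω, volume (polarProjectionBody (convexHull ℝ (range fun j => Y' j ω))) ∂P') ∧
    -- Petty's projection inequality
    (∀ K : Set (EuclideanSpace ℝ (Fin n)), IsConvexBody K →
      volume (polarProjectionBody K) ≤ volume (polarProjectionBody (symmRearrangement K))) := by
  refine ⟨?_, ?_, ?_⟩
  · intro m C hC hCc f hf Ω Ω' _ _ P P' _ _ X X' hX hX' ν hν
    exact lintegral_polarProjectionBody_matrixImage_le hn hC hCc hf hX hX' hν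
  · intro m K hK Ω Ω' _ _ P P' _ _ Y Y' hY hY'
    exact lintegral_volume_polarProjectionBody_convexHull_le hn hK hY hY'
  · exact fun K hK => volume_polarProjectionBody_le hn hK
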